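/- **Data.** Let $A=(a_{ij})_{i,j\in I}$ be an integer matrix with $a_{ii}\in\{2,0,-2,-4,\dots\}$ and $a_{ij}\le 0$ for $i\ne j$, and let $d_i\in\mathbf Z_{>0}$ $(i\in I)$ be such that $(d_ia_{ij})$ is symmetric; the index set $I$ may be infinite. Put $I^{\rm re}=\{i: a_{ii}=2\}$ and $I^{\rm im}=\{i : a_{ii}\le 0\}$. Let $P$ be a free abelian group, $P^\vee=\operatorname{Hom}(P,\mathbf Z)$, $\alpha_i\in P$, $h_i\in P^\vee$ $(i\in I)$ and $I^{\rm odd}\subset I$, such that $\langle h_i,\alpha_j\rangle=a_{ij}$; the $\alpha_i$ are linearly independent over $\mathbf C$; $a_{ij}\in 2\mathbf Z$ for all $i\in I^{\rm re}\cap I^{\rm odd}$, $j\in I$; and for each $i$ there is $\Lambda_i\in P$ with $\langle h_j,\Lambda_i\rangle=\delta_{ij}$ for all $j\in I$. Put $Q=\sum_i\mathbf Z\alpha_i\subset P$. **The form on $\mathfrak h$.** Let $\mathfrak h=\mathbf C\otimes_{\mathbf Z}P^\vee=\mathfrak h'\oplus\mathfrak h''$, where $\mathfrak h'=\bigoplus_i\mathbf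 C h_i$ and $\mathfrak h''$ is a chosen complement, and let $(\ ,\ )$ be the symmetric bilinear form on $\mathfrak h$ with $(h,h_i)=d_i^{-1}\langle h,\alpha_i\rangle$ for $h\in\mathfrak h$ and $(h',h'')=0$ for $h',h''\in\mathfrak h''$. Assume that this form is non-degenerate, and let $\nu:\mathfrak h\to\mathfrak h^*$, $\nu(h)(h')=(h,h')$, which is then injective. **The superalgebra.** Let $I^\infty=(I^{\rm re}\times\{1\})\sqcup(I^{\rm im}\times\mathbf Z_{>0})$ and write $e_i=e_{i1}$, $f_i=f_{i1}$. The Borcherds–Bozec superalgebra $\mathfrak g=\mathfrak g_{\bar 0}\oplus\mathfrak g_{\bar 1}$ is the Lie superalgebra over $\mathbf C$ generated by $\mathfrak h$ (even) and $e_{il},f_{il}$ for $(i,l)\in I^\infty$ (odd if $i\in I^{\rm odd}$, even otherwise), with the defining relations $$[h,h']=0,\quad [e_{il},f_{jk}]=l\,\delta_{ij}\delta_{kl}h_i,\quad [h,e_{jl}]=l\langle h,\alpha_j\rangle e_{jl},\quad [h,f_{jl}]=-l\langle h,\alpha_j\rangle f_{jl},$$ $$(\operatorname{ad}e_i)^{1-la_{ij}}(e_{jl})=(\operatorname{ad}f_i)^{1-la_{ij}}(f_{jl})=0\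 \text{ for } i\in I^{\rm re},\ (i,1)\ne(j,l),$$ $$[e_{il},e_{jk}]=[f_{il},f_{jk}]=0\ \text{ if } a_{ij}=0$$ (the linear relations of $\mathfrak h$ being kept). For $\alpha\in Q$ put $\mathfrak g_\alpha=\{x\in\mathfrak g:[h,x]=\langle h,\alpha\rangle x\text{ for all }h\in\mathfrak h\}$. **Proposition.** The form $(\ ,\ )$ on $\mathfrak h$ extends to a bilinear form $(\ ,\ )$ on $\mathfrak g$ such that: (a) $(\mathfrak g_\alpha,\mathfrak g_\beta)=0$ for $\alpha,\beta\in Q$ with $\alpha+\beta\ne0$; (b) $(\ ,\ )$ is non-degenerate on $\mathfrak g$; (c) $(\ ,\ )$ is super-symmetric: $(x,y)=(-1)^{|x||y|}(y,x)$ for all homogeneous $x,y\in\mathfrak g$; (d) $(\ ,\ )$ is invariant: $([x,y],z)=(x,[y,z])$ for all $x,y,z\in\mathfrak g$; (e) for every $\alpha\in Q$ (in particular for every positive root), $\alpha$ lies in the image of $\nu$, and $[x,y]=(x,y)\,\nu^{-1}(\alpha)$ for all $x\in\mathfrak g_\alpha$, $y\in\mathfrak g_{-\alpha}$. -/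

import Mathlib

open scoped TensorProduct

noncomputable section

/-! ### Lie superalgebras over the complex numbers -/

/-- The sign `(-1)^{|x||y|}` attached to two parities. -/
def superSign (a b : ZMod 2) : ℂ := (-1) ^ (a.val * b.val)

/-- A Lie superalgebra structure on a complex vector space `L`: a `ℤ/2`-grading and a bilinear
bracket that respects it, with super-skew-symmetry and the super-Jacobi identity. -/
structure LieSuperalgebra (L : Type*) [AddCommGroup L] [Module ℂ L] where
  /-- the superbracket -/
  bracket : L →ₗ[ℂ] L →ₗ[ℂ] L
  /-- the homogeneous components -/
  part : ZMod 2 → Submodule ℂ L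
  isInternal : DirectSum.IsInternal part
  bracket_mem : ∀ a b x y, x ∈ part a → y ∈ part b → bracket x y ∈ part (a + b)
  bracket_skew : ∀ a b x y, x ∈ part a → y ∈ part b →
    bracket x y = -(superSign a b • bracket y x)
  jacobi : ∀ a b x y z, x ∈ part a → y ∈ part b →
    bracket x (bracket y z) = bracket (bracket x y) z + superSign a b • bracket y (bracket x z)

/-! ### Lie superalgebras presented by generators and relations -/

namespace SuperPresentation

variable {X : Type*}

/-- The parity of a nonassociative monomial in generators with parities `p`. -/
def monoParity (p : X → ZMod 2) : FreeMagma X → ZMod 2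
  | .of x => p x
  | .mul m n => monoParity p m + monoParity p n

/-- The span of the monomials of parity `a` in the free nonassociative algebra. -/
def freePart (p : X → ZMod 2) (a : ZMod 2) :
    Submodule ℂ (FreeNonUnitalNonAssocAlgebra ℂ X) :=
  Submodule.span ℂ (MonoidAlgebra.ofMagma ℂ (FreeMagma X) '' {m | monoParity p m = a})

/-- The elements which are set to zero: those coming from the axioms of a Lie superalgebra and
the given relators `R`. -/
inductive Relator (p : X → ZMod 2) (R : Set (FreeNonUnitalNonAssocAlgebra ℂ X)) :
    FreeNonUnitalNonAssocAlgebra ℂ X → Prop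
  | skew (a b : ZMod 2) (x y : FreeNonUnitalNonAssocAlgebra ℂ X) (hx : x ∈ freePart p a)
      (hy : y ∈ freePart p b) : Relator p R (x * y + superSign a b • (y * x))
  | jacobi (a b c : ZMod 2) (x y z : FreeNonUnitalNonAssocAlgebra ℂ X) (hx : x ∈ freePart p a)
      (hy : y ∈ freePart p b) (hz : z ∈ freePart p c) :
      Relator p R (x * (y * z) - (x * y) * z - superSign a b • (y * (x * z)))
  | rel (r : FreeNonUnitalNonAssocAlgebra ℂ X) (hr : r ∈ R) : Relator p R r

/-- The two-sided ideal generated by the relators. -/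
def relIdeal (p : X → ZMod 2) (R : Set (FreeNonUnitalNonAssocAlgebra ℂ X)) :
    Submodule ℂ (FreeNonUnitalNonAssocAlgebra ℂ X) :=
  sInf {J | (∀ r, Relator p R r → r ∈ J) ∧ ∀ x y, x ∈ J ∨ y ∈ J → x * y ∈ J}

/-- The underlying vector space of the Lie superalgebra with generators `X` of parities `p` and
relators `R`. -/
abbrev Presented (p : X → ZMod 2) (R : Set (FreeNonUnitalNonAssocAlgebra ℂ X)) : Type _ :=
  FreeNonUnitalNonAssocAlgebra ℂ X ⧸ relIdeal p R

section

variable {p : X → ZMod 2} {R : Set (FreeNonUnitalNonAssocAlgebra ℂ X)}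

theorem relator_mem {r : FreeNonUnitalNonAssocAlgebra ℂ X} (h : Relator p R r) :
    r ∈ relIdeal p R := by
  rw [relIdeal, Submodule.mem_sInf]
  exact fun J hJ => hJ.1 r h

theorem mul_mem_relIdeal {x y : FreeNonUnitalNonAssocAlgebra ℂ X}
    (h : x ∈ relIdeal p R ∨ y ∈ relIdeal p R) : x * y ∈ relIdeal p R := by
  simp only [relIdeal, Submodule.mem_sInf] at h ⊢
  exact fun J hJ => hJ.2 x y (h.imp (fun h => h J hJ) (fun h => h J hJ))

theorem relIdeal_le {J : Submodule ℂ (FreeNonUnitalNonAssocAlgebra ℂ X)}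
    (h1 : ∀ r, Relator p R r → r ∈ J) (h2 : ∀ x y, x ∈ J ∨ y ∈ J → x * y ∈ J) :
    relIdeal p R ≤ J :=
  sInf_le ⟨h1, h2⟩

end

/-- The bracket of the presented Lie superalgebra, induced by the product of the free
nonassociative algebra. -/
def presentedBracket (p : X → ZMod 2) (R : Set (FreeNonUnitalNonAssocAlgebra ℂ X)) :
    Presented p R →ₗ[ℂ] Presented p R →ₗ[ℂ] Presented p R :=
  (relIdeal p R).liftQ
    { toFun := fun x => (relIdeal p R).mapQ (relIdeal p R)
        (LinearMap.mul ℂ (FreeNonUnitalNonAssocAlgebra ℂ X) x)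
        (fun _ hy => mul_mem_relIdeal (Or.inr hy))
      map_add' := fun x y => by
        refine LinearMap.ext fun z => ?_
        obtain ⟨z, rfl⟩ := Submodule.Quotient.mk_surjective _ z
        exact congrArg (Submodule.Quotient.mk (p := relIdeal p R)) (add_mul x y z)
      map_smul' := fun c x => by
        refine LinearMap.ext fun z => ?_
        obtain ⟨z, rfl⟩ := Submodule.Quotient.mk_surjective _ z
        exact congrArg (Submodule.Quotient.mk (p := relIdeal p R)) (smul_mul_assoc c x z) }
    (fun x hx => by
      rw [LinearMap.mem_ker]
      refine LinearMap.ext fun z => ?_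
      obtain ⟨z, rfl⟩ := Submodule.Quotient.mk_surjective _ z
      exact (Submodule.Quotient.mk_eq_zero _).2 (mul_mem_relIdeal (Or.inl hx)))

/-- The homogeneous components of the presented Lie superalgebra. -/
def presentedPart (p : X → ZMod 2) (R : Set (FreeNonUnitalNonAssocAlgebra ℂ X)) (a : ZMod 2) :
    Submodule ℂ (Presented p R) :=
  (freePart p a).map (relIdeal p R).mkQ

section

variable {p : X → ZMod 2} {R : Set (FreeNonUnitalNonAssocAlgebra ℂ X)}

theorem presentedBracket_mk (x y : FreeNonUnitalNonAssocAlgebra ℂ X) :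
    presentedBracket p R ((relIdeal p R).mkQ x) ((relIdeal p R).mkQ y) =
      (relIdeal p R).mkQ (x * y) := rfl

theorem mul_mem_freePart {a b : ZMod 2} {x y : FreeNonUnitalNonAssocAlgebra ℂ X}
    (hx : x ∈ freePart p a) (hy : y ∈ freePart p b) : x * y ∈ freePart p (a + b) := by
  unfold freePart at hx hy
  induction hx using Submodule.span_induction with
  | zero => simp
  | add x x' _ _ h h' => rw [add_mul]; exact add_mem h h'
  | smul c x _ h => rw [smul_mul_assoc]; exact Submodule.smul_mem _ _ h
  | mem x hx =>
    obtain ⟨m, hm, rfl⟩ := hx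
    induction hy using Submodule.span_induction with
    | zero => simp
    | add x x' _ _ h h' => rw [mul_add]; exact add_mem h h'
    | smul c x _ h => rw [mul_smul_comm]; exact Submodule.smul_mem _ _ h
    | mem y hy =>
      obtain ⟨n, hn, rfl⟩ := hy
      rw [← map_mul]
      refine Submodule.subset_span ⟨m * n, ?_, rfl⟩
      change monoParity p m + monoParity p n = a + b
      rw [hm, hn]

theorem of_mem_freePart (x : X) :
    FreeNonUnitalNonAssocAlgebra.of ℂ x ∈ freePart p (p x) :=
  Submodule.subset_span ⟨FreeMagma.of x, rfl, rfl⟩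

theorem iSup_freePart : freePart p 0 ⊔ freePart p 1 = ⊤ := by
  rw [eq_top_iff]
  rintro x -
  induction x using MonoidAlgebra.induction_linear with
  | zero => exact zero_mem _
  | add x y hx hy => exact add_mem hx hy
  | single m c =>
    have : MonoidAlgebra.single m c = c • MonoidAlgebra.ofMagma ℂ (FreeMagma X) m := by
      simp [MonoidAlgebra.ofMagma]
    rw [this]
    refine Submodule.smul_mem _ _ ?_
    rcases (by decide : ∀ a : ZMod 2, a = 0 ∨ a = 1) (monoParity p m) with h | h
    · exact Submodule.mem_sup_left (Submodule.subset_span ⟨m, h, rfl⟩)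
    · exact Submodule.mem_sup_right (Submodule.subset_span ⟨m, h, rfl⟩)

/-- The parity automorphism of the free algebra. -/
def parityAut (p : X → ZMod 2) :
    FreeNonUnitalNonAssocAlgebra ℂ X →ₙₐ[ℂ] FreeNonUnitalNonAssocAlgebra ℂ X :=
  FreeNonUnitalNonAssocAlgebra.lift ℂ
    (fun x => ((-1 : ℂ) ^ (p x).val) • FreeNonUnitalNonAssocAlgebra.of ℂ x)

theorem parityAut_apply {a : ZMod 2} {x : FreeNonUnitalNonAssocAlgebra ℂ X}
    (hx : x ∈ freePart p a) : parityAut p x = ((-1 : ℂ) ^ a.val) • x := by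
  unfold freePart at hx
  induction hx using Submodule.span_induction with
  | zero => simp
  | add x y _ _ h h' => rw [map_add, h, h', smul_add]
  | smul c x _ h => rw [map_smul, h, smul_comm]
  | mem x hx =>
    obtain ⟨m, rfl, rfl⟩ := hx
    induction m with
    | ih1 x => exact FreeNonUnitalNonAssocAlgebra.lift_of_apply ℂ _ x
    | ih2 m n hm hn =>
      change parityAut p (MonoidAlgebra.ofMagma ℂ (FreeMagma X) (m * n)) =
        ((-1 : ℂ) ^ (monoParity p m + monoParity p n).val) •
          MonoidAlgebra.ofMagma ℂ (FreeMagma X) (m * n)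
      rw [map_mul, map_mul, hm, hn, smul_mul_smul_comm]
      congr 1
      have key : ∀ a b : ZMod 2, (-1 : ℂ) ^ a.val * (-1) ^ b.val = (-1) ^ (a + b).val := by
        intro a b
        rw [← pow_add, ZMod.val_add, ← neg_one_pow_eq_pow_mod_two]
      exact key _ _

theorem relator_homogeneous (hR : ∀ r ∈ R, ∃ a, r ∈ freePart p a)
    {r : FreeNonUnitalNonAssocAlgebra ℂ X} (h : Relator p R r) : ∃ a, r ∈ freePart p a := by
  cases h with
  | skew a b x y hx hy =>
    refine ⟨a + b, add_mem (mul_mem_freePart hx hy) (Submodule.smul_mem _ _ ?_)⟩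
    rw [add_comm]
    exact mul_mem_freePart hy hx
  | jacobi a b c x y z hx hy hz =>
    refine ⟨a + (b + c), sub_mem (sub_mem (mul_mem_freePart hx (mul_mem_freePart hy hz)) ?_)
      (Submodule.smul_mem _ _ ?_)⟩
    · rw [← add_assoc]
      exact mul_mem_freePart (mul_mem_freePart hx hy) hz
    · rw [add_left_comm]
      exact mul_mem_freePart hy (mul_mem_freePart hx hz)
  | rel _ hr => exact hR r hr

theorem parityAut_mem_relIdeal (hR : ∀ r ∈ R, ∃ a, r ∈ freePart p a)
    {x : FreeNonUnitalNonAssocAlgebra ℂ X} (hx : x ∈ relIdeal p R) :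
    parityAut p x ∈ relIdeal p R := by
  have h : relIdeal p R ≤ (relIdeal p R).comap (parityAut p : _ →ₗ[ℂ] _) := by
    refine relIdeal_le (fun r hr => ?_) (fun x y hxy => ?_)
    · obtain ⟨a, ha⟩ := relator_homogeneous hR hr
      change parityAut p r ∈ relIdeal p R
      rw [parityAut_apply ha]
      exact Submodule.smul_mem _ _ (relator_mem hr)
    · change parityAut p (x * y) ∈ relIdeal p R
      rw [map_mul]
      exact mul_mem_relIdeal hxy
  exact h hx

theorem isInternal_presentedPart (hR : ∀ r ∈ R, ∃ a, r ∈ freePart p a) :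
    DirectSum.IsInternal (presentedPart p R) := by
  rw [DirectSum.isInternal_submodule_iff_isCompl (presentedPart p R) (i := 0) (j := 1)
    (by decide) (by ext a; revert a; simp; decide)]
  constructor
  · rw [Submodule.disjoint_def]
    rintro _ ⟨x, hx, rfl⟩ ⟨y, hy, hxy⟩
    have h1 : x - y ∈ relIdeal p R := (Submodule.Quotient.eq _).1 hxy.symm
    have h2 := parityAut_mem_relIdeal hR h1
    rw [map_sub, parityAut_apply hx, parityAut_apply hy] at h2
    have h3 : (2 : ℂ) • x ∈ relIdeal p R := by
      have h4 := add_mem h1 h2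
      have e0 : (0 : ZMod 2).val = 0 := rfl
      have e1 : (1 : ZMod 2).val = 1 := rfl
      rw [e0, e1, pow_zero, pow_one, one_smul, neg_one_smul] at h4
      have : (2 : ℂ) • x = x - y + (x - -y) := by rw [two_smul]; abel
      rwa [this]
    have h5 := Submodule.smul_mem (relIdeal p R) (2⁻¹ : ℂ) h3
    rw [smul_smul, inv_mul_cancel₀ two_ne_zero, one_smul] at h5
    exact (Submodule.Quotient.mk_eq_zero _).2 h5
  · rw [codisjoint_iff, presentedPart, presentedPart, ← Submodule.map_sup, iSup_freePart,
      Submodule.map_top, Submodule.range_mkQ]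

end

/-- The Lie superalgebra presented by generators `X` of parities `p` and homogeneous
relators `R`. -/
def presentedLieSuperalgebra (p : X → ZMod 2) (R : Set (FreeNonUnitalNonAssocAlgebra ℂ X))
    (hR : ∀ r ∈ R, ∃ a, r ∈ freePart p a) : LieSuperalgebra (Presented p R) where
  bracket := presentedBracket p R
  part := presentedPart p R
  isInternal := isInternal_presentedPart hR
  bracket_mem := by
    rintro a b _ _ ⟨x, hx, rfl⟩ ⟨y, hy, rfl⟩
    exact ⟨x * y, mul_mem_freePart hx hy, rfl⟩
  bracket_skew := by
    rintro a b _ _ ⟨x, hx, rfl⟩ ⟨y, hy, rfl⟩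
    rw [eq_neg_iff_add_eq_zero]
    exact (Submodule.Quotient.mk_eq_zero _).2 (relator_mem (.skew a b x y hx hy))
  jacobi := by
    rintro a b _ _ z ⟨x, hx, rfl⟩ ⟨y, hy, rfl⟩
    have hz : z ∈ presentedPart p R 0 ⊔ presentedPart p R 1 := by
      rw [presentedPart, presentedPart, ← Submodule.map_sup, iSup_freePart,
        Submodule.map_top, Submodule.range_mkQ]
      trivial
    have key : ∀ c, ∀ z ∈ presentedPart p R c,
        presentedBracket p R ((relIdeal p R).mkQ x)
            (presentedBracket p R ((relIdeal p R).mkQ y) z) =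
          presentedBracket p R (presentedBracket p R ((relIdeal p R).mkQ x)
            ((relIdeal p R).mkQ y)) z + superSign a b •
          presentedBracket p R ((relIdeal p R).mkQ y)
            (presentedBracket p R ((relIdeal p R).mkQ x) z) := by
      rintro c _ ⟨z, hz, rfl⟩
      rw [← sub_eq_zero, ← sub_sub]
      exact (Submodule.Quotient.mk_eq_zero _).2 (relator_mem (.jacobi a b c x y z hx hy hz))
    obtain ⟨u, hu, v, hv, rfl⟩ := Submodule.mem_sup.1 hz
    simp only [map_add, key 0 u hu, key 1 v hv, smul_add]
    abel

end SuperPresentation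

/-! ### Odd Borcherds-Cartan data -/

/-- The Cartan subalgebra `𝔥 = ℂ ⊗ P^∨`, where `P^∨ = Hom(P, ℤ)`. -/
abbrev Cartan (P : Type*) [AddCommGroup P] : Type _ := ℂ ⊗[ℤ] Module.Dual ℤ P

/-- The functional `h ↦ ⟨h, μ⟩` on `𝔥` given by `μ ∈ P`. -/
def cartanEval {P : Type*} [AddCommGroup P] (μ : P) : Cartan P →ₗ[ℂ] ℂ :=
  (TensorProduct.AlgebraTensorModule.rid ℤ ℂ ℂ).toLinearMap ∘ₗ
    LinearMap.baseChange ℂ (Module.Dual.eval ℤ P μ)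

@[simp]
theorem cartanEval_tmul {P : Type*} [AddCommGroup P] (μ : P) (c : ℂ) (g : Module.Dual ℤ P) :
    cartanEval μ (c ⊗ₜ[ℤ] g) = (g μ : ℂ) * c := by
  simp [cartanEval]

/-- An odd Borcherds-Cartan datum with index set `I` and weight lattice `P`, together with a
choice of a symmetrizing matrix `diag(d_i)`. -/
structure OddBorcherdsCartanDatum (I P : Type*) [AddCommGroup P] where
  /-- the Borcherds-Cartan matrix -/
  A : Matrix I I ℤ
  /-- the entries of the symmetrizing diagonal matrix -/
  d : I → ℤ
  /-- the simple roots -/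
  simpleRoot : I → P
  /-- the simple coroots -/
  simpleCoroot : I → Module.Dual ℤ P
  /-- the odd indices -/
  odd : Set I
  diag : ∀ i, A i i = 2 ∨ (A i i ≤ 0 ∧ Even (A i i))
  off_diag : ∀ i j, i ≠ j → A i j ≤ 0
  d_pos : ∀ i, 0 < d i
  symmetrizes : (Matrix.of fun i j => d i * A i j).IsSymm
  pairing : ∀ i j, simpleCoroot i (simpleRoot j) = A i j
  linearIndependent : LinearIndependent ℂ (fun i => (1 : ℂ) ⊗ₜ[ℤ] simpleRoot i)
  odd_real : ∀ i ∈ odd, A i i = 2 → ∀ j, Even (A i j)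
  fundamental : ∀ i, ∃ Λ : P, simpleCoroot i Λ = 1 ∧ ∀ j, j ≠ i → simpleCoroot j Λ = 0

namespace OddBorcherdsCartanDatum

variable {I P : Type*} [AddCommGroup P] (D : OddBorcherdsCartanDatum I P)

/-- The simple coroot `h_i` as an element of `𝔥`. -/
def coroot (i : I) : Cartan P := (1 : ℂ) ⊗ₜ[ℤ] D.simpleCoroot i

/-- The root lattice `Q`, inside `P`. -/
def rootLattice : AddSubgroup P := AddSubgroup.closure (Set.range D.simpleRoot)

/-- The subspace `𝔥'` spanned by the simple coroots. -/
abbrev cartanPrime : Submodule ℂ (Cartan P) := Submodule.span ℂ (Set.range D.coroot)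

theorem linearIndependent_coroot : LinearIndependent ℂ D.coroot := by
  rw [linearIndependent_iff']
  intro s g hg i hi
  obtain ⟨Λ, h1, h0⟩ := D.fundamental i
  have h := congrArg (cartanEval Λ) hg
  rw [map_sum, map_zero, Finset.sum_eq_single_of_mem i hi] at h
  · simpa [coroot, h1] using h
  · intro j _ hj
    simp [coroot, h0 j hj]

theorem cartanEval_coroot (i j : I) :
    cartanEval (D.simpleRoot j) (D.coroot i) = (D.A i j : ℂ) := by
  simp [coroot, D.pairing]

/-- The linear map `𝔥 → 𝔥^*` that kills the complement `H` of `𝔥'` and sends `h_i` to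
`d_i⁻¹ α_i`. -/
def cartanFormAux (H : Submodule ℂ (Cartan P)) (hH : IsCompl D.cartanPrime H) :
    Cartan P →ₗ[ℂ] Cartan P →ₗ[ℂ] ℂ :=
  Finsupp.linearCombination ℂ (fun i => (D.d i : ℂ)⁻¹ • cartanEval (D.simpleRoot i)) ∘ₗ
    D.linearIndependent_coroot.repr ∘ₗ D.cartanPrime.projectionOnto H hH

/-- The bilinear form on `𝔥 = 𝔥' ⊕ H` determined by `(h, h_i) = d_i⁻¹ ⟨h, α_i⟩` for `h ∈ 𝔥`
and `(h', h'') = 0` for `h', h'' ∈ H`; these properties and the symmetry are proved below. -/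
def cartanForm (H : Submodule ℂ (Cartan P)) (hH : IsCompl D.cartanPrime H) :
    LinearMap.BilinForm ℂ (Cartan P) :=
  D.cartanFormAux H hH +
    (D.cartanFormAux H hH).flip ∘ₗ (LinearMap.id - D.cartanPrime.projection H hH)

section

variable (H : Submodule ℂ (Cartan P)) (hH : IsCompl D.cartanPrime H)

theorem coroot_mem (i : I) : D.coroot i ∈ D.cartanPrime :=
  Submodule.subset_span ⟨i, rfl⟩

theorem cartanFormAux_coroot (i : I) :
    D.cartanFormAux H hH (D.coroot i) = (D.d i : ℂ)⁻¹ • cartanEval (D.simpleRoot i) := by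
  have h1 : D.cartanPrime.projectionOnto H hH (D.coroot i) = ⟨D.coroot i, D.coroot_mem i⟩ :=
    Submodule.projectionOnto_apply_of_mem_left hH (D.coroot_mem i)
  have h2 : D.linearIndependent_coroot.repr ⟨D.coroot i, D.coroot_mem i⟩ =
      Finsupp.single i 1 :=
    D.linearIndependent_coroot.repr_eq_single i _ rfl
  change Finsupp.linearCombination ℂ _ (D.linearIndependent_coroot.repr
    (D.cartanPrime.projectionOnto H hH (D.coroot i))) = _
  rw [h1, h2, Finsupp.linearCombination_single, one_smul]

theorem cartanFormAux_projection (x : Cartan P) :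
    D.cartanFormAux H hH (D.cartanPrime.projection H hH x) = D.cartanFormAux H hH x := by
  change Finsupp.linearCombination ℂ _ (D.linearIndependent_coroot.repr
    (D.cartanPrime.projectionOnto H hH (D.cartanPrime.projectionOnto H hH x))) = _
  rw [Submodule.projectionOnto_apply_left]
  rfl

theorem cartanFormAux_complement {x : Cartan P} (hx : x ∈ H) : D.cartanFormAux H hH x = 0 := by
  rw [← cartanFormAux_projection, (Submodule.projection_apply_eq_zero_iff hH).2 hx, map_zero]

theorem cartanFormAux_symm {x : Cartan P} (hx : x ∈ D.cartanPrime) (i : I) :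
    D.cartanFormAux H hH x (D.coroot i) = D.cartanFormAux H hH (D.coroot i) x := by
  induction hx using Submodule.span_induction with
  | zero => simp
  | add x y _ _ h h' => simp [h, h']
  | smul c x _ h => simp [h]
  | mem x hx =>
    obtain ⟨j, rfl⟩ := hx
    have hi : (D.d i : ℂ) ≠ 0 := by exact_mod_cast (D.d_pos i).ne'
    have hj : (D.d j : ℂ) ≠ 0 := by exact_mod_cast (D.d_pos j).ne'
    have h : (D.d j : ℂ) * D.A j i = D.d i * D.A i j := by
      exact_mod_cast D.symmetrizes.apply i j
    simp only [cartanFormAux_coroot, LinearMap.smul_apply, cartanEval_coroot, smul_eq_mul]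
    field_simp
    linear_combination -h

/-- `(h, h_i) = d_i⁻¹ ⟨h, α_i⟩` for `h ∈ 𝔥`. -/
theorem cartanForm_coroot (x : Cartan P) (i : I) :
    D.cartanForm H hH x (D.coroot i) = (D.d i : ℂ)⁻¹ * cartanEval (D.simpleRoot i) x := by
  have h := D.cartanFormAux_symm H hH (x := D.cartanPrime.projection H hH x)
    (Submodule.projection_apply_mem hH x) i
  rw [cartanFormAux_projection] at h
  simp only [cartanForm, LinearMap.add_apply, LinearMap.comp_apply, LinearMap.sub_apply,
    LinearMap.flip_apply, LinearMap.id_apply, map_sub, h]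
  rw [cartanFormAux_coroot]
  simp

/-- `(h', h'') = 0` for `h', h'' ∈ H`. -/
theorem cartanForm_complement {x y : Cartan P} (hx : x ∈ H) (hy : y ∈ H) :
    D.cartanForm H hH x y = 0 := by
  simp [cartanForm, D.cartanFormAux_complement H hH hx, D.cartanFormAux_complement H hH hy]

theorem cartanForm_symm (x y : Cartan P) :
    D.cartanForm H hH x y = D.cartanForm H hH y x := by
  have key : ∀ z ∈ D.cartanPrime, ∀ w ∈ D.cartanPrime,
      D.cartanFormAux H hH z w = D.cartanFormAux H hH w z := by
    intro z hz w hw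
    induction hw using Submodule.span_induction with
    | zero => simp
    | add u v _ _ h h' => simp [h, h']
    | smul c u _ h => simp [h]
    | mem w hw =>
      obtain ⟨j, rfl⟩ := hw
      exact D.cartanFormAux_symm H hH hz j
  have h := key _ (Submodule.projection_apply_mem hH x) _ (Submodule.projection_apply_mem hH y)
  rw [cartanFormAux_projection, cartanFormAux_projection] at h
  simp only [cartanForm, LinearMap.add_apply, LinearMap.comp_apply, LinearMap.sub_apply,
    LinearMap.flip_apply, LinearMap.id_apply, map_sub]
  linear_combination h

end

/-- The map `ν : 𝔥 → 𝔥^*`, `ν(h)(h') = (h, h')`. -/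
def nu (H : Submodule ℂ (Cartan P)) (hH : IsCompl D.cartanPrime H) :
    Cartan P →ₗ[ℂ] Module.Dual ℂ (Cartan P) :=
  D.cartanForm H hH

/-! ### The Borcherds-Bozec superalgebra -/

/-- The index set `I^∞` of pairs `(i, l)` with `l ≥ 1`, where `l = 1` if `i` is real. -/
abbrev Index : Type _ := {a : I × ℕ // 1 ≤ a.2 ∧ (D.A a.1 a.1 = 2 → a.2 = 1)}

/-- The generators: `e_{il}`, `f_{il}` for `(i, l) ∈ I^∞`, and the elements of `𝔥`. -/
inductive Gen (D : OddBorcherdsCartanDatum I P) : Type _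
  | e (a : D.Index)
  | f (a : D.Index)
  | h (t : Cartan P)

open Classical in
/-- The parity of an index `i ∈ I`. -/
def indexParity (i : I) : ZMod 2 := if i ∈ D.odd then 1 else 0

/-- The parities of the generators. -/
def genParity : D.Gen → ZMod 2
  | .e a => D.indexParity a.1.1
  | .f a => D.indexParity a.1.1
  | .h _ => 0

/-- The generator `e_{il}` in the free nonassociative algebra. -/
def freeE (a : D.Index) : FreeNonUnitalNonAssocAlgebra ℂ D.Gen :=
  FreeNonUnitalNonAssocAlgebra.of ℂ (Gen.e a)

/-- The generator `f_{il}` in the free nonassociative algebra. -/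
def freeF (a : D.Index) : FreeNonUnitalNonAssocAlgebra ℂ D.Gen :=
  FreeNonUnitalNonAssocAlgebra.of ℂ (Gen.f a)

/-- The generator attached to an element of `𝔥` in the free nonassociative algebra. -/
def freeH (t : Cartan P) : FreeNonUnitalNonAssocAlgebra ℂ D.Gen :=
  FreeNonUnitalNonAssocAlgebra.of ℂ (Gen.h t)

/-- The defining relators; the product of the free nonassociative algebra stands for the
superbracket. The first two make the map from `𝔥` linear. In the Serre relators the index `a`
is `(i, 1)` with `i` real, and `b = (j, l)`. -/
inductive IsRelator : FreeNonUnitalNonAssocAlgebra ℂ D.Gen → Prop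
  | h_add (s t : Cartan P) : IsRelator (D.freeH (s + t) - (D.freeH s + D.freeH t))
  | h_smul (c : ℂ) (t : Cartan P) : IsRelator (D.freeH (c • t) - c • D.freeH t)
  | h_h (s t : Cartan P) : IsRelator (D.freeH s * D.freeH t)
  | e_f_same (a : D.Index) :
      IsRelator (D.freeE a * D.freeF a - (a.1.2 : ℂ) • D.freeH (D.coroot a.1.1))
  | e_f_ne (a b : D.Index) (hab : a ≠ b) : IsRelator (D.freeE a * D.freeF b)
  | h_e (t : Cartan P) (a : D.Index) :
      IsRelator (D.freeH t * D.freeE a -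
        ((a.1.2 : ℂ) * cartanEval (D.simpleRoot a.1.1) t) • D.freeE a)
  | h_f (t : Cartan P) (a : D.Index) :
      IsRelator (D.freeH t * D.freeF a +
        ((a.1.2 : ℂ) * cartanEval (D.simpleRoot a.1.1) t) • D.freeF a)
  | serre_e (a b : D.Index) (ha : D.A a.1.1 a.1.1 = 2) (hab : a ≠ b) :
      IsRelator ((fun x => D.freeE a * x)^[(1 - (b.1.2 : ℤ) * D.A a.1.1 b.1.1).toNat]
        (D.freeE b))
  | serre_f (a b : D.Index) (ha : D.A a.1.1 a.1.1 = 2) (hab : a ≠ b) :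
      IsRelator ((fun x => D.freeF a * x)^[(1 - (b.1.2 : ℤ) * D.A a.1.1 b.1.1).toNat]
        (D.freeF b))
  | e_e (a b : D.Index) (hab : D.A a.1.1 b.1.1 = 0) : IsRelator (D.freeE a * D.freeE b)
  | f_f (a b : D.Index) (hab : D.A a.1.1 b.1.1 = 0) : IsRelator (D.freeF a * D.freeF b)

theorem freeE_mem (a : D.Index) :
    D.freeE a ∈ SuperPresentation.freePart D.genParity (D.indexParity a.1.1) :=
  SuperPresentation.of_mem_freePart (p := D.genParity) (Gen.e a)

theorem freeF_mem (a : D.Index) :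
    D.freeF a ∈ SuperPresentation.freePart D.genParity (D.indexParity a.1.1) :=
  SuperPresentation.of_mem_freePart (p := D.genParity) (Gen.f a)

theorem freeH_mem (t : Cartan P) :
    D.freeH t ∈ SuperPresentation.freePart D.genParity 0 :=
  SuperPresentation.of_mem_freePart (p := D.genParity) (Gen.h t)

theorem iterate_mul_mem {p : D.Gen → ZMod 2} {a b : ZMod 2}
    {x y : FreeNonUnitalNonAssocAlgebra ℂ D.Gen}
    (hx : x ∈ SuperPresentation.freePart p a) (hy : y ∈ SuperPresentation.freePart p b) (n : ℕ) :
    (fun z => x * z)^[n] y ∈ SuperPresentation.freePart p (n • a + b) := by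
  induction n with
  | zero => simpa using hy
  | succ n ih =>
    rw [Function.iterate_succ_apply', succ_nsmul', add_assoc]
    exact SuperPresentation.mul_mem_freePart hx ih

theorem isRelator_homogeneous : ∀ r ∈ {r | D.IsRelator r},
    ∃ a, r ∈ SuperPresentation.freePart D.genParity a := by
  intro r hr
  cases hr with
  | h_add s t => exact ⟨0, sub_mem (D.freeH_mem _) (add_mem (D.freeH_mem _) (D.freeH_mem _))⟩
  | h_smul c t => exact ⟨0, sub_mem (D.freeH_mem _) (Submodule.smul_mem _ _ (D.freeH_mem _))⟩
  | h_h s t => exact ⟨_, SuperPresentation.mul_mem_freePart (D.freeH_mem s) (D.freeH_mem t)⟩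
  | e_f_same a =>
    refine ⟨0, sub_mem ?_ (Submodule.smul_mem _ _ (D.freeH_mem _))⟩
    have h := SuperPresentation.mul_mem_freePart (D.freeE_mem a) (D.freeF_mem a)
    rwa [CharTwo.add_self_eq_zero] at h
  | e_f_ne a b _ => exact ⟨_, SuperPresentation.mul_mem_freePart (D.freeE_mem a) (D.freeF_mem b)⟩
  | h_e t a =>
    have h := SuperPresentation.mul_mem_freePart (D.freeH_mem t) (D.freeE_mem a)
    rw [zero_add] at h
    exact ⟨_, sub_mem h (Submodule.smul_mem _ _ (D.freeE_mem a))⟩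
  | h_f t a =>
    have h := SuperPresentation.mul_mem_freePart (D.freeH_mem t) (D.freeF_mem a)
    rw [zero_add] at h
    exact ⟨_, add_mem h (Submodule.smul_mem _ _ (D.freeF_mem a))⟩
  | serre_e a b _ _ => exact ⟨_, D.iterate_mul_mem (D.freeE_mem a) (D.freeE_mem b) _⟩
  | serre_f a b _ _ => exact ⟨_, D.iterate_mul_mem (D.freeF_mem a) (D.freeF_mem b) _⟩
  | e_e a b _ => exact ⟨_, SuperPresentation.mul_mem_freePart (D.freeE_mem a) (D.freeE_mem b)⟩
  | f_f a b _ => exact ⟨_, SuperPresentation.mul_mem_freePart (D.freeF_mem a) (D.freeF_mem b)⟩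

/-- The underlying vector space of the Borcherds-Bozec superalgebra `𝔤`. -/
abbrev BBSuper : Type _ := SuperPresentation.Presented D.genParity {r | D.IsRelator r}

/-- The Borcherds-Bozec superalgebra `𝔤` as a Lie superalgebra. -/
def lieSuper : LieSuperalgebra D.BBSuper :=
  SuperPresentation.presentedLieSuperalgebra D.genParity {r | D.IsRelator r}
    D.isRelator_homogeneous

/-- The canonical map `𝔥 → 𝔤`. -/
def ofCartan : Cartan P →ₗ[ℂ] D.BBSuper where
  toFun t := Submodule.Quotient.mk (D.freeH t)
  map_add' s t := (Submodule.Quotient.eq _).2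
    (SuperPresentation.relator_mem (.rel _ (IsRelator.h_add s t)))
  map_smul' c t := (Submodule.Quotient.eq _).2
    (SuperPresentation.relator_mem (.rel _ (IsRelator.h_smul c t)))

/-- The root space `𝔤_α = {x ∈ 𝔤 | [h, x] = ⟨h, α⟩ x for all h ∈ 𝔥}`. -/
def rootSpace (α : P) : Submodule ℂ D.BBSuper where
  carrier := {x | ∀ t : Cartan P,
    D.lieSuper.bracket (D.ofCartan t) x = cartanEval α t • x}
  zero_mem' := fun t => by simp
  add_mem' := fun {x y} hx hy t => by rw [map_add, hx t, hy t, smul_add]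
  smul_mem' := fun c x hx t => by rw [map_smul, hx t, smul_comm]

end OddBorcherdsCartanDatum

end

noncomputable section

/-! The superalgebra is graded by the free abelian group on `I^∞`, which is finer than the grading
by `Q`: `e_{i2}` and the brackets of two `e_{i1}` have the same weight but different degrees. The
structure `RootGraded` isolates what the construction of the form needs: a triangular decomposition,
a nondegenerate form on `𝔥`, and for each degree `α` an element `t α` of `𝔥` representing its
weight.

Construction. If `[x, y] = (x, y) t α` is to hold for opposite degrees, then a functional `ξ` on `𝔥`
with `ξ(h_i) = d_i⁻¹` forces `(x, y) = ξ([x, y]) / ht α`, because `ξ(t α)` is the height of `α`.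
`RootGraded.B` takes this as the definition outside degree zero. The bracket identity and the
invariance under single generators are proved in one induction on the height (`bracketEq_and_inv`,
with the main computation in `invLeft_step`). Invariance under everything follows, since the algebra
is spanned by `𝔥` and iterated brackets of generators of one sign.

Nondegeneracy (`SatisfiesSerre.noRadical_aux`). A nonzero radical element `x` of minimal height `α`
is killed by all opposite elements of lower height, hence by the partial Casimir operator, the sum
of `[v, [u, x]]` over dual bases in the degrees strictly between `0` and `α`. That operator is the
scalar `Σ α_j (δ_j, δ_j) - (α, α)` on the whole component (`casimir_aux`). For real `j`, `sl₂` or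
`osp(1|2)` theory gives `(α, δ_j) ≤ 0`, so every summand of the scalar, written as `α_j ((δ_j, δ_j)
- (α, δ_j))`, is nonnegative. Their vanishing leaves only pairwise orthogonal imaginary indices,
isotropic when repeated, and for these the relations `[e_{il}, e_{jk}] = 0` kill every bracket.
Simple degrees are excluded directly by `[e, f] ≠ 0`.

All this requires `𝔥` to embed in `𝔤` (`ofCartan_injective`). For that, a Verma module is built over
the algebra with the Chevalley relations only. The Serre elements in the `f` are killed by every `ad
e`, and symmetrically, so all Serre elements act by zero on the quotient by the maximal proper
submodule, where `t ∈ 𝔥` acts on the highest weight vector by an arbitrary functional.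

The root spaces in the statement are weight spaces of `𝔥`, not degree components. The claims about
them follow from invariance, nondegeneracy on `𝔥`, and the fact that `𝔥` is its own centralizer. -/

/-! ### Sign rules. -/

theorem zmod_two_cases (a : ZMod 2) : a = 0 ∨ a = 1 := by revert a; decide

@[simp] theorem superSign_zero_left (a : ZMod 2) : superSign 0 a = 1 := by
  simp [superSign]

@[simp] theorem superSign_zero_right (a : ZMod 2) : superSign a 0 = 1 := by
  simp [superSign]

theorem superSign_one_one : superSign 1 1 = -1 := by
  have : (1 : ZMod 2).val = 1 := rfl
  simp [superSign, this]

theorem superSign_comm (a b : ZMod 2) : superSign a b = superSign b a := by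
  rw [superSign, superSign, mul_comm]

theorem superSign_mul_self (a b : ZMod 2) : superSign a b * superSign a b = 1 := by
  rw [superSign, ← mul_pow]; simp

theorem superSign_add_left (a b c : ZMod 2) :
    superSign (a + b) c = superSign a c * superSign b c := by
  rcases zmod_two_cases a with rfl | rfl <;> rcases zmod_two_cases b with rfl | rfl <;>
    rcases zmod_two_cases c with rfl | rfl <;>
    simp [superSign_one_one, CharTwo.add_self_eq_zero]

theorem superSign_add_right (a b c : ZMod 2) :
    superSign a (b + c) = superSign a b * superSign a c := by
  rw [superSign_comm, superSign_add_left, superSign_comm b, superSign_comm c]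

theorem superSign_eq (a b : ZMod 2) : superSign a b = 1 ∨ superSign a b = -1 :=
  neg_one_pow_eq_or ℂ _

/-! ### Presented Lie superalgebras: representations by supercommutators. -/

namespace SuperPresentation

variable {X : Type*} {p : X → ZMod 2} {R : Set (FreeNonUnitalNonAssocAlgebra ℂ X)}

/-- A monomial, as an element of the free nonassociative algebra. -/
abbrev mono (m : FreeMagma X) : FreeNonUnitalNonAssocAlgebra ℂ X :=
  MonoidAlgebra.ofMagma ℂ (FreeMagma X) m

theorem mono_mul (m n : FreeMagma X) : mono (m * n) = mono m * mono n := map_mul _ _ _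

theorem single_eq_smul_mono (m : FreeMagma X) (c : ℂ) :
    MonoidAlgebra.single m c = c • mono m := by
  simp [mono, MonoidAlgebra.ofMagma]

theorem span_range_mono : Submodule.span ℂ (Set.range (mono (X := X))) = ⊤ := by
  rw [eq_top_iff]
  rintro x -
  induction x using MonoidAlgebra.induction_linear with
  | zero => exact zero_mem _
  | add x y hx hy => exact add_mem hx hy
  | single m c =>
    rw [single_eq_smul_mono]
    exact Submodule.smul_mem _ _ (Submodule.subset_span ⟨m, rfl⟩)

section FreeLinear

variable {A : Type*} [AddCommGroup A] [Module ℂ A]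

/-- The linear map on the free nonassociative algebra with given values on monomials. -/
def freeLinear (φ : FreeMagma X → A) : FreeNonUnitalNonAssocAlgebra ℂ X →ₗ[ℂ] A :=
  Finsupp.linearCombination ℂ φ ∘ₗ (MonoidAlgebra.coeffLinearEquiv ℂ).toLinearMap

@[simp] theorem freeLinear_mono (φ : FreeMagma X → A) (m : FreeMagma X) :
    freeLinear φ (mono m) = φ m := by
  simp [freeLinear, mono, MonoidAlgebra.ofMagma]

end FreeLinear

section Rep

variable {A : Type*} [Ring A] [Algebra ℂ A]

/-- The value of a monomial in an associative algebra, with supercommutators as products. -/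
def monoRep (p : X → ZMod 2) (g : X → A) : FreeMagma X → A
  | .of x => g x
  | .mul m n => monoRep p g m * monoRep p g n -
      superSign (monoParity p m) (monoParity p n) • (monoRep p g n * monoRep p g m)

/-- The linear extension of `monoRep`. -/
def freeRep (p : X → ZMod 2) (g : X → A) : FreeNonUnitalNonAssocAlgebra ℂ X →ₗ[ℂ] A :=
  freeLinear (monoRep p g)

theorem freeRep_of (g : X → A) (x : X) :
    freeRep p g (FreeNonUnitalNonAssocAlgebra.of ℂ x) = g x :=
  freeLinear_mono (monoRep p g) (FreeMagma.of x)

theorem freeRep_mul (g : X → A) {a b : ZMod 2} {x y : FreeNonUnitalNonAssocAlgebra ℂ X}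
    (hx : x ∈ freePart p a) (hy : y ∈ freePart p b) :
    freeRep p g (x * y) = freeRep p g x * freeRep p g y -
      superSign a b • (freeRep p g y * freeRep p g x) := by
  unfold freePart at hx hy
  induction hx using Submodule.span_induction with
  | zero => simp
  | add x x' _ _ h h' =>
    rw [add_mul, map_add, h, h', map_add, add_mul, mul_add, smul_add]; abel
  | smul c x _ h =>
    rw [smul_mul_assoc, map_smul, h, map_smul, smul_mul_assoc, mul_smul_comm, smul_sub,
      smul_comm c (superSign a b)]
  | mem x hx =>
    obtain ⟨m, rfl, rfl⟩ := hx
    induction hy using Submodule.span_induction with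
    | zero => simp
    | add x x' _ _ h h' =>
      rw [mul_add, map_add, h, h', map_add, add_mul, mul_add, smul_add]; abel
    | smul c x _ h =>
      rw [mul_smul_comm, map_smul, h, map_smul, smul_mul_assoc, mul_smul_comm, smul_sub,
        smul_comm c (superSign _ b)]
    | mem y hy =>
      obtain ⟨n, rfl, rfl⟩ := hy
      change freeRep p g (mono m * mono n) = freeRep p g (mono m) * freeRep p g (mono n) -
        _ • (freeRep p g (mono n) * freeRep p g (mono m))
      rw [← mono_mul]
      simp only [freeRep, freeLinear_mono]
      rfl

theorem exists_add_parts (x : FreeNonUnitalNonAssocAlgebra ℂ X) :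
    ∃ u ∈ freePart p 0, ∃ v ∈ freePart p 1, u + v = x :=
  Submodule.mem_sup.1 (iSup_freePart (p := p) ▸ Submodule.mem_top)

/-- The target algebra carries no parity, and `freeRep` turns products into supercommutators only on
homogeneous elements, so its kernel need not be an ideal. The span `J` of the homogeneous elements
of the kernel is one, and it contains the relators because they are homogeneous. -/
theorem relIdeal_le_ker_freeRep (hR : ∀ r ∈ R, ∃ a, r ∈ freePart p a) (g : X → A)
    (hg : ∀ r ∈ R, freeRep p g r = 0) : relIdeal p R ≤ LinearMap.ker (freeRep p g) := by
  set K := LinearMap.ker (freeRep p g) with hK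
  let J : Submodule ℂ (FreeNonUnitalNonAssocAlgebra ℂ X) := ⨆ a, K ⊓ freePart p a
  have hJK : J ≤ K := iSup_le fun a => inf_le_left
  refine le_trans (relIdeal_le (J := J) ?_ ?_) hJK
  · have aux : ∀ r, freeRep p g r = 0 → (∃ a, r ∈ freePart p a) → r ∈ J := by
      rintro r h0 ⟨a, ha⟩
      exact Submodule.mem_iSup_of_mem a ⟨h0, ha⟩
    intro r hr
    refine aux r ?_ (relator_homogeneous hR hr)
    cases hr with
    | skew a b x y hx hy =>
      rw [map_add, map_smul, freeRep_mul g hx hy, freeRep_mul g hy hx, superSign_comm b a,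
        smul_sub, smul_smul, superSign_mul_self, one_smul]
      abel
    | jacobi a b c x y z hx hy hz =>
      rw [map_sub, map_sub, map_smul, freeRep_mul g hx (mul_mem_freePart hy hz),
        freeRep_mul g hy hz, freeRep_mul g (mul_mem_freePart hx hy) hz, freeRep_mul g hx hy,
        freeRep_mul g hy (mul_mem_freePart hx hz), freeRep_mul g hx hz]
      simp only [superSign_add_left, superSign_add_right, mul_sub, sub_mul, smul_sub,
        mul_smul_comm, smul_mul_assoc, smul_smul, mul_assoc, superSign_comm b a]
      have h := superSign_mul_self a b
      rw [← mul_assoc (superSign a b) (superSign a b), h, one_mul]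
      have h2 : superSign a b * (superSign a c * superSign b c) =
        superSign a c * (superSign a b * superSign b c) := by ring
      have h3 : superSign a b * (superSign a b * (superSign b c * superSign a c)) =
        superSign a c * superSign b c := by linear_combination superSign b c * superSign a c * h
      simp only [h2, h3]
      module
    | rel _ hr => exact hg r hr
  · have key : ∀ x ∈ J, ∀ y, x * y ∈ J ∧ y * x ∈ J := by
      intro x hx y
      have aux : ∀ b, ∀ y ∈ freePart p b, x * y ∈ J ∧ y * x ∈ J := by
        intro b y hy
        induction hx using Submodule.iSup_induction' with
        | zero => simp
        | add x x' _ _ h h' =>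
          rw [add_mul, mul_add]
          exact ⟨add_mem h.1 h'.1, add_mem h.2 h'.2⟩
        | mem a x hx =>
          have h0 : freeRep p g x = 0 := hx.1
          refine ⟨Submodule.mem_iSup_of_mem (a + b) ⟨?_, mul_mem_freePart hx.2 hy⟩,
            Submodule.mem_iSup_of_mem (b + a) ⟨?_, mul_mem_freePart hy hx.2⟩⟩
          · change freeRep p g (x * y) = 0
            rw [freeRep_mul g hx.2 hy, h0]; simp
          · change freeRep p g (y * x) = 0
            rw [freeRep_mul g hy hx.2, h0]; simp
      obtain ⟨u, hu, v, hv, rfl⟩ := exists_add_parts (p := p) y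
      have h0 := aux 0 u hu
      have h1 := aux 1 v hv
      rw [mul_add, add_mul]
      exact ⟨add_mem h0.1 h1.1, add_mem h0.2 h1.2⟩
    rintro x y (h | h)
    · exact (key x h y).1
    · exact (key y h x).2

/-- The representation of a presented Lie superalgebra in an associative algebra (with the
supercommutator) given by elements which satisfy the relations. -/
def presentedRep (hR : ∀ r ∈ R, ∃ a, r ∈ freePart p a) (g : X → A)
    (hg : ∀ r ∈ R, freeRep p g r = 0) : Presented p R →ₗ[ℂ] A :=
  (relIdeal p R).liftQ (freeRep p g) (relIdeal_le_ker_freeRep hR g hg)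

theorem presentedRep_mk (hR : ∀ r ∈ R, ∃ a, r ∈ freePart p a) (g : X → A)
    (hg : ∀ r ∈ R, freeRep p g r = 0) (x : FreeNonUnitalNonAssocAlgebra ℂ X) :
    presentedRep hR g hg ((relIdeal p R).mkQ x) = freeRep p g x := rfl

theorem presentedRep_bracket (hR : ∀ r ∈ R, ∃ a, r ∈ freePart p a) (g : X → A)
    (hg : ∀ r ∈ R, freeRep p g r = 0) {a b : ZMod 2} {x y : Presented p R}
    (hx : x ∈ presentedPart p R a) (hy : y ∈ presentedPart p R b) :
    presentedRep hR g hg (presentedBracket p R x y) =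
      presentedRep hR g hg x * presentedRep hR g hg y -
        superSign a b • (presentedRep hR g hg y * presentedRep hR g hg x) := by
  obtain ⟨x, hx, rfl⟩ := hx
  obtain ⟨y, hy, rfl⟩ := hy
  rw [presentedBracket_mk, presentedRep_mk, presentedRep_mk, presentedRep_mk]
  exact freeRep_mul g hx hy

end Rep

/-! ### Presented Lie superalgebras: gradings. -/

section Grading

variable {G : Type*} [AddCommMonoid G] (δ : X → G)

/-- The degree of a monomial. -/
def monoDeg : FreeMagma X → G
  | .of x => δ x
  | .mul m n => monoDeg m + monoDeg n

/-- The span of the monomials of degree `γ`. -/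
def freeComp (γ : G) : Submodule ℂ (FreeNonUnitalNonAssocAlgebra ℂ X) :=
  Submodule.span ℂ (mono '' {m | monoDeg δ m = γ})

variable {δ}

theorem mono_mem_freeComp (m : FreeMagma X) : mono m ∈ freeComp δ (monoDeg δ m) :=
  Submodule.subset_span ⟨m, rfl, rfl⟩

theorem of_mem_freeComp (x : X) : FreeNonUnitalNonAssocAlgebra.of ℂ x ∈ freeComp δ (δ x) :=
  mono_mem_freeComp (δ := δ) (FreeMagma.of x)

theorem mul_mem_freeComp {γ η : G} {x y : FreeNonUnitalNonAssocAlgebra ℂ X}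
    (hx : x ∈ freeComp δ γ) (hy : y ∈ freeComp δ η) : x * y ∈ freeComp δ (γ + η) := by
  unfold freeComp at hx hy
  induction hx using Submodule.span_induction with
  | zero => simp
  | add x x' _ _ h h' => rw [add_mul]; exact add_mem h h'
  | smul c x _ h => rw [smul_mul_assoc]; exact Submodule.smul_mem _ _ h
  | mem x hx =>
    obtain ⟨m, rfl, rfl⟩ := hx
    induction hy using Submodule.span_induction with
    | zero => simp
    | add x x' _ _ h h' => rw [mul_add]; exact add_mem h h'
    | smul c x _ h => rw [mul_smul_comm]; exact Submodule.smul_mem _ _ h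
    | mem y hy =>
      obtain ⟨n, rfl, rfl⟩ := hy
      rw [← mono_mul]
      exact mono_mem_freeComp (m * n)

theorem iterate_mul_mem_freeComp {γ η : G} {x y : FreeNonUnitalNonAssocAlgebra ℂ X}
    (hx : x ∈ freeComp δ γ) (hy : y ∈ freeComp δ η) (n : ℕ) :
    (fun z => x * z)^[n] y ∈ freeComp δ (n • γ + η) := by
  induction n with
  | zero => simpa using hy
  | succ n ih =>
    rw [Function.iterate_succ_apply', succ_nsmul', add_assoc]
    exact mul_mem_freeComp hx ih

/-- A relation between two homogeneous elements that is bilinear need only be checked on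
monomials. -/
theorem freePart_induction₂ {Y : Type*} [AddCommGroup Y] [Module ℂ Y] {a b : ZMod 2}
    (φ : FreeNonUnitalNonAssocAlgebra ℂ X →ₗ[ℂ] FreeNonUnitalNonAssocAlgebra ℂ X →ₗ[ℂ] Y)
    (S : Submodule ℂ Y)
    (h : ∀ m n, monoParity p m = a → monoParity p n = b → φ (mono m) (mono n) ∈ S)
    {x y : FreeNonUnitalNonAssocAlgebra ℂ X}
    (hx : x ∈ freePart p a) (hy : y ∈ freePart p b) : φ x y ∈ S := by
  unfold freePart at hx hy
  induction hx using Submodule.span_induction with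
  | zero => simp
  | add x x' _ _ h h' => rw [map_add]; exact add_mem h h'
  | smul c x _ h => rw [map_smul]; exact Submodule.smul_mem _ _ h
  | mem x hx =>
    obtain ⟨m, hm, rfl⟩ := hx
    induction hy using Submodule.span_induction with
    | zero => simp
    | add x x' _ _ h h' => rw [map_add]; exact add_mem h h'
    | smul c x _ h => rw [map_smul]; exact Submodule.smul_mem _ _ h
    | mem y hy =>
      obtain ⟨n, hn, rfl⟩ := hy
      exact h m n hm hn

/-- The skew-symmetry and Jacobi relators are indexed by elements homogeneous for parity only. By
multilinearity they are combinations of the same relators on monomials, and those are homogeneous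
for the degree. -/
theorem relIdeal_le_iSup (hδ : ∀ r ∈ R, ∃ γ, r ∈ freeComp δ γ) :
    relIdeal p R ≤ ⨆ γ, relIdeal p R ⊓ freeComp δ γ := by
  set J := ⨆ γ, relIdeal p R ⊓ freeComp δ γ
  have mem : ∀ {r γ}, Relator p R r → r ∈ freeComp δ γ → r ∈ J := fun h h' =>
    Submodule.mem_iSup_of_mem _ ⟨relator_mem h, h'⟩
  have hpm : ∀ m : FreeMagma X, mono m ∈ freePart p (monoParity p m) := fun m =>
    Submodule.subset_span ⟨m, rfl, rfl⟩
  refine relIdeal_le (fun r hr => ?_) ?_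
  · cases hr with
    | skew a b x y hx hy =>
      refine freePart_induction₂ (p := p) (LinearMap.mul ℂ (FreeNonUnitalNonAssocAlgebra ℂ X) +
        superSign a b • (LinearMap.mul ℂ (FreeNonUnitalNonAssocAlgebra ℂ X)).flip) J ?_ hx hy
      rintro m n rfl rfl
      refine mem (.skew _ _ _ _ (hpm m) (hpm n)) (γ := monoDeg δ m + monoDeg δ n)
        (add_mem (mul_mem_freeComp (mono_mem_freeComp m) (mono_mem_freeComp n))
          (Submodule.smul_mem _ _ ?_))
      rw [add_comm]
      exact mul_mem_freeComp (mono_mem_freeComp n) (mono_mem_freeComp m)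
    | jacobi a b c x y z hx hy hz =>
      have hlin : ∀ x y, ∀ z ∈ freePart p c, (∀ k, monoParity p k = c →
          x * (y * mono k) - (x * y) * mono k - superSign a b • (y * (x * mono k)) ∈ J) →
          x * (y * z) - (x * y) * z - superSign a b • (y * (x * z)) ∈ J := by
        intro x y z hz h
        unfold freePart at hz
        induction hz using Submodule.span_induction with
        | zero => simp
        | add z z' _ _ h h' =>
          have := add_mem h h'
          convert this using 1
          simp only [mul_add, smul_add]
          abel
        | smul t z _ h =>
          have := Submodule.smul_mem _ t h
          convert this using 1
          simp only [mul_smul_comm, smul_sub, smul_comm t (superSign a b)]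
        | mem z hz =>
          obtain ⟨k, hk, rfl⟩ := hz
          exact h k hk
      refine hlin x y z hz fun k hk => ?_
      let μ := LinearMap.mul ℂ (FreeNonUnitalNonAssocAlgebra ℂ X)
      -- With `z` already a monomial `k`, the three bilinear maps below are `x(yk)`, `(xy)k` and
      -- `y(xk)`.
      have h := freePart_induction₂ (p := p) (a := a) (b := b)
        (μ.compl₂ (μ.flip (mono k)) - μ.compr₂ (μ.flip (mono k)) -
          superSign a b • (μ.compl₂ (μ.flip (mono k))).flip) J ?_ hx hy
      · exact h
      rintro m n rfl rfl
      refine mem (.jacobi _ _ _ _ _ _ (hpm m) (hpm n) (hpm k))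
        (γ := monoDeg δ m + (monoDeg δ n + monoDeg δ k)) (sub_mem (sub_mem
          (mul_mem_freeComp (mono_mem_freeComp m)
            (mul_mem_freeComp (mono_mem_freeComp n) (mono_mem_freeComp k))) ?_)
          (Submodule.smul_mem _ _ ?_))
      · rw [← add_assoc]
        exact mul_mem_freeComp (mul_mem_freeComp (mono_mem_freeComp m) (mono_mem_freeComp n))
          (mono_mem_freeComp k)
      · rw [add_left_comm]
        exact mul_mem_freeComp (mono_mem_freeComp n)
          (mul_mem_freeComp (mono_mem_freeComp m) (mono_mem_freeComp k))
    | rel _ hr =>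
      obtain ⟨γ, hγ⟩ := hδ r hr
      exact mem (.rel r hr) hγ
  · have key : ∀ x ∈ J, ∀ y, x * y ∈ J ∧ y * x ∈ J := by
      intro x hx y
      have hy : y ∈ Submodule.span ℂ (Set.range (mono (X := X))) := by
        rw [span_range_mono]; trivial
      induction hy using Submodule.span_induction with
      | zero => simp
      | add y y' _ _ h h' =>
        rw [mul_add, add_mul]
        exact ⟨add_mem h.1 h'.1, add_mem h.2 h'.2⟩
      | smul c y _ h =>
        rw [mul_smul_comm, smul_mul_assoc]
        exact ⟨Submodule.smul_mem _ _ h.1, Submodule.smul_mem _ _ h.2⟩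
      | mem y hy =>
        obtain ⟨m, rfl⟩ := hy
        induction hx using Submodule.iSup_induction' with
        | zero => simp
        | add x x' _ _ h h' =>
          rw [add_mul, mul_add]
          exact ⟨add_mem h.1 h'.1, add_mem h.2 h'.2⟩
        | mem γ x hx =>
          exact ⟨Submodule.mem_iSup_of_mem _ ⟨mul_mem_relIdeal (Or.inl hx.1),
            mul_mem_freeComp hx.2 (mono_mem_freeComp m)⟩,
            Submodule.mem_iSup_of_mem _ ⟨mul_mem_relIdeal (Or.inr hx.1),
            mul_mem_freeComp (mono_mem_freeComp m) hx.2⟩⟩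
    rintro x y (h | h)
    · exact (key x h y).1
    · exact (key y h x).2

variable (δ) in
/-- The operator on the free algebra which multiplies the elements of degree `γ` by `s γ`. -/
def freeScale (s : G → ℂ) :
    FreeNonUnitalNonAssocAlgebra ℂ X →ₗ[ℂ] FreeNonUnitalNonAssocAlgebra ℂ X :=
  freeLinear fun m => s (monoDeg δ m) • mono m

theorem freeScale_apply (s : G → ℂ) {γ : G} {x : FreeNonUnitalNonAssocAlgebra ℂ X}
    (hx : x ∈ freeComp δ γ) : freeScale δ s x = s γ • x := by
  unfold freeComp at hx
  induction hx using Submodule.span_induction with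
  | zero => simp
  | add x x' _ _ h h' => rw [map_add, h, h', smul_add]
  | smul c x _ h => rw [map_smul, h, smul_comm]
  | mem x hx =>
    obtain ⟨m, rfl, rfl⟩ := hx
    exact freeLinear_mono _ m

variable (p R δ) in
/-- The component of degree `γ` of a graded presented Lie superalgebra. -/
def presentedComp (γ : G) : Submodule ℂ (Presented p R) :=
  (freeComp δ γ).map (relIdeal p R).mkQ

/-- The operator on a graded presented Lie superalgebra which multiplies the elements of
degree `γ` by `s γ`. -/
def presentedScale (hδ : ∀ r ∈ R, ∃ γ, r ∈ freeComp δ γ) (s : G → ℂ) :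
    Presented p R →ₗ[ℂ] Presented p R :=
  (relIdeal p R).mapQ (relIdeal p R) (freeScale δ s) <| by
    refine (relIdeal_le_iSup hδ).trans (iSup_le ?_)
    rintro γ x ⟨h1, h2⟩
    rw [Submodule.mem_comap, freeScale_apply s h2]
    exact Submodule.smul_mem _ _ h1

/-- Indicator functions `s` give the projections to the components, and `s = ht⁻¹` gives the
normalization of the invariant form; directness of the sum of the components never has to be stated
separately. -/
theorem presentedScale_apply (hδ : ∀ r ∈ R, ∃ γ, r ∈ freeComp δ γ) (s : G → ℂ) {γ : G}
    {x : Presented p R} (hx : x ∈ presentedComp p R δ γ) :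
    presentedScale hδ s x = s γ • x := by
  obtain ⟨x, hx, rfl⟩ := hx
  change (relIdeal p R).mkQ (freeScale δ s x) = _
  rw [freeScale_apply s hx, map_smul]

theorem presentedBracket_mem_presentedComp {γ η : G} {x y : Presented p R}
    (hx : x ∈ presentedComp p R δ γ) (hy : y ∈ presentedComp p R δ η) :
    presentedBracket p R x y ∈ presentedComp p R δ (γ + η) := by
  obtain ⟨x, hx, rfl⟩ := hx
  obtain ⟨y, hy, rfl⟩ := hy
  exact ⟨x * y, mul_mem_freeComp hx hy, rfl⟩

theorem presented_induction {C : Presented p R → Prop} (zero : C 0)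
    (add : ∀ x y, C x → C y → C (x + y)) (smul : ∀ (c : ℂ) x, C x → C (c • x))
    (mk : ∀ m, C ((relIdeal p R).mkQ (mono m))) (x : Presented p R) : C x := by
  obtain ⟨x, rfl⟩ := Submodule.Quotient.mk_surjective _ x
  have hx : x ∈ Submodule.span ℂ (Set.range (mono (X := X))) := by
    rw [span_range_mono]; trivial
  change C ((relIdeal p R).mkQ x)
  induction hx using Submodule.span_induction with
  | zero => rwa [map_zero]
  | add y y' _ _ h h' => rw [map_add]; exact add _ _ h h'
  | smul c y _ h => rw [map_smul]; exact smul _ _ h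
  | mem y hy =>
    obtain ⟨m, rfl⟩ := hy
    exact mk m

theorem iSup_presentedComp : ⨆ γ, presentedComp p R δ γ = ⊤ := by
  rw [eq_top_iff]
  rintro x -
  refine presented_induction (zero_mem _) (fun _ _ => add_mem)
    (fun _ _ => Submodule.smul_mem _ _) (fun m => ?_) x
  exact Submodule.mem_iSup_of_mem (monoDeg δ m) ⟨_, mono_mem_freeComp m, rfl⟩

theorem monoParity_eq (q : G →+ ZMod 2) (hq : ∀ x, q (δ x) = p x) (m : FreeMagma X) :
    q (monoDeg δ m) = monoParity p m := by
  induction m with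
  | ih1 x => exact hq x
  | ih2 m n hm hn =>
    change q (monoDeg δ m + monoDeg δ n) = monoParity p m + monoParity p n
    rw [map_add, hm, hn]

theorem presentedComp_le_part (q : G →+ ZMod 2) (hq : ∀ x, q (δ x) = p x) (γ : G) :
    presentedComp p R δ γ ≤ presentedPart p R (q γ) := by
  refine Submodule.map_mono (Submodule.span_le.2 ?_)
  rintro _ ⟨m, rfl, rfl⟩
  rw [monoParity_eq q hq]
  exact Submodule.subset_span ⟨m, rfl, rfl⟩

/-- This lets supersymmetry, once known on degree components, pass to all elements homogeneous for
parity. -/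
theorem presentedPart_le_iSup (q : G →+ ZMod 2) (hq : ∀ x, q (δ x) = p x) (a : ZMod 2) :
    presentedPart p R a ≤ ⨆ γ : {γ : G // q γ = a}, presentedComp p R δ γ := by
  rw [presentedPart, freePart, Submodule.map_span_le]
  rintro _ ⟨m, hm, rfl⟩
  refine Submodule.mem_iSup_of_mem ⟨monoDeg δ m, ?_⟩ ⟨_, mono_mem_freeComp m, rfl⟩
  rw [monoParity_eq q hq]
  exact hm

end Grading

end SuperPresentation

/-- A Lie superalgebra graded by the lattice `J →₀ ℤ`, with triangular decomposition. The degree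
zero part is a Cartan subalgebra `V`, and the positive and negative parts are generated by elements
`gen 1 j` and `gen (-1) j` of degrees `±j`. The Cartan subalgebra carries a nondegenerate
form, for which `t α` represents the weight of `α`. -/
structure RootGraded (J V : Type*) {L : Type*} [AddCommGroup V] [Module ℂ V] [AddCommGroup L]
    [Module ℂ L] (𝓛 : LieSuperalgebra L) where
  /-- the parity of a degree -/
  parity : (J →₀ ℤ) →+ ZMod 2
  /-- the homogeneous components -/
  comp : (J →₀ ℤ) → Submodule ℂ L
  comp_le : ∀ α, comp α ≤ 𝓛.part (parity α)
  bracket_mem : ∀ {α β x y}, x ∈ comp α → y ∈ comp β → 𝓛.bracket x y ∈ comp (α + β)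
  /-- the operators which act on each component as a scalar -/
  scale : ((J →₀ ℤ) → ℂ) → L →ₗ[ℂ] L
  scale_apply : ∀ s {α x}, x ∈ comp α → scale s x = s α • x
  iSup_comp : ⨆ α, comp α = ⊤
  /-- the inclusion of the Cartan subalgebra -/
  car : V →ₗ[ℂ] L
  car_injective : Function.Injective car
  car_mem : ∀ v, car v ∈ comp 0
  /-- the generators -/
  gen : ℤˣ → J → L
  gen_mem : ∀ (ε : ℤˣ) j, gen ε j ∈ comp ((ε : ℤ) • Finsupp.single j 1)
  /-- the weight of a degree -/
  wt : (J →₀ ℤ) →+ V →ₗ[ℂ] ℂ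
  car_bracket : ∀ {α x}, x ∈ comp α → ∀ v, 𝓛.bracket (car v) x = wt α v • x
  /-- the form on the Cartan subalgebra -/
  form : LinearMap.BilinForm ℂ V
  form_symm : ∀ u v, form u v = form v u
  form_nondeg : ∀ v, (∀ u, form v u = 0) → v = 0
  /-- the element of the Cartan subalgebra which represents a weight -/
  t : (J →₀ ℤ) →+ V
  form_t : ∀ α v, form (t α) v = wt α v
  gen_bracket_same : ∀ (ε : ℤˣ) j, ∃ c : ℂ, c ≠ 0 ∧
    𝓛.bracket (gen ε j) (gen (-ε) j) = car (c • t ((ε : ℤ) • Finsupp.single j 1))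
  gen_bracket_ne : ∀ ε j k, j ≠ k → 𝓛.bracket (gen ε j) (gen (-ε) k) = 0
  /-- a functional on the Cartan subalgebra which is positive on positive degrees -/
  xi : V →ₗ[ℂ] ℂ
  /-- the heights of the simple degrees -/
  w : J → ℕ
  w_pos : ∀ j, 0 < w j
  xi_t : ∀ j, xi (t (Finsupp.single j 1)) = w j
  span_top : ∀ S : Submodule ℂ L, (∀ v, car v ∈ S) → (∀ ε j, gen ε j ∈ S) →
    (∀ (ε : ℤˣ) j x α, 0 < α → x ∈ S → x ∈ comp ((ε : ℤ) • α) → 𝓛.bracket (gen ε j) x ∈ S) → S = ⊤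

/-! ### Degree components and words in the generators. -/

namespace RootGraded

variable {J V L : Type*} [AddCommGroup V] [Module ℂ V] [AddCommGroup L] [Module ℂ L]
  {𝓛 : LieSuperalgebra L} (S : RootGraded J V 𝓛)

/-- The bracket. -/
abbrev br (_ : RootGraded J V 𝓛) : L →ₗ[ℂ] L →ₗ[ℂ] L := 𝓛.bracket

/-- The sign attached to two degrees. -/
def sg (α β : J →₀ ℤ) : ℂ := superSign (S.parity α) (S.parity β)

/-- The simple degrees. -/
abbrev δ (j : J) : J →₀ ℤ := Finsupp.single j 1

theorem sg_comm (α β : J →₀ ℤ) : S.sg α β = S.sg β α := superSign_comm _ _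

theorem sg_mul_self (α β : J →₀ ℤ) : S.sg α β * S.sg α β = 1 := superSign_mul_self _ _

theorem sg_add_left (α β γ : J →₀ ℤ) : S.sg (α + β) γ = S.sg α γ * S.sg β γ := by
  rw [sg, map_add, superSign_add_left]; rfl

theorem sg_add_right (α β γ : J →₀ ℤ) : S.sg α (β + γ) = S.sg α β * S.sg α γ := by
  rw [sg, map_add, superSign_add_right]; rfl

@[simp] theorem sg_zero_left (α : J →₀ ℤ) : S.sg 0 α = 1 := by simp [sg]

@[simp] theorem sg_zero_right (α : J →₀ ℤ) : S.sg α 0 = 1 := by simp [sg]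

theorem parity_neg (α : J →₀ ℤ) : S.parity (-α) = S.parity α := by
  rw [map_neg]; revert α; intro α; generalize S.parity α = a; revert a; decide

@[simp] theorem sg_neg_left (α β : J →₀ ℤ) : S.sg (-α) β = S.sg α β := by
  rw [sg, parity_neg]; rfl

@[simp] theorem sg_neg_right (α β : J →₀ ℤ) : S.sg α (-β) = S.sg α β := by
  rw [sg, parity_neg]; rfl

@[simp] theorem sg_smul_left (ε : ℤˣ) (α β : J →₀ ℤ) : S.sg ((ε : ℤ) • α) β = S.sg α β := by
  rcases Int.units_eq_one_or ε with rfl | rfl <;> simp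

@[simp] theorem sg_smul_right (ε : ℤˣ) (α β : J →₀ ℤ) : S.sg α ((ε : ℤ) • β) = S.sg α β := by
  rcases Int.units_eq_one_or ε with rfl | rfl <;> simp

theorem skew {α β : J →₀ ℤ} {x y : L} (hx : x ∈ S.comp α) (hy : y ∈ S.comp β) :
    S.br x y = -(S.sg α β • S.br y x) :=
  𝓛.bracket_skew _ _ x y (S.comp_le _ hx) (S.comp_le _ hy)

theorem jac {α β : J →₀ ℤ} {x y : L} (hx : x ∈ S.comp α) (hy : y ∈ S.comp β) (z : L) :
    S.br x (S.br y z) = S.br (S.br x y) z + S.sg α β • S.br y (S.br x z) :=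
  𝓛.jacobi _ _ x y z (S.comp_le _ hx) (S.comp_le _ hy)

theorem br_mem {α β γ : J →₀ ℤ} {x y : L} (hx : x ∈ S.comp α) (hy : y ∈ S.comp β)
    (h : α + β = γ) : S.br x y ∈ S.comp γ :=
  h ▸ S.bracket_mem hx hy

theorem comp_induction {C : L → Prop} (zero : C 0) (add : ∀ x y, C x → C y → C (x + y))
    (mem : ∀ α, ∀ x ∈ S.comp α, C x) (x : L) : C x := by
  have hx : x ∈ ⨆ α, S.comp α := S.iSup_comp ▸ Submodule.mem_top
  induction hx using Submodule.iSup_induction' with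
  | zero => exact zero
  | add x y _ _ hx hy => exact add x y hx hy
  | mem α x hx => exact mem α x hx

/-- The projection to a component. -/
def proj (α : J →₀ ℤ) : L →ₗ[ℂ] L := S.scale (Set.indicator {α} 1)

theorem proj_same {α : J →₀ ℤ} {x : L} (hx : x ∈ S.comp α) : S.proj α x = x := by
  simp [proj, S.scale_apply _ hx]

theorem proj_ne {α β : J →₀ ℤ} {x : L} (hx : x ∈ S.comp β) (h : β ≠ α) : S.proj α x = 0 := by
  simp [proj, S.scale_apply _ hx, h]

theorem proj_mem (α : J →₀ ℤ) (x : L) : S.proj α x ∈ S.comp α := by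
  induction x using S.comp_induction with
  | zero => simp
  | add x y hx hy => rw [map_add]; exact add_mem hx hy
  | mem β x hx =>
    by_cases h : β = α
    · subst h; rwa [S.proj_same hx]
    · rw [S.proj_ne hx h]; exact zero_mem _

theorem δ_pos (j : J) : 0 < δ j := by
  rw [lt_iff_le_and_ne]
  exact ⟨Finsupp.single_nonneg.2 zero_le_one, (Finsupp.single_ne_zero.2 one_ne_zero).symm⟩

/-- The iterated brackets of generators of the same sign, with their degrees. -/
inductive IsWord (ε : ℤˣ) : (J →₀ ℤ) → L → Prop
  | gen (j : J) : IsWord ε (δ j) (S.gen ε j)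
  | cons (j : J) (α : J →₀ ℤ) (x : L) (hx : IsWord ε α x) :
    IsWord ε (α + δ j) (S.br (S.gen ε j) x)

variable {S} in
theorem IsWord.pos {ε : ℤˣ} {α : J →₀ ℤ} {x : L} (h : S.IsWord ε α x) : 0 < α := by
  induction h with
  | gen j => exact δ_pos j
  | cons j α x _ ih => exact add_pos ih (δ_pos j)

variable {S} in
theorem IsWord.mem {ε : ℤˣ} {α : J →₀ ℤ} {x : L} (h : S.IsWord ε α x) :
    x ∈ S.comp ((ε : ℤ) • α) := by
  induction h with
  | gen j => exact S.gen_mem ε j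
  | cons j α x _ ih => exact S.br_mem (S.gen_mem ε j) ih (by rw [smul_add, add_comm])

theorem smul_pos_inj {ε ε' : ℤˣ} {α β : J →₀ ℤ} (hα : 0 < α) (hβ : 0 < β)
    (h : (ε : ℤ) • α = (ε' : ℤ) • β) : ε = ε' ∧ α = β := by
  have aux : ∀ {α β : J →₀ ℤ}, 0 < α → 0 < β → α ≠ -β := by
    rintro _ β hα hβ rfl
    exact lt_asymm hβ (neg_pos.1 hα)
  rcases Int.units_eq_one_or ε with rfl | rfl <;> rcases Int.units_eq_one_or ε' with rfl | rfl
  · simpa using h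
  · exact absurd (by simpa using h) (aux hα hβ)
  · exact absurd (by simpa using h.symm) (aux hβ hα)
  · simpa using h

/-- The triangular decomposition: by `span_top` it is enough that the span is stable under
bracketing a generator with homogeneous elements of its own sign, so mixed brackets never have to be
examined. -/
theorem mem_span_words (x : L) :
    x ∈ Submodule.span ℂ (Set.range S.car ∪ {y | ∃ ε α, S.IsWord ε α y}) := by
  have : Submodule.span ℂ (Set.range S.car ∪ {y | ∃ ε α, S.IsWord ε α y}) = ⊤ := by
    refine S.span_top _ (fun v => Submodule.subset_span (Or.inl ⟨v, rfl⟩))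
      (fun ε j => Submodule.subset_span (Or.inr ⟨ε, _, .gen j⟩)) ?_
    intro ε j x α hα hx hxα
    -- An expansion of the homogeneous `x` may contain words of other degrees and elements of `𝔥`.
    -- Projecting first discards them, and the remaining words can be lengthened by `gen ε j`.
    suffices h : ∀ z ∈ Submodule.span ℂ (Set.range S.car ∪ {y | ∃ ε α, S.IsWord ε α y}),
        S.br (S.gen ε j) (S.proj ((ε : ℤ) • α) z) ∈
          Submodule.span ℂ (Set.range S.car ∪ {y | ∃ ε α, S.IsWord ε α y}) by
      have := h x hx
      rwa [S.proj_same hxα] at this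
    intro z hz
    induction hz using Submodule.span_induction with
    | zero => simp
    | add x y _ _ hx hy => rw [map_add, map_add]; exact add_mem hx hy
    | smul c x _ hx => rw [map_smul, map_smul]; exact Submodule.smul_mem _ _ hx
    | mem z hz =>
      rcases hz with ⟨v, rfl⟩ | ⟨ε', β, hz⟩
      · rw [S.proj_ne (S.car_mem v), map_zero]
        · exact zero_mem _
        · intro h
          rcases Int.units_eq_one_or ε with rfl | rfl
          · exact hα.ne (by simpa using h)
          · exact hα.ne' (by simpa using h.symm)
      · by_cases h : (ε' : ℤ) • β = (ε : ℤ) • α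
        · obtain ⟨rfl, rfl⟩ := smul_pos_inj hz.pos hα h
          rw [S.proj_same hz.mem]
          exact Submodule.subset_span (Or.inr ⟨_, _, .cons j _ _ hz⟩)
        · rw [S.proj_ne hz.mem h, map_zero]
          exact zero_mem _
  rw [this]; trivial

theorem mem_span_homogeneous_words {α : J →₀ ℤ} {x : L} (hx : x ∈ S.comp α) :
    x ∈ Submodule.span ℂ ({y | α = 0 ∧ y ∈ Set.range S.car} ∪
      {y | ∃ (ε : ℤˣ) (β : _), S.IsWord ε β y ∧ α = (ε : ℤ) • β}) := by
  rw [← S.proj_same hx]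
  have hz := S.mem_span_words x
  clear hx
  induction hz using Submodule.span_induction with
  | zero => simp
  | add x y _ _ hx hy => rw [map_add]; exact add_mem hx hy
  | smul c x _ hx => rw [map_smul]; exact Submodule.smul_mem _ _ hx
  | mem z hz =>
    rcases hz with ⟨v, rfl⟩ | ⟨ε', β, hz⟩
    · by_cases h : 0 = α
      · subst h
        rw [S.proj_same (S.car_mem v)]
        exact Submodule.subset_span (Or.inl ⟨rfl, v, rfl⟩)
      · rw [S.proj_ne (S.car_mem v) h]; exact zero_mem _
    · by_cases h : (ε' : ℤ) • β = α
      · subst h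
        rw [S.proj_same hz.mem]
        exact Submodule.subset_span (Or.inr ⟨_, _, hz, rfl⟩)
      · rw [S.proj_ne hz.mem h]; exact zero_mem _

theorem smul_ne_zero_of_pos {ε : ℤˣ} {α : J →₀ ℤ} (hα : 0 < α) : (ε : ℤ) • α ≠ 0 := by
  rcases Int.units_eq_one_or ε with rfl | rfl <;> simp [hα.ne']

theorem exists_car {x : L} (hx : x ∈ S.comp 0) : ∃ v, S.car v = x := by
  have h := S.mem_span_homogeneous_words hx
  have : Submodule.span ℂ ({y | (0 : J →₀ ℤ) = 0 ∧ y ∈ Set.range S.car} ∪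
      {y | ∃ (ε : ℤˣ) (β : _), S.IsWord ε β y ∧ 0 = (ε : ℤ) • β}) ≤ LinearMap.range S.car := by
    rw [Submodule.span_le]
    rintro y (⟨-, hy⟩ | ⟨ε, β, hy, h0⟩)
    · exact hy
    · exact absurd h0.symm (smul_ne_zero_of_pos hy.pos)
  exact this h

theorem mem_span_word {ε : ℤˣ} {α : J →₀ ℤ} (hα : 0 < α) {x : L}
    (hx : x ∈ S.comp ((ε : ℤ) • α)) : x ∈ Submodule.span ℂ {y | S.IsWord ε α y} := by
  refine Submodule.span_mono ?_ (S.mem_span_homogeneous_words hx)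
  rintro y (⟨h0, -⟩ | ⟨ε', β, hy, h⟩)
  · exact absurd h0 (smul_ne_zero_of_pos hα)
  · obtain ⟨rfl, rfl⟩ := smul_pos_inj hα hy.pos h
    exact hy

theorem eq_zero_of_mixed {α : J →₀ ℤ} (h1 : ¬ 0 ≤ α) (h2 : ¬ α ≤ 0) {x : L}
    (hx : x ∈ S.comp α) : x = 0 := by
  have h := S.mem_span_homogeneous_words hx
  have : ({y | α = 0 ∧ y ∈ Set.range S.car} ∪
      {y | ∃ (ε : ℤˣ) (β : _), S.IsWord ε β y ∧ α = (ε : ℤ) • β}) = ∅ := by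
    rw [Set.eq_empty_iff_forall_notMem]
    rintro y (⟨rfl, -⟩ | ⟨ε, β, hy, rfl⟩)
    · exact h1 le_rfl
    · rcases Int.units_eq_one_or ε with rfl | rfl
      · exact h1 (by simpa using hy.pos.le)
      · exact h2 (by simpa using hy.pos.le)
  rwa [this, Submodule.span_empty, Submodule.mem_bot] at h

theorem eq_zero_of_mixed_smul {ε : ℤˣ} {α : J →₀ ℤ} (h1 : ¬ 0 ≤ α) (h2 : ¬ α ≤ 0) {x : L}
    (hx : x ∈ S.comp ((ε : ℤ) • α)) : x = 0 := by
  rcases Int.units_eq_one_or ε with rfl | rfl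
  · exact S.eq_zero_of_mixed h1 h2 (by simpa using hx)
  · exact S.eq_zero_of_mixed (α := -α) (by simpa using h2) (by simpa using h1) (by simpa using hx)

theorem add_δ_ne_δ {β : J →₀ ℤ} (hβ : 0 < β) (j k : J) : β + δ k ≠ δ j := by
  intro h
  have h1 : ∀ i, 0 ≤ β i := fun i => hβ.le i
  refine hβ.ne' (Finsupp.ext fun i => ?_)
  have hi := DFunLike.congr_fun h i
  have hk := DFunLike.congr_fun h k
  have := h1 i
  have := h1 k
  classical
  simp only [Finsupp.add_apply, Finsupp.single_apply, if_true] at hi hk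
  simp only [Finsupp.coe_zero, Pi.zero_apply]
  split_ifs at hi hk <;> first | omega | simp_all

/-- One generator is peeled off each word. The rest `y` is allowed to be any element of its
component, so that inductive hypotheses about whole components apply to it. -/
theorem comp_cases {ε : ℤˣ} {α : J →₀ ℤ} (hα : 0 < α) {C : L → Prop} (zero : C 0)
    (add : ∀ x y, C x → C y → C (x + y)) (smul : ∀ (c : ℂ) x, C x → C (c • x))
    (gen : ∀ j, α = δ j → C (S.gen ε j))
    (cons : ∀ j β, ∀ y ∈ S.comp ((ε : ℤ) • β), 0 < β → α = β + δ j → C (S.br (S.gen ε j) y))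
    {x : L} (hx : x ∈ S.comp ((ε : ℤ) • α)) : C x := by
  have h := S.mem_span_word hα hx
  clear hx
  induction h using Submodule.span_induction with
  | zero => exact zero
  | add x y _ _ hx hy => exact add x y hx hy
  | smul c x _ hx => exact smul c x hx
  | mem x hx =>
    cases hx with
    | gen j => exact gen j rfl
    | cons j β y hy => exact cons j β y hy.mem hy.pos rfl

/-- A word with at least two letters never has a simple degree. -/
theorem exists_smul_gen {ε : ℤˣ} {j : J} {x : L} (hx : x ∈ S.comp ((ε : ℤ) • δ j)) :
    ∃ c : ℂ, x = c • S.gen ε j := by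
  refine S.comp_cases (C := fun x => ∃ c : ℂ, x = c • S.gen ε j) (δ_pos j) ⟨0, by simp⟩ ?_ ?_ ?_ ?_ hx
  · rintro _ _ ⟨c, rfl⟩ ⟨c', rfl⟩
    exact ⟨c + c', by rw [add_smul]⟩
  · rintro c _ ⟨c', rfl⟩
    exact ⟨c * c', by rw [mul_smul]⟩
  · intro k hk
    have : j = k := by
      by_contra h
      have := DFunLike.congr_fun hk j
      simp [Ne.symm h] at this
    exact ⟨1, by rw [this, one_smul]⟩
  · intro k β y _ hβ h
    exact absurd h.symm (add_δ_ne_δ hβ j k)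

/-! ### The form -/

theorem exists_pi0 : ∃ π : L →ₗ[ℂ] V, (∀ v, π (S.car v) = v) ∧
    ∀ α, α ≠ 0 → ∀ x ∈ S.comp α, π x = 0 := by
  obtain ⟨g, hg⟩ := S.car.exists_leftInverse_of_injective (LinearMap.ker_eq_bot.2 S.car_injective)
  refine ⟨g ∘ₗ S.proj 0, fun v => ?_, fun α hα x hx => ?_⟩
  · rw [LinearMap.comp_apply, S.proj_same (S.car_mem v)]
    exact LinearMap.congr_fun hg v
  · rw [LinearMap.comp_apply, S.proj_ne hx hα, map_zero]

/-- The projection to the Cartan subalgebra. -/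
def pi0 : L →ₗ[ℂ] V := S.exists_pi0.choose

theorem pi0_car (v : V) : S.pi0 (S.car v) = v := S.exists_pi0.choose_spec.1 v

theorem pi0_of_ne {α : J →₀ ℤ} (hα : α ≠ 0) {x : L} (hx : x ∈ S.comp α) : S.pi0 x = 0 :=
  S.exists_pi0.choose_spec.2 α hα x hx

/-- The height of a degree. -/
def ht : (J →₀ ℤ) →ₗ[ℤ] ℤ := Finsupp.linearCombination ℤ fun j => (S.w j : ℤ)

theorem ht_δ (j : J) : S.ht (δ j) = S.w j := by simp [ht]

theorem xi_t_eq (α : J →₀ ℤ) : S.xi (S.t α) = (S.ht α : ℂ) := by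
  induction α using Finsupp.induction_linear with
  | zero => simp
  | add α β h h' => simp [h, h']
  | single j n =>
    have : Finsupp.single j n = n • δ j := by simp
    rw [this, map_zsmul, map_zsmul, S.xi_t, map_zsmul, S.ht_δ]
    simp

theorem ht_pos {α : J →₀ ℤ} (hα : 0 < α) : 0 < S.ht α := by
  have h1 : ∀ i, 0 ≤ α i := fun i => hα.le i
  obtain ⟨i, hi⟩ : ∃ i, α i ≠ 0 := by
    by_contra! h
    exact hα.ne' (Finsupp.ext h)
  rw [ht, Finsupp.linearCombination_apply, Finsupp.sum]
  refine Finset.sum_pos' (fun j _ => mul_nonneg (h1 j) (Int.natCast_nonneg _))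
    ⟨i, Finsupp.mem_support_iff.2 hi, mul_pos (lt_of_le_of_ne (h1 i) (Ne.symm hi)) ?_⟩
  exact_mod_cast S.w_pos i

theorem ht_ne_zero {ε : ℤˣ} {α : J →₀ ℤ} (hα : 0 < α) : S.ht ((ε : ℤ) • α) ≠ 0 := by
  have := S.ht_pos hα
  rcases Int.units_eq_one_or ε with rfl | rfl <;> simp <;> omega

/-- The invariant form. -/
def B : LinearMap.BilinForm ℂ L :=
  S.form.compl₁₂ S.pi0 S.pi0 +
    (S.br ∘ₗ S.scale fun α => (S.ht α : ℂ)⁻¹).compr₂ (S.xi ∘ₗ S.pi0)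

theorem B_apply (x y : L) : S.B x y = S.form (S.pi0 x) (S.pi0 y) +
    S.xi (S.pi0 (S.br (S.scale (fun α => (S.ht α : ℂ)⁻¹) x) y)) := rfl

theorem B_of_ne {α β : J →₀ ℤ} {x y : L} (hx : x ∈ S.comp α) (hy : y ∈ S.comp β)
    (h : α + β ≠ 0) : S.B x y = 0 := by
  rw [B_apply, S.scale_apply _ hx, map_smul, LinearMap.smul_apply, map_smul, map_smul,
    S.pi0_of_ne h (S.bracket_mem hx hy)]
  have : S.form (S.pi0 x) (S.pi0 y) = 0 := by
    by_cases h0 : α = 0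
    · have : β ≠ 0 := fun h1 => h (by rw [h0, h1, add_zero])
      rw [S.pi0_of_ne this hy, map_zero]
    · rw [S.pi0_of_ne h0 hx, map_zero, LinearMap.zero_apply]
  rw [this]; simp

theorem B_car (u v : V) : S.B (S.car u) (S.car v) = S.form u v := by
  rw [B_apply, S.scale_apply _ (S.car_mem u)]
  simp [pi0_car]

/-- This is the identity `[x, y] = (x, y) t α` seen through `ξ`, since `ξ (t α) = ht α`; it is the
only value the form can have outside degree zero. -/
theorem ht_mul_B {α : J →₀ ℤ} (h : S.ht α ≠ 0) {x y : L} (hx : x ∈ S.comp α) :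
    S.ht α * S.B x y = S.xi (S.pi0 (S.br x y)) := by
  have hα : α ≠ 0 := fun h0 => h (by rw [h0, map_zero])
  rw [B_apply, S.scale_apply _ hx, S.pi0_of_ne hα hx]
  have : (S.ht α : ℂ) ≠ 0 := by exact_mod_cast h
  simp [this]

theorem ht_ne_zero_of_ne {α : J →₀ ℤ} {x : L} (hx : x ∈ S.comp α) (hα : α ≠ 0) (hx0 : x ≠ 0) :
    S.ht α ≠ 0 := by
  have h : 0 ≤ α ∨ α ≤ 0 := by
    by_contra! h
    exact hx0 (S.eq_zero_of_mixed h.1 h.2 hx)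
  rcases h with h | h
  · exact (S.ht_pos (lt_of_le_of_ne h hα.symm)).ne'
  · have := S.ht_pos (α := -α) (lt_of_le_of_ne (by simpa using h) (by simpa using hα))
    rw [map_neg] at this
    omega

/-- Exchanging `x` and `y` changes the bracket by minus the super sign and the height by a minus
sign; the two minus signs cancel. -/
theorem B_symm {α β : J →₀ ℤ} {x y : L} (hx : x ∈ S.comp α) (hy : y ∈ S.comp β) :
    S.B x y = S.sg α β * S.B y x := by
  by_cases h : α + β = 0
  · obtain rfl : β = -α := by rw [eq_neg_iff_add_eq_zero, add_comm, h]
    by_cases h0 : α = 0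
    · subst h0
      obtain ⟨u, rfl⟩ := S.exists_car hx
      obtain ⟨v, rfl⟩ := S.exists_car (x := y) (by simpa using hy)
      rw [S.B_car, S.B_car, S.form_symm]; simp
    · by_cases hx0 : x = 0
      · simp [hx0]
      have h1 := S.ht_ne_zero_of_ne hx h0 hx0
      have h2 := S.ht_mul_B h1 (y := y) hx
      have h3 := S.ht_mul_B (α := -α) (by simpa using h1) (y := x) hy
      rw [S.skew hx hy, map_neg, map_smul, map_neg, map_smul, ← h3] at h2
      have h4 : (S.ht α : ℂ) ≠ 0 := by exact_mod_cast h1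
      apply mul_left_cancel₀ h4
      rw [h2, map_neg, smul_eq_mul]
      push_cast
      ring
  · rw [S.B_of_ne hx hy h, S.B_of_ne hy hx (by rwa [add_comm]), mul_zero]

end RootGraded

/-! ### Invariance of the form and brackets of opposite components. -/

namespace RootGraded

variable {J V L : Type*} [AddCommGroup V] [Module ℂ V] [AddCommGroup L] [Module ℂ L]
  {𝓛 : LieSuperalgebra L} (S : RootGraded J V 𝓛)

theorem wt_t_symm (α β : J →₀ ℤ) : S.wt α (S.t β) = S.wt β (S.t α) := by
  rw [← S.form_t, ← S.form_t, S.form_symm]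

/-- The bracket of opposite components is given by the form. -/
def BracketEq (α : J →₀ ℤ) : Prop :=
  ∀ x ∈ S.comp α, ∀ y ∈ S.comp (-α), S.br x y = S.B x y • S.car (S.t α)

/-- The form is invariant under a generator, when paired with brackets of a given degree. -/
def InvLeft (ε : ℤˣ) (j : J) (ξ : J →₀ ℤ) : Prop :=
  ∀ x ∈ S.comp ((ε : ℤ) • ξ), ∀ y ∈ S.comp (-((ε : ℤ) • (ξ + δ j))),
    S.B (S.gen ε j) (S.br x y) = -(S.sg (δ j) ξ * S.B x (S.br (S.gen ε j) y))

/-- The form is invariant under a generator in a given degree. -/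
def InvRight (ε : ℤˣ) (j : J) (ξ : J →₀ ℤ) : Prop :=
  ∀ x ∈ S.comp ((ε : ℤ) • ξ), ∀ y ∈ S.comp (-((ε : ℤ) • (ξ + δ j))),
    S.B (S.br (S.gen ε j) x) y = -(S.sg (δ j) ξ * S.B x (S.br (S.gen ε j) y))

variable {S}

/-- Apply `ξ`. To establish `BracketEq` it is therefore enough to show that brackets are some
multiple of `t α`. -/
theorem eq_B_of_bracket_eq {α : J →₀ ℤ} (h : S.ht α ≠ 0) {x y : L} (hx : x ∈ S.comp α) {c : ℂ}
    (hc : S.br x y = c • S.car (S.t α)) : S.B x y = c := by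
  have h1 := S.ht_mul_B h (y := y) hx
  rw [hc, map_smul, S.pi0_car, map_smul, S.xi_t_eq, smul_eq_mul, mul_comm] at h1
  exact mul_right_cancel₀ (by exact_mod_cast h) h1

theorem bracketEq_zero : S.BracketEq 0 := by
  intro x hx y hy
  obtain ⟨u, rfl⟩ := S.exists_car hx
  rw [neg_zero] at hy
  rw [S.car_bracket hy]; simp

theorem bracketEq_δ (ε : ℤˣ) (j : J) : S.BracketEq ((ε : ℤ) • δ j) := by
  intro x hx y hy
  have hx' := hx
  obtain ⟨c, rfl⟩ := S.exists_smul_gen hx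
  obtain ⟨d, rfl⟩ := S.exists_smul_gen (ε := -ε) (x := y) (by simpa using hy)
  obtain ⟨a, -, ha⟩ := S.gen_bracket_same ε j
  have : S.br (c • S.gen ε j) (d • S.gen (-ε) j) = (c * d * a) • S.car (S.t ((ε : ℤ) • δ j)) := by
    simp only [map_smul, LinearMap.smul_apply, ha, smul_smul]
    congr 1; ring
  rw [this, eq_B_of_bracket_eq (S.ht_ne_zero (δ_pos j)) hx' this]

theorem δ_le_of_le_δ {ξ : J →₀ ℤ} {i : J} (hξ : 0 < ξ) (h : ξ ≤ δ i) : δ i ≤ ξ := by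
  have h1 : ∀ k, 0 ≤ ξ k := fun k => hξ.le k
  have h2 : ∀ k, ξ k ≤ δ i k := fun k => h k
  obtain ⟨k, hk⟩ : ∃ k, ξ k ≠ 0 := by
    by_contra! h0
    exact hξ.ne' (Finsupp.ext h0)
  classical
  simp only [Finsupp.single_apply] at h2
  have hki : i = k := by
    by_contra hki
    have := h2 k
    have := h1 k
    rw [if_neg hki] at *
    omega
  subst hki
  intro l
  have := h1 l
  have := h1 i
  rw [Finsupp.single_apply]
  split_ifs with hl
  · subst hl; omega
  · omega

/-- Such a degree is of mixed sign: `0 < ξ ≤ δ i` would force `ξ = δ i`, where the difference is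
`0`. -/
theorem eq_zero_of_not_nonneg_sub {ε : ℤˣ} {ξ : J →₀ ℤ} {i : J} (hξ : 0 < ξ)
    (h : ¬ 0 ≤ ξ - δ i) {x : L} (hx : x ∈ S.comp ((ε : ℤ) • (ξ - δ i))) : x = 0 :=
  S.eq_zero_of_mixed_smul h
    (fun h' => h (sub_nonneg.2 (δ_le_of_le_δ hξ (sub_nonpos.1 h')))) hx

variable (S) in
theorem sg_eq (α β : J →₀ ℤ) : S.sg α β = 1 ∨ S.sg α β = -1 := superSign_eq _ _

/-- Write `y = [e, z]` with `e` an opposite generator and move `x` and `g` past `e` by the Jacobi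
identity. Of the four resulting terms, one on each side reduces to `([x, e], [g, z])` by invariance
in lower degree, and the other two are compared directly. -/
theorem invLeft_step {ε : ℤˣ} {j : J} {ξ : J →₀ ℤ} (hξ : 0 ≤ ξ)
    (hE : S.BracketEq ((ε : ℤ) • ξ)) (h1 : ∀ i, 0 ≤ ξ - δ i → S.InvLeft ε j (ξ - δ i))
    (h2 : ∀ i, 0 ≤ ξ - δ i → S.InvRight (-ε) i (ξ - δ i)) : S.InvLeft ε j ξ := by
  intro x hx y hy
  have hg := S.gen_mem ε j
  rcases hξ.eq_or_lt with rfl | hξ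
  · obtain ⟨v, rfl⟩ := S.exists_car (by simpa using hx)
    rw [zero_add] at hy
    rw [S.car_bracket hy, bracketEq_δ ε j _ hg y hy, map_smul, map_smul, S.B_car, S.form_symm,
      S.form_t]
    simp
    ring
  have hα : 0 < ξ + δ j := add_pos hξ (δ_pos j)
  replace hy : y ∈ S.comp (((-ε : ℤˣ) : ℤ) • (ξ + δ j)) := by
    rwa [Units.val_neg, neg_smul]
  refine S.comp_cases (C := fun y => S.B (S.gen ε j) (S.br x y) =
    -(S.sg (δ j) ξ * S.B x (S.br (S.gen ε j) y))) hα (by simp) ?_ ?_ ?_ ?_ hy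
  · intro y y' h h'
    rw [map_add, map_add, h, h', map_add, map_add]; ring
  · intro c y h
    rw [map_smul, map_smul, h, map_smul, map_smul, smul_eq_mul, smul_eq_mul]; ring
  · intro i hi
    exact absurd hi (add_δ_ne_δ hξ i j)
  intro i β z hz hβ hαβ
  clear hy y
  have he := S.gen_mem (-ε) i
  set e := S.gen (-ε) i
  set g := S.gen ε j
  obtain rfl : β = ξ + δ j - δ i := by rw [hαβ]; abel
  have hw : S.br g z ∈ S.comp (((-ε : ℤˣ) : ℤ) • (ξ - δ i)) :=
    S.br_mem hg hz (by push_cast; module)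
  have hu : S.br x e ∈ S.comp ((ε : ℤ) • (ξ - δ i)) :=
    S.br_mem hx he (by push_cast; module)
  -- Left invariance under `g` with `[x, e]`, of degree `ξ - δ i` up to sign, in place of `x`.
  have X1 : S.B g (S.br (S.br x e) z) = -(S.sg (δ j) (ξ - δ i) * S.B (S.br x e) (S.br g z)) := by
    by_cases h : 0 ≤ ξ - δ i
    · refine h1 i h _ hu _ ?_
      convert hz using 2
      push_cast; module
    · rw [eq_zero_of_not_nonneg_sub hξ h hu]; simp
  -- Right invariance under the opposite generator `e`, conjugated by supersymmetry. The signs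
  -- depend only on the three values `a1`, `a2`, `a3 = ±1`, and all eight cases are checked.
  have Y2 : S.B x (S.br e (S.br g z)) = S.B (S.br x e) (S.br g z) := by
    by_cases h : 0 ≤ ξ - δ i
    · have := h2 i h _ hw x (by convert hx using 2; push_cast; module)
      rw [S.B_symm hx (S.bracket_mem he hw), this, S.skew he hx, map_neg, map_smul,
        S.B_symm hw hu, smul_eq_mul]
      simp only [sg_smul_left, sg_smul_right, sg_add_right, sub_eq_add_neg, sg_neg_right,
        sg_neg_left, sg_add_left]
      rw [S.sg_comm ξ (δ i)]
      rcases S.sg_eq ξ ξ with a1 | a1 <;> rcases S.sg_eq (δ i) (δ i) with a2 | a2 <;>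
        rcases S.sg_eq (δ i) ξ with a3 | a3 <;> simp only [a1, a2, a3] <;> ring
    · rw [eq_zero_of_not_nonneg_sub hξ h hu, eq_zero_of_not_nonneg_sub hξ h hw]; simp
  -- If `i = j`, both `[x, z]` and `[g, e]` lie in `𝔥`, and the two sides agree by symmetry of the
  -- pairing between `δ j` and `ξ`. If `i ≠ j`, then `[g, e] = 0`, and `[x, z]` vanishes because its
  -- degree has mixed sign.
  have XY : S.sg ξ (δ i) * S.B g (S.br e (S.br x z)) =
      -(S.sg (δ j) ξ * S.B x (S.br (S.br g e) z)) := by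
    by_cases hij : j = i
    · subst hij
      rw [add_sub_cancel_right] at hz
      have hge : S.br g e = S.B g e • S.car (S.t ((ε : ℤ) • δ j)) :=
        bracketEq_δ ε j _ hg _ (by simpa using he)
      rw [hE x hx z (by simpa using hz), hge]
      rw [map_smul (S.br e), map_smul, S.skew he (S.car_mem _), S.car_bracket he, map_smul S.br,
        LinearMap.smul_apply, S.car_bracket hz]
      simp only [map_neg, map_smul, sg_zero_right, one_smul, smul_eq_mul]
      have := S.wt_t_symm ((ε : ℤ) • δ j) ((ε : ℤ) • ξ)
      rw [S.sg_comm ξ]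
      push_cast
      simp only [neg_smul, map_neg, LinearMap.neg_apply]
      linear_combination S.sg (δ j) ξ * S.B x z * S.B g e * this
    · have h0 : S.br g e = 0 := S.gen_bracket_ne ε j i hij
      have h3 : S.br x z = 0 := by
        have hm : S.br x z ∈ S.comp ((ε : ℤ) • (δ i - δ j)) :=
          S.br_mem hx hz (by push_cast; module)
        refine S.eq_zero_of_mixed_smul ?_ ?_ hm
        · intro h
          have := h j
          simp [Ne.symm hij] at this
        · intro h
          have := h i
          simp [hij] at this
      rw [h0, h3]; simp
  rw [S.jac hx he, S.jac hg he, map_add, map_add, map_smul, map_smul, X1, Y2]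
  simp only [sg_smul_left, sg_smul_right, smul_eq_mul]
  have h4 : S.sg (δ j) (ξ - δ i) = S.sg (δ j) ξ * S.sg (δ j) (δ i) := by
    rw [sub_eq_add_neg, sg_add_right, sg_neg_right]
  rw [h4]
  linear_combination XY

/-- The Jacobi identity writes `[[g, x], y]` as a combination of `t (δ j)` and `t ξ`. Left
invariance says exactly that the two coefficients are equal, so the sum is a multiple of `t (ξ + δ
j)`, and `eq_B_of_bracket_eq` identifies the coefficient. -/
theorem invRight_of_invLeft {ε : ℤˣ} {j : J} {ξ : J →₀ ℤ} (hξ : 0 ≤ ξ)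
    (hE : S.BracketEq ((ε : ℤ) • ξ)) (h : S.InvLeft ε j ξ) {x y : L}
    (hx : x ∈ S.comp ((ε : ℤ) • ξ)) (hy : y ∈ S.comp (-((ε : ℤ) • (ξ + δ j)))) :
    S.br (S.br (S.gen ε j) x) y =
      S.B (S.br (S.gen ε j) x) y • S.car (S.t ((ε : ℤ) • (ξ + δ j))) ∧
    S.B (S.br (S.gen ε j) x) y = -(S.sg (δ j) ξ * S.B x (S.br (S.gen ε j) y)) := by
  have hg := S.gen_mem ε j
  have hα : 0 < ξ + δ j := add_pos_of_nonneg_of_pos hξ (δ_pos j)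
  have h1 := S.jac hg hx y
  have h2 := hE x hx (S.br (S.gen ε j) y) (S.br_mem hg hy (by module))
  have h3 := bracketEq_δ ε j _ hg (S.br x y) (S.br_mem hx hy (by module))
  have h4 := h x hx y hy
  have h5 : S.br (S.br (S.gen ε j) x) y =
      S.B (S.gen ε j) (S.br x y) • S.car (S.t ((ε : ℤ) • (ξ + δ j))) := by
    rw [h3, h2, smul_smul] at h1
    rw [eq_sub_of_add_eq h1.symm, smul_add, map_add, map_add, smul_add, h4]
    simp only [sg_smul_left, sg_smul_right]
    module
  have h6 := eq_B_of_bracket_eq (S.ht_ne_zero hα)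
    (S.br_mem hg hx (by module : _ = (ε : ℤ) • (ξ + δ j))) h5
  exact ⟨by rw [h5, h6], by rw [h6, h4]⟩

theorem bracketEq_step {ε : ℤˣ} {α : J →₀ ℤ} (hα : 0 ≤ α)
    (hE : ∀ j ξ, 0 ≤ ξ → α = ξ + δ j → S.BracketEq ((ε : ℤ) • ξ))
    (h : ∀ j ξ, 0 ≤ ξ → α = ξ + δ j → S.InvLeft ε j ξ) : S.BracketEq ((ε : ℤ) • α) := by
  rcases hα.eq_or_lt with rfl | hα
  · rw [smul_zero]; exact bracketEq_zero
  intro x hx y hy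
  refine S.comp_cases (C := fun x => S.br x y = S.B x y • S.car (S.t ((ε : ℤ) • α))) hα
    (by simp) ?_ ?_ ?_ ?_ hx
  · intro x x' h h'
    rw [map_add, LinearMap.add_apply, h, h', map_add, LinearMap.add_apply, add_smul]
  · intro c x h
    rw [map_smul S.br, LinearMap.smul_apply, h, map_smul S.B, LinearMap.smul_apply, smul_assoc]
  · rintro j rfl
    exact bracketEq_δ ε j _ (S.gen_mem ε j) y hy
  · rintro j β z hz hβ rfl
    exact (invRight_of_invLeft hβ.le (hE j β hβ.le rfl) (h j β hβ.le rfl) hz hy).1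

/-- The bracket identity, both invariances and both signs go through one induction: left invariance
for `ε` uses right invariance for `-ε` in a lower degree. -/
theorem bracketEq_and_inv (n : ℕ) : ∀ (ε : ℤˣ) (α : J →₀ ℤ), 0 ≤ α → S.ht α ≤ n →
    S.BracketEq ((ε : ℤ) • α) ∧ ∀ j ξ, 0 ≤ ξ → α = ξ + δ j →
      S.InvLeft ε j ξ ∧ S.InvRight ε j ξ := by
  induction n with
  | zero =>
    intro ε α hα hn
    have h0 : ¬ 0 < α := fun h => by have := S.ht_pos h; omega
    have : α = 0 := by
      by_contra h
      exact h0 (lt_of_le_of_ne hα (Ne.symm h))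
    subst this
    refine ⟨by rw [smul_zero]; exact bracketEq_zero, fun j ξ hξ h => ?_⟩
    exact absurd (add_pos_of_nonneg_of_pos hξ (δ_pos j)) (h ▸ lt_irrefl _)
  | succ n ih =>
    intro ε α hα hn
    have hlt : ∀ (j : J) (ξ : J →₀ ℤ), α = ξ + δ j → S.ht ξ ≤ n := by
      rintro j ξ rfl
      have := S.w_pos j
      rw [map_add, S.ht_δ] at hn
      omega
    have hE : ∀ j ξ, 0 ≤ ξ → α = ξ + δ j → S.BracketEq ((ε : ℤ) • ξ) := fun j ξ hξ h =>
      (ih ε ξ hξ (hlt j ξ h)).1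
    have hL : ∀ j ξ, 0 ≤ ξ → α = ξ + δ j → S.InvLeft ε j ξ := by
      intro j ξ hξ h
      refine invLeft_step hξ (hE j ξ hξ h) (fun i hi => ?_) (fun i hi => ?_)
      · refine ((ih ε (ξ - δ i + δ j) (add_nonneg hi (δ_pos j).le) ?_).2 j _ hi rfl).1
        have := hlt i (ξ - δ i + δ j) (by rw [h]; abel)
        exact this
      · exact ((ih (-ε) ξ hξ (hlt j ξ h)).2 i _ hi (by abel)).2
    exact ⟨bracketEq_step hα hE hL, fun j ξ hξ h => ⟨hL j ξ hξ h, fun x hx y hy =>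
      (invRight_of_invLeft hξ (hE j ξ hξ h) (hL j ξ hξ h) hx hy).2⟩⟩

theorem bracketEq_smul (ε : ℤˣ) {α : J →₀ ℤ} (hα : 0 ≤ α) : S.BracketEq ((ε : ℤ) • α) :=
  (bracketEq_and_inv (S.ht α).toNat ε α hα (Int.self_le_toNat _)).1

theorem bracketEq (α : J →₀ ℤ) : S.BracketEq α := by
  by_cases h : 0 ≤ α
  · simpa using bracketEq_smul (S := S) 1 h
  by_cases h' : α ≤ 0
  · simpa using bracketEq_smul (S := S) (-1) (α := -α) (by simpa using h')
  · intro x hx y hy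
    rw [S.eq_zero_of_mixed h h' hx]; simp

theorem invRight (ε : ℤˣ) (j : J) {ξ : J →₀ ℤ} (hξ : 0 ≤ ξ) : S.InvRight ε j ξ :=
  ((bracketEq_and_inv (S.ht (ξ + δ j)).toNat ε (ξ + δ j) (add_nonneg hξ (δ_pos j).le)
    (Int.self_le_toNat _)).2 j ξ hξ rfl).2

variable (S) in
/-- The form is invariant under the homogeneous element `z`. -/
def Inv (γ : J →₀ ℤ) (z : L) : Prop :=
  ∀ α β, ∀ x ∈ S.comp α, ∀ y ∈ S.comp β,
    S.B (S.br z x) y = -(S.sg γ α * S.B x (S.br z y))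

theorem inv_car (v : V) : S.Inv 0 (S.car v) := by
  intro α β x hx y hy
  rw [S.car_bracket hx, S.car_bracket hy]
  by_cases h : α + β = 0
  · obtain rfl : β = -α := by rw [eq_neg_iff_add_eq_zero, add_comm, h]
    simp
  · simp [S.B_of_ne hx hy h]

/-- Only degrees with sum `-ε δ j` matter. If `x` has the sign of the generator, or degree zero,
this is `invRight`; otherwise supersymmetry exchanges `x` and `y`, unless `y` has mixed degree and
vanishes. -/
theorem inv_gen (ε : ℤˣ) (j : J) : S.Inv (δ j) (S.gen ε j) := by
  intro α β x hx y hy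
  have hg := S.gen_mem ε j
  by_cases h : (ε : ℤ) • δ j + α + β = 0
  swap
  · rw [S.B_of_ne (S.bracket_mem hg hx) hy h, S.B_of_ne hx (S.bracket_mem hg hy)]
    · simp
    · intro h'
      apply h
      rw [← h']; abel
  obtain ⟨ξ, rfl⟩ : ∃ ξ, α = (ε : ℤ) • ξ := ⟨(ε : ℤ) • α, by
    rw [smul_smul]; rcases Int.units_eq_one_or ε with rfl | rfl <;> simp⟩
  obtain rfl : β = -((ε : ℤ) • (ξ + δ j)) := by
    rw [← sub_eq_zero, ← h]; module
  by_cases h1 : 0 ≤ ξ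
  · rw [invRight ε j h1 x hx y hy, sg_smul_right]
  by_cases h2 : ξ ≤ 0
  swap
  · rw [S.eq_zero_of_mixed_smul h1 h2 hx]; simp
  have hξ : 0 < -ξ := lt_of_le_of_ne (by simpa using h2) (fun h => h1 (by
    rw [eq_comm, neg_eq_zero] at h; rw [h]))
  by_cases h3 : 0 ≤ -ξ - δ j
  · have h4 := invRight ε j h3 y (by convert hy using 2; module) x (by convert hx using 2; module)
    rw [S.B_symm (S.bracket_mem hg hx) hy, S.B_symm hx (S.bracket_mem hg hy), h4]
    simp only [sg_smul_left, sg_smul_right, sg_add_right, sub_eq_add_neg, sg_neg_right,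
      sg_add_left]
    rw [S.sg_comm ξ (δ j)]
    rcases S.sg_eq ξ ξ with a1 | a1 <;> rcases S.sg_eq (δ j) (δ j) with a2 | a2 <;>
      rcases S.sg_eq (δ j) ξ with a3 | a3 <;> simp only [a1, a2, a3] <;> ring
  · have : y = 0 := eq_zero_of_not_nonneg_sub (ε := ε) (i := j) hξ h3 (by convert hy using 2; module)
    simp [this]

theorem Inv.bracket {γ η : J →₀ ℤ} {u z : L} (hu : u ∈ S.comp γ) (hz : z ∈ S.comp η)
    (h : S.Inv γ u) (h' : S.Inv η z) : S.Inv (γ + η) (S.br u z) := by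
  intro α β x hx y hy
  have e1 := eq_sub_of_add_eq (S.jac hu hz x).symm
  have e2 := eq_sub_of_add_eq (S.jac hu hz y).symm
  rw [e1, e2, map_sub, LinearMap.sub_apply, map_smul, LinearMap.smul_apply,
    h _ _ _ (S.bracket_mem hz hx) _ hy, h' _ _ _ hx _ (S.bracket_mem hu hy),
    h' _ _ _ (S.bracket_mem hu hx) _ hy, h _ _ _ hx _ (S.bracket_mem hz hy), map_sub, map_smul]
  simp only [sg_add_left, sg_add_right, smul_eq_mul]
  rw [S.sg_comm η γ]
  have a := S.sg_mul_self γ η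
  linear_combination (-(S.sg η α * S.sg γ α * S.B x (S.br u (S.br z y)))) * a

theorem IsWord.inv {ε : ℤˣ} {α : J →₀ ℤ} {x : L} (h : S.IsWord ε α x) :
    S.Inv ((ε : ℤ) • α) x := by
  have aux : ∀ {γ : J →₀ ℤ} {z : L}, S.Inv γ z → S.Inv ((ε : ℤ) • γ) z := fun h α β x hx y hy => by
    rw [sg_smul_left]; exact h α β x hx y hy
  induction h with
  | gen j => exact aux (inv_gen ε j)
  | cons j α x hx ih =>
    have := Inv.bracket (S.gen_mem ε j) hx.mem (aux (inv_gen ε j)) ih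
    rwa [← smul_add, add_comm] at this

theorem inv {γ : J →₀ ℤ} {z : L} (hz : z ∈ S.comp γ) : S.Inv γ z := by
  have h := S.mem_span_homogeneous_words hz
  clear hz
  induction h using Submodule.span_induction with
  | zero => intro α β x _ y _; simp
  | add z z' _ _ h h' =>
    intro α β x hx y hy
    rw [map_add S.br, LinearMap.add_apply, LinearMap.add_apply, map_add, map_add,
      LinearMap.add_apply, h α β x hx y hy, h' α β x hx y hy]
    ring
  | smul c z _ h =>
    intro α β x hx y hy
    rw [map_smul S.br, LinearMap.smul_apply, LinearMap.smul_apply, map_smul, map_smul,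
      LinearMap.smul_apply, h α β x hx y hy, smul_eq_mul, smul_eq_mul]
    ring
  | mem z hz =>
    rcases hz with ⟨rfl, v, rfl⟩ | ⟨ε, β, hz, rfl⟩
    · exact inv_car v
    · exact hz.inv

theorem B_invariant (x y z : L) : S.B (S.br x y) z = S.B x (S.br y z) := by
  induction x using S.comp_induction with
  | zero => simp
  | add x x' h h' => simp only [map_add, LinearMap.add_apply, h, h']
  | mem α x hx =>
    induction y using S.comp_induction with
    | zero => simp
    | add y y' h h' => simp only [map_add, LinearMap.add_apply, h, h']
    | mem β y hy =>
      induction z using S.comp_induction with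
      | zero => simp
      | add z z' h h' => simp only [map_add, h, h']
      | mem γ z hz =>
        rw [S.skew hx hy, map_neg, map_smul, LinearMap.neg_apply, LinearMap.smul_apply,
          inv hy _ _ x hx z hz, S.sg_comm β α, smul_eq_mul]
        linear_combination S.B x (S.br y z) * S.sg_mul_self α β

end RootGraded

/-! ### Strings under a generator: the `sl₂` and `osp(1|2)` recursions. -/

theorem iterate_smul_apply {L : Type*} [AddCommGroup L] [Module ℂ L] (f : L →ₗ[ℂ] L) (n : ℕ) (c : ℂ) (x : L) :
    f^[n] (c • x) = c • f^[n] x := by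
  rw [← Module.End.pow_apply, map_smul, Module.End.pow_apply]

/-- The coefficients which appear when `ad e` is applied to the powers of `ad f`. -/
def ladderCoeff (s : ℂ) (lam : ℕ → ℂ) : ℕ → ℂ
  | 0 => lam 0
  | n + 1 => lam (n + 1) + s * ladderCoeff s lam n

/-- Moving `e` past one `f` contributes the eigenvalue of `h` and the sign `s = (-1)^{|e||f|}`; `s =
1` is the `sl₂` case and `s = -1` the `osp(1|2)` case. -/
theorem LieSuperalgebra.bracket_iterate {L : Type*} [AddCommGroup L] [Module ℂ L]
    (𝓛 : LieSuperalgebra L) {a : ZMod 2} {e f h y : L} (he : e ∈ 𝓛.part a) (hf : f ∈ 𝓛.part a)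
    (hef : 𝓛.bracket e f = h) (hy : 𝓛.bracket e y = 0) {lam : ℕ → ℂ}
    (hl : ∀ n, 𝓛.bracket h ((𝓛.bracket f)^[n] y) = lam n • (𝓛.bracket f)^[n] y) (n : ℕ) :
    𝓛.bracket e ((𝓛.bracket f)^[n + 1] y) =
      ladderCoeff (superSign a a) lam n • (𝓛.bracket f)^[n] y := by
  induction n with
  | zero =>
    have h0 := hl 0
    simp only [Function.iterate_succ, Function.iterate_zero, Function.comp_apply, id_eq] at h0 ⊢
    rw [𝓛.jacobi a a e f y he hf, hef, hy, h0, map_zero, smul_zero, add_zero]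
    rfl
  | succ n ih =>
    rw [Function.iterate_succ_apply', 𝓛.jacobi a a e f _ he hf, hef, hl, ih, map_smul, smul_smul,
      ← Function.iterate_succ_apply' (𝓛.bracket f), ← add_smul]
    rfl

/-! ### Dual bases and the partial Casimir operator. -/

namespace RootGraded

variable {J V L : Type*} [AddCommGroup V] [Module ℂ V] [AddCommGroup L] [Module ℂ L]
  {𝓛 : LieSuperalgebra L} (S : RootGraded J V 𝓛)

/-- `J` may be infinite, but the first letter of a word of degree `α` lies in the support of `α`, so
the component sits in a finite sum of images of smaller components and lines. -/
theorem finiteDimensional_comp_aux (n : ℕ) : ∀ (ε : ℤˣ) (α : J →₀ ℤ), 0 < α → S.ht α ≤ n →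
    FiniteDimensional ℂ (S.comp ((ε : ℤ) • α)) := by
  classical
  induction n with
  | zero => intro ε α hα hn; have := S.ht_pos hα; omega
  | succ n ih =>
    intro ε α hα hn
    let T : J → Submodule ℂ L := fun j => Submodule.span ℂ {S.gen ε j} ⊔
      ⨆ _ : 0 < α - δ j, (S.comp ((ε : ℤ) • (α - δ j))).map (S.br (S.gen ε j))
    have hT : ∀ j, FiniteDimensional ℂ (T j) := by
      intro j
      have : ∀ _ : 0 < α - δ j, FiniteDimensional ℂ
          ((S.comp ((ε : ℤ) • (α - δ j))).map (S.br (S.gen ε j))) := by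
        intro h
        have := S.w_pos j
        have : S.ht (α - δ j) ≤ n := by rw [map_sub, S.ht_δ]; omega
        have := ih ε _ h this
        infer_instance
      infer_instance
    have h1 : ∀ i, 0 ≤ α i := fun i => hα.le i
    refine Submodule.finiteDimensional_of_le (S₂ := α.support.sup T) fun x hx => ?_
    refine S.comp_cases (C := fun x => x ∈ α.support.sup T) hα (zero_mem _)
      (fun _ _ => add_mem) (fun c _ => Submodule.smul_mem _ c) ?_ ?_ hx
    · intro j hj
      have hm : j ∈ α.support := by rw [hj]; simp
      exact Finset.le_sup (f := T) hm
        (Submodule.mem_sup_left (Submodule.mem_span_singleton_self _))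
    · rintro j β y hy hβ rfl
      have hm : j ∈ (β + δ j).support := by
        have h2 : 0 ≤ β j := hβ.le j
        rw [Finsupp.mem_support_iff]
        simp
        omega
      refine Finset.le_sup (f := T) hm (Submodule.mem_sup_right ?_)
      rw [add_sub_cancel_right]
      exact Submodule.mem_iSup_of_mem hβ ⟨y, hy, rfl⟩

theorem finiteDimensional_comp (ε : ℤˣ) {α : J →₀ ℤ} (hα : 0 < α) :
    FiniteDimensional ℂ (S.comp ((ε : ℤ) • α)) :=
  S.finiteDimensional_comp_aux (S.ht α).toNat ε α hα (Int.self_le_toNat _)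

/-- No nonzero element of the component is orthogonal to the opposite component. -/
def NoRadical (α : J →₀ ℤ) : Prop :=
  ∀ x ∈ S.comp α, (∀ y ∈ S.comp (-α), S.B x y = 0) → x = 0

/-- Dual families in opposite components. -/
structure IsDualFamily (α : J →₀ ℤ) {n : ℕ} (u v : Fin n → L) : Prop where
  mem_left : ∀ i, u i ∈ S.comp (-α)
  mem_right : ∀ i, v i ∈ S.comp α
  sum_right : ∀ y ∈ S.comp α, ∑ i, S.B (u i) y • v i = y
  sum_left : ∀ x ∈ S.comp (-α), ∑ i, S.B x (v i) • u i = x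

variable {S}

/-- With no radical on either side and one side finite-dimensional, the pairing is perfect; `v` is a
basis and `u` its dual basis. -/
theorem exists_isDualFamily {α : J →₀ ℤ} (hfd : FiniteDimensional ℂ (S.comp α))
    (h1 : S.NoRadical α) (h2 : S.NoRadical (-α)) :
    ∃ (n : ℕ) (u v : Fin n → L), S.IsDualFamily α u v := by
  let p : S.comp (-α) →ₗ[ℂ] S.comp α →ₗ[ℂ] ℂ := S.B.domRestrict₁₂ (S.comp (-α)) (S.comp α)
  have hp : ∀ x y, p x y = S.B x y := fun _ _ => rfl
  have inj1 : Function.Injective p := by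
    rw [injective_iff_map_eq_zero]
    intro x hx
    refine Subtype.ext (h2 x x.2 fun y hy => ?_)
    rw [neg_neg] at hy
    exact LinearMap.congr_fun hx ⟨y, hy⟩
  have inj2 : Function.Injective p.flip := by
    rw [injective_iff_map_eq_zero]
    intro y hy
    refine Subtype.ext (h1 y y.2 fun x hx => ?_)
    have h := LinearMap.congr_fun hy ⟨x, hx⟩
    change S.B x y = 0 at h
    rw [S.B_symm y.2 hx, h, mul_zero]
  have hperf : p.IsPerfPair := LinearMap.IsPerfPair.of_injective' inj1 inj2
  let b := Module.finBasis ℂ (S.comp α)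
  have hu : ∀ i (y : S.comp α), S.B (p.toPerfPair.symm (b.coord i) : L) y = b.repr y i := by
    intro i y
    have : p (p.toPerfPair.symm (b.coord i)) = b.coord i := p.toPerfPair.apply_symm_apply _
    exact LinearMap.congr_fun this y
  have sum_right : ∀ y ∈ S.comp α,
      ∑ i, S.B (p.toPerfPair.symm (b.coord i) : L) y • (b i : L) = y := by
    intro y hy
    have h := congrArg (Subtype.val : S.comp α → L) (b.sum_repr ⟨y, hy⟩)
    rw [← Submodule.coe_subtype, map_sum] at h
    refine Eq.trans (Finset.sum_congr rfl fun i _ => ?_) h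
    rw [hu i ⟨y, hy⟩]; rfl
  refine ⟨_, fun i => p.toPerfPair.symm (b.coord i), fun i => b i, fun i => Subtype.mem _,
    fun i => Subtype.mem _, sum_right, fun x hx => ?_⟩
  rw [← sub_eq_zero]
  refine h2 _ (sub_mem (sum_mem fun i _ => Submodule.smul_mem _ _ (Subtype.mem _)) hx) ?_
  intro y hy
  rw [neg_neg] at hy
  conv_lhs => rw [map_sub, LinearMap.sub_apply, ← sum_right y hy]
  simp only [map_sum, map_smul, LinearMap.sum_apply, LinearMap.smul_apply, smul_eq_mul]
  rw [sub_eq_zero]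
  refine Finset.sum_congr rfl fun i _ => ?_
  congr 1
  have := congrArg (S.B x) (sum_right (b i) (b i).2)
  rw [map_sum] at this
  rw [← this]
  refine Finset.sum_congr rfl fun k _ => ?_
  rw [map_smul, smul_eq_mul, mul_comm]

variable (S) in
/-- The scalar by which the partial Casimir operator acts on the component of degree `α`. -/
def casimirScalar (α : J →₀ ℤ) : ℂ :=
  Finsupp.linearCombination ℤ (fun j => S.wt (δ j) (S.t (δ j))) α - S.wt α (S.t α)

theorem casimirScalar_δ (j : J) : S.casimirScalar (δ j) = 0 := by
  simp [casimirScalar]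

/-- The increment matches the two boundary terms in `casimir_aux`. -/
theorem casimirScalar_add_δ (γ : J →₀ ℤ) (j : J) :
    S.casimirScalar (γ + δ j) = S.casimirScalar γ - 2 * S.wt γ (S.t (δ j)) := by
  have h := S.wt_t_symm (δ j) γ
  simp only [casimirScalar, map_add, LinearMap.add_apply]
  rw [h]
  simp
  ring

/-- Invariance of the Casimir tensor: `Σ v' ⊗ [u', g]` and `Σ [g, v] ⊗ u` have the same matrix
`([u', g], v) = (u', [g, v])`. -/
theorem sum_bracket_gen {ε : ℤˣ} {j : J} {β : J →₀ ℤ} {n m : ℕ} {u v : Fin n → L}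
    {u' v' : Fin m → L} (h : S.IsDualFamily ((ε : ℤ) • β) u v)
    (h' : S.IsDualFamily ((ε : ℤ) • (β + δ j)) u' v') (y : L) :
    ∑ i, S.br (v' i) (S.br (S.br (u' i) (S.gen ε j)) y) =
      ∑ r, S.br (S.br (S.gen ε j) (v r)) (S.br (u r) y) := by
  have hg := S.gen_mem ε j
  have e1 : ∀ i, S.br (u' i) (S.gen ε j) =
      ∑ r, S.B (u' i) (S.br (S.gen ε j) (v r)) • u r := fun i => by
    rw [← h.sum_left _ (S.br_mem (h'.mem_left i) hg (by module))]
    simp_rw [S.B_invariant]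
  have e2 : ∀ r, S.br (S.gen ε j) (v r) =
      ∑ i, S.B (u' i) (S.br (S.gen ε j) (v r)) • v' i := fun r =>
    (h'.sum_right _ (S.br_mem hg (h.mem_right r) (by module))).symm
  have e3 : ∀ r, S.br (S.br (S.gen ε j) (v r)) (S.br (u r) y) =
      ∑ i, S.B (u' i) (S.br (S.gen ε j) (v r)) • S.br (v' i) (S.br (u r) y) := fun r => by
    conv_lhs => rw [e2 r]
    simp only [map_sum, map_smul, LinearMap.sum_apply, LinearMap.smul_apply]
  have e4 : ∀ i, S.br (v' i) (S.br (S.br (u' i) (S.gen ε j)) y) =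
      ∑ r, S.B (u' i) (S.br (S.gen ε j) (v r)) • S.br (v' i) (S.br (u r) y) := fun i => by
    rw [e1 i]
    simp only [map_sum, map_smul, LinearMap.sum_apply, LinearMap.smul_apply]
  simp_rw [e3, e4]
  exact Finset.sum_comm

/-- A boundary term: `[u, g]` lies in `𝔥` and acts on `y` by a scalar, after which the dual families
reassemble `g`. -/
theorem sum_bracket_gen_δ {ε : ℤˣ} {j : J} {γ : J →₀ ℤ} {n : ℕ} {u v : Fin n → L}
    (h : S.IsDualFamily ((ε : ℤ) • δ j) u v) {y : L} (hy : y ∈ S.comp ((ε : ℤ) • γ)) :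
    ∑ i, S.br (v i) (S.br (S.br (u i) (S.gen ε j)) y) =
      -(S.wt γ (S.t (δ j))) • S.br (S.gen ε j) y := by
  have hg := S.gen_mem ε j
  have e1 : ∀ i, S.br (u i) (S.gen ε j) =
      S.B (u i) (S.gen ε j) • S.car (S.t (-((ε : ℤ) • δ j))) := fun i =>
    bracketEq _ _ (h.mem_left i) _ (by rwa [neg_neg])
  have hs : S.wt ((ε : ℤ) • γ) (S.t (-((ε : ℤ) • δ j))) = -(S.wt γ (S.t (δ j))) := by
    rcases Int.units_eq_one_or ε with rfl | rfl <;> simp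
  have e2 : ∀ i, S.br (v i) (S.br (S.br (u i) (S.gen ε j)) y) =
      -(S.wt γ (S.t (δ j))) • S.br (S.B (u i) (S.gen ε j) • v i) y := fun i => by
    rw [e1 i, map_smul S.br, LinearMap.smul_apply, S.car_bracket hy, hs, map_smul, map_smul,
      map_smul S.br, LinearMap.smul_apply, smul_comm]
  simp_rw [e2]
  rw [← Finset.smul_sum, ← LinearMap.sum_apply, ← map_sum, h.sum_right _ hg]

/-- The other boundary term: here `[u, y]` lies in `𝔥`, and the dual families reassemble `y`. -/
theorem sum_bracket_gen_top {ε : ℤˣ} {j : J} {γ : J →₀ ℤ} {n : ℕ} {u v : Fin n → L}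
    (h : S.IsDualFamily ((ε : ℤ) • γ) u v) {y : L} (hy : y ∈ S.comp ((ε : ℤ) • γ)) :
    ∑ i, S.br (v i) (S.br (S.gen ε j) (S.br (u i) y)) =
      -(S.sg γ (δ j) * S.wt γ (S.t (δ j))) • S.br (S.gen ε j) y := by
  have hg := S.gen_mem ε j
  have e1 : ∀ i, S.br (u i) y = S.B (u i) y • S.car (S.t (-((ε : ℤ) • γ))) := fun i =>
    bracketEq _ _ (h.mem_left i) _ (by rwa [neg_neg])
  have hs : S.wt ((ε : ℤ) • δ j) (S.t (-((ε : ℤ) • γ))) = -(S.wt γ (S.t (δ j))) := by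
    rw [S.wt_t_symm γ]
    rcases Int.units_eq_one_or ε with rfl | rfl <;> simp
  have e2 : ∀ i, S.br (v i) (S.br (S.gen ε j) (S.br (u i) y)) =
      (S.wt γ (S.t (δ j))) • S.br (S.B (u i) y • v i) (S.gen ε j) := fun i => by
    rw [e1 i, map_smul, S.skew hg (S.car_mem _), S.car_bracket hg, hs]
    simp only [sg_zero_right, one_smul, neg_smul, neg_neg, map_smul, LinearMap.smul_apply]
    rw [smul_comm]
  simp_rw [e2]
  rw [← Finset.smul_sum, ← LinearMap.sum_apply, ← map_sum, h.sum_right _ hy, S.skew hy hg]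
  simp only [sg_smul_left, sg_smul_right]
  module

open Classical in
-- For `x = [g, y]`, moving each `u` past `g` splits the sum into terms `A` with `[u, g]` and `D`
-- with `[u, y]`. Shifting the index of `A` by `δ j` makes `A` and `D` combine to `g` bracketed with
-- the operator for `γ`; two boundary terms remain, each `-(γ, δ j) [g, y]`.
theorem casimir_aux (m : ℕ) : ∀ (ε : ℤˣ) (α : J →₀ ℤ), 0 < α → S.ht α ≤ m →
    ∀ (n : (J →₀ ℤ) → ℕ) (u v : ∀ β, Fin (n β) → L),
    (∀ β, 0 < β → β < α → S.IsDualFamily ((ε : ℤ) • β) (u β) (v β)) →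
    ∀ x ∈ S.comp ((ε : ℤ) • α),
      ∑ β ∈ Finset.Ioo 0 α, ∑ i, S.br (v β i) (S.br (u β i) x) = S.casimirScalar α • x := by
  induction m with
  | zero => intro ε α hα hn; have := S.ht_pos hα; omega
  | succ m ih =>
    intro ε α hα hn n u v hd x hx
    refine S.comp_cases (C := fun x => ∑ β ∈ Finset.Ioo 0 α, ∑ i, S.br (v β i) (S.br (u β i) x) =
      S.casimirScalar α • x) hα (by simp) ?_ ?_ ?_ ?_ hx
    · intro x x' h h'
      simp only [map_add, Finset.sum_add_distrib, h, h', smul_add]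
    · intro c x h
      simp only [map_smul, ← Finset.smul_sum, h]
      rw [smul_comm]
    · rintro j rfl
      have : Finset.Ioo 0 (δ j) = ∅ := by
        rw [Finset.eq_empty_iff_forall_notMem]
        intro β hβ
        rw [Finset.mem_Ioo] at hβ
        exact not_le_of_gt hβ.2 (δ_le_of_le_δ hβ.1 hβ.2.le)
      rw [this, Finset.sum_empty, casimirScalar_δ, zero_smul]
    rintro j γ y hy hγ rfl
    clear hx x hα
    have hg := S.gen_mem ε j
    set g := S.gen ε j
    have hlt : γ < γ + δ j := lt_add_of_pos_right γ (δ_pos j)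
    let A : (J →₀ ℤ) → L := fun β => ∑ i, S.br (v β i) (S.br (S.br (u β i) g) y)
    let D : (J →₀ ℤ) → L := fun β =>
      S.sg β (δ j) • ∑ i, S.br (v β i) (S.br g (S.br (u β i) y))
    have hsplit : ∀ β ∈ Finset.Ioo 0 (γ + δ j),
        ∑ i, S.br (v β i) (S.br (u β i) (S.br g y)) = A β + D β := by
      intro β hβ
      rw [Finset.mem_Ioo] at hβ
      simp only [A, D, Finset.smul_sum]
      rw [← Finset.sum_add_distrib]
      refine Finset.sum_congr rfl fun i _ => ?_
      rw [S.jac ((hd β hβ.1 hβ.2).mem_left i) hg, map_add, map_smul]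
      simp only [sg_neg_left, sg_smul_left, sg_smul_right]
    rw [Finset.sum_congr rfl hsplit, Finset.sum_add_distrib]
    -- If `β` does not contain `δ j`, then `[u, g]` has mixed degree and vanishes. The other `β` are
    -- `η + δ j` with `0 ≤ η < γ`, and `η = 0` is the boundary term.
    have hA : ∑ β ∈ Finset.Ioo 0 (γ + δ j), A β =
        A (δ j) + ∑ β ∈ Finset.Ioo 0 γ, A (β + δ j) := by
      have h1 : ∑ β ∈ Finset.Ioo 0 (γ + δ j), A β =
          ∑ β ∈ (Finset.Ico 0 γ).map (addRightEmbedding (δ j)), A β := by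
        symm
        refine Finset.sum_subset ?_ ?_
        · intro β hβ
          rw [Finset.mem_map] at hβ
          obtain ⟨η, hη, rfl⟩ := hβ
          rw [Finset.mem_Ico] at hη
          rw [Finset.mem_Ioo]
          exact ⟨add_pos_of_nonneg_of_pos hη.1 (δ_pos j), add_lt_add_left hη.2 (δ j)⟩
        · intro β hβ hβ'
          have hβ2 := Finset.mem_Ioo.1 hβ
          refine Finset.sum_eq_zero fun i _ => ?_
          have hm : S.br (u β i) g ∈ S.comp (((-ε : ℤˣ) : ℤ) • (β - δ j)) :=
            S.br_mem ((hd β hβ2.1 hβ2.2).mem_left i) hg (by push_cast; module)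
          have h0 : ¬ 0 ≤ β - δ j := by
            intro h0
            apply hβ'
            rw [Finset.mem_map]
            refine ⟨β - δ j, Finset.mem_Ico.2 ⟨h0, ?_⟩, by simp⟩
            rw [sub_lt_iff_lt_add]; exact hβ2.2
          rw [eq_zero_of_not_nonneg_sub hβ2.1 h0 hm]; simp
      rw [h1, Finset.sum_map, ← Finset.Ioo_insert_left hγ, Finset.sum_insert (by simp)]
      simp
    -- If `β` is not below `γ`, then `[u, y]` has mixed degree, because `0 < β - γ ≤ δ j` would give
    -- `β = γ + δ j`. The boundary term is `β = γ`.
    have hD : ∑ β ∈ Finset.Ioo 0 (γ + δ j), D β = D γ + ∑ β ∈ Finset.Ioo 0 γ, D β := by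
      have h1 : ∑ β ∈ Finset.Ioo 0 (γ + δ j), D β = ∑ β ∈ Finset.Ioc 0 γ, D β := by
        symm
        refine Finset.sum_subset ?_ ?_
        · intro β hβ
          rw [Finset.mem_Ioc] at hβ
          exact Finset.mem_Ioo.2 ⟨hβ.1, hβ.2.trans_lt hlt⟩
        · intro β hβ hβ'
          have hβ2 := Finset.mem_Ioo.1 hβ
          have h0 : ¬ β ≤ γ := fun h => hβ' (Finset.mem_Ioc.2 ⟨hβ2.1, h⟩)
          have hz : ∀ i, S.br (u β i) y = 0 := by
            intro i
            have hm : S.br (u β i) y ∈ S.comp ((ε : ℤ) • (γ - β)) :=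
              S.br_mem ((hd β hβ2.1 hβ2.2).mem_left i) hy (by module)
            refine S.eq_zero_of_mixed_smul (fun h => h0 (by simpa using h)) (fun h => ?_) hm
            have h2 : 0 < β - γ := lt_of_le_of_ne (by simpa using h) fun h3 =>
              h0 (sub_eq_zero.1 h3.symm).le
            have h3 := δ_le_of_le_δ (i := j) h2 (by rw [sub_le_iff_le_add']; exact hβ2.2.le)
            rw [le_sub_iff_add_le'] at h3
            exact not_le_of_gt hβ2.2 h3
          simp [D, hz]
      rw [h1, ← Finset.Ioo_insert_right hγ, Finset.sum_insert (by simp)]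
    have hcancel : ∀ β ∈ Finset.Ioo 0 γ, A (β + δ j) + D β =
        S.br g (∑ i, S.br (v β i) (S.br (u β i) y)) := by
      intro β hβ
      rw [Finset.mem_Ioo] at hβ
      have hdβ := hd β hβ.1 (hβ.2.trans hlt)
      have h1 := sum_bracket_gen hdβ
        (hd (β + δ j) (add_pos hβ.1 (δ_pos j)) (add_lt_add_left hβ.2 (δ j))) y
      simp only [A, D]
      rw [h1, Finset.smul_sum, ← Finset.sum_add_distrib, map_sum]
      refine Finset.sum_congr rfl fun i _ => ?_
      rw [S.jac hg (hdβ.mem_right i), sg_smul_left, sg_smul_right, S.sg_comm]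
    have hAδ : A (δ j) = -(S.wt γ (S.t (δ j))) • S.br g y :=
      sum_bracket_gen_δ (hd _ (δ_pos j) (lt_add_of_pos_left _ hγ)) hy
    have hDγ : D γ = -(S.wt γ (S.t (δ j))) • S.br g y := by
      simp only [D]
      rw [sum_bracket_gen_top (hd γ hγ hlt) hy, smul_smul]
      congr 1
      linear_combination (-S.wt γ (S.t (δ j))) * S.sg_mul_self γ (δ j)
    have hih : ∑ β ∈ Finset.Ioo 0 γ, ∑ i, S.br (v β i) (S.br (u β i) y) =
        S.casimirScalar γ • y := by
      refine ih ε γ hγ ?_ n u v (fun β h h' => hd β h (h'.trans hlt)) y hy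
      have := S.w_pos j
      rw [map_add, S.ht_δ] at hn
      omega
    rw [hA, hD, hAδ, hDγ, casimirScalar_add_δ]
    have hsum := Finset.sum_congr rfl hcancel
    rw [Finset.sum_add_distrib, ← map_sum, hih, map_smul] at hsum
    rw [add_add_add_comm, hsum]
    module

end RootGraded

/-! ### Triviality of the radical. -/

namespace RootGraded

variable {J V L : Type*} [AddCommGroup V] [Module ℂ V] [AddCommGroup L] [Module ℂ L]
  {𝓛 : LieSuperalgebra L} (S : RootGraded J V 𝓛)

/-- The positive and negative parts satisfy the Serre relations for the symmetrized
Borcherds-Cartan matrix `b`. -/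
structure SatisfiesSerre (b : J → J → ℤ) : Prop where
  wt_t : ∀ j k, S.wt (δ j) (S.t (δ k)) = b j k
  off_diag : ∀ j k, j ≠ k → b j k ≤ 0
  nilpotent : ∀ ε j k, 0 < b j j → ∃ n, (S.br (S.gen ε j))^[n] (S.gen ε k) = 0
  comm : ∀ ε j k, b j k = 0 → S.br (S.gen ε j) (S.gen ε k) = 0

variable {S}

/-- The Leibniz rule: every term of the expansion has `a` letters `f` on `p` or `c` on `q`. The
signs are irrelevant, and the sharper exponent `a + c - 1` is not needed. -/
theorem iterate_bracket_eq_zero {γ : J →₀ ℤ} {f : L} (hf : f ∈ S.comp γ) (n : ℕ) :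
    ∀ (a c : ℕ) (η : J →₀ ℤ) (p q : L), a + c = n → p ∈ S.comp η → (S.br f)^[a] p = 0 →
      (S.br f)^[c] q = 0 → (S.br f)^[n] (S.br p q) = 0 := by
  induction n with
  | zero =>
    intro a c η p q h hp hp0 hq0
    obtain rfl : a = 0 := by omega
    simp only [Function.iterate_zero, id_eq] at hp0 ⊢
    rw [hp0]; simp
  | succ n ih =>
    intro a c η p q h hp hp0 hq0
    rw [Function.iterate_succ_apply, S.jac hf hp, iterate_map_add, iterate_smul_apply]
    have h1 : (S.br f)^[n] (S.br (S.br f p) q) = 0 := by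
      cases a with
      | zero =>
        simp only [Function.iterate_zero, id_eq] at hp0
        rw [hp0]; simp
      | succ a =>
        exact ih a c (γ + η) _ q (by omega) (S.bracket_mem hf hp)
          (by rwa [Function.iterate_succ_apply] at hp0) hq0
    have h2 : (S.br f)^[n] (S.br p (S.br f q)) = 0 := by
      cases c with
      | zero =>
        simp only [Function.iterate_zero, id_eq] at hq0
        rw [hq0]; simp
      | succ c =>
        exact ih a c η p _ (by omega) hp hp0 (by rwa [Function.iterate_succ_apply] at hq0)
    rw [h1, h2]; simp

theorem SatisfiesSerre.exists_iterate_eq_zero {b : J → J → ℤ} (hS : S.SatisfiesSerre b) {ε : ℤˣ}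
    {j : J} (hj : 0 < b j j) {α : J →₀ ℤ} (hα : 0 < α) {x : L}
    (hx : x ∈ S.comp ((ε : ℤ) • α)) : ∃ n, (S.br (S.gen ε j))^[n] x = 0 := by
  have h := S.mem_span_word hα hx
  clear hx
  induction h using Submodule.span_induction with
  | zero => exact ⟨0, rfl⟩
  | add x y _ _ hx hy =>
    obtain ⟨n, hn⟩ := hx
    obtain ⟨m, hm⟩ := hy
    refine ⟨n + m, ?_⟩
    rw [iterate_map_add, add_comm n m, Function.iterate_add_apply, hn, add_comm m n,
      Function.iterate_add_apply, hm]
    simp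
  | smul c x _ hx =>
    obtain ⟨n, hn⟩ := hx
    exact ⟨n, by rw [iterate_smul_apply, hn, smul_zero]⟩
  | mem x hx =>
    replace hx : S.IsWord ε α x := hx
    clear hα
    induction hx with
    | gen k => exact hS.nilpotent ε j k hj
    | cons k α x hx ih =>
      obtain ⟨n, hn⟩ := hS.nilpotent ε j k hj
      obtain ⟨m, hm⟩ := ih
      exact ⟨n + m, iterate_bracket_eq_zero (S.gen_mem ε j) _ n m _ _ _ rfl (S.gen_mem ε k) hn hm⟩

/-- For `s = 1` this is a sum of positive numbers times `c`. For `s = -1` the sums alternate, but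
consecutive ones add up to `c (A + (n + 1) b)`, so passing from `n` to `n + 2` adds `c b`; the
values start with `c A` and `c b`. -/
theorem ladderCoeff_pos {s : ℂ} (hs : s = 1 ∨ s = -1) {c : ℂ} {A b : ℤ} (hA : 0 < A)
    (hb : 0 < b) (n : ℕ) :
    ∃ r : ℤ, 0 < r ∧ ladderCoeff s (fun n => c * (A + n * b)) n = c * r := by
  rcases hs with rfl | rfl
  · induction n with
    | zero => exact ⟨A, hA, by simp [ladderCoeff]⟩
    | succ n ih =>
      obtain ⟨r, hr, h⟩ := ih
      refine ⟨A + (n + 1) * b + r, by positivity, ?_⟩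
      rw [ladderCoeff, h]; push_cast; ring
  · have key : ∀ n : ℕ, (∃ r : ℤ, 0 < r ∧
        ladderCoeff (-1) (fun n => c * (A + n * b)) n = c * r) ∧
        ladderCoeff (-1) (fun n => c * (A + n * b)) n +
          ladderCoeff (-1) (fun n => c * (A + n * b)) (n + 1) = c * (A + (n + 1) * b) ∧
        (∃ r : ℤ, 0 < r ∧ ladderCoeff (-1) (fun n => c * (A + n * b)) (n + 1) = c * r) := by
      intro n
      induction n with
      | zero =>
        refine ⟨⟨A, hA, by simp [ladderCoeff]⟩, by simp [ladderCoeff], ⟨b, hb, ?_⟩⟩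
        simp [ladderCoeff]; ring
      | succ n ih =>
        obtain ⟨⟨r, hr, h⟩, h1, h2⟩ := ih
        refine ⟨h2, by simp [ladderCoeff]; ring, ⟨r + b, by positivity, ?_⟩⟩
        rw [h] at h1
        rw [ladderCoeff]
        push_cast at h1 ⊢
        linear_combination (-1 : ℂ) * h1
    exact (key n).1

variable (S) in
theorem parity_smul (ε : ℤˣ) (α : J →₀ ℤ) : S.parity ((ε : ℤ) • α) = S.parity α := by
  rcases Int.units_eq_one_or ε with rfl | rfl
  · rw [Units.val_one, one_smul]
  · rw [Units.val_neg, Units.val_one, neg_one_smul, parity_neg]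

theorem exists_gen_bracket (ε : ℤˣ) (j : J) : ∃ c : ℂ, c ≠ 0 ∧
    S.br (S.gen (-ε) j) (S.gen ε j) = S.car (c • S.t ((ε : ℤ) • δ j)) := by
  obtain ⟨c, hc, h⟩ := S.gen_bracket_same ε j
  have hs : S.sg (δ j) (δ j) ≠ 0 := by
    rcases S.sg_eq (δ j) (δ j) with h | h <;> rw [h] <;> simp
  refine ⟨-(S.sg (δ j) (δ j) * c), neg_ne_zero.2 (mul_ne_zero hs hc), ?_⟩
  rw [S.skew (S.gen_mem _ _) (S.gen_mem _ _), h, sg_smul_left, sg_smul_right, ← map_smul,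
    ← map_neg, smul_smul, neg_smul]

/-- With a positive pairing, the string of `x` under `gen ε j` would have nonzero coefficients
throughout and never end, against local nilpotency. -/
theorem SatisfiesSerre.wt_nonpos {b : J → J → ℤ} (hS : S.SatisfiesSerre b) {ε : ℤˣ} {j : J}
    (hj : 0 < b j j) {α : J →₀ ℤ} (hα : 0 < α) {x : L} (hx : x ∈ S.comp ((ε : ℤ) • α))
    (hx0 : x ≠ 0) (he : S.br (S.gen (-ε) j) x = 0) {A : ℤ} (hA : S.wt α (S.t (δ j)) = A) :
    A ≤ 0 := by
  by_contra! hpos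
  obtain ⟨c, hc, hc'⟩ := S.exists_gen_bracket ε j
  have hmem : ∀ n : ℕ, (S.br (S.gen ε j))^[n] x ∈ S.comp ((ε : ℤ) • (α + n • δ j)) := by
    intro n
    induction n with
    | zero => simpa using hx
    | succ n ih =>
      rw [Function.iterate_succ_apply']
      exact S.br_mem (S.gen_mem ε j) ih (by module)
  have hp : ∀ ε', S.gen ε' j ∈ 𝓛.part (S.parity (δ j)) := by
    intro ε'
    have := S.comp_le _ (S.gen_mem ε' j)
    rwa [parity_smul] at this
  have hladder := 𝓛.bracket_iterate (hp _) (hp _) hc' he (lam := fun n => c * (A + n * b j j)) (by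
    intro n
    rw [S.car_bracket (hmem n)]
    congr 1
    have : S.wt ((ε : ℤ) • (α + n • δ j)) (S.t ((ε : ℤ) • δ j)) =
        S.wt (α + n • δ j) (S.t (δ j)) := by
      rcases Int.units_eq_one_or ε with rfl | rfl <;> simp
    rw [map_smul, this, map_add, LinearMap.add_apply, hA, map_nsmul, LinearMap.smul_apply,
      hS.wt_t, smul_eq_mul]
    simp)
  have hne : ∀ n : ℕ, (S.br (S.gen ε j))^[n] x ≠ 0 := by
    intro n
    induction n with
    | zero => exact hx0
    | succ n ih =>
      intro h0
      have h1 := hladder n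
      obtain ⟨r, hr, h2⟩ := ladderCoeff_pos (S.sg_eq (δ j) (δ j)) (c := c) hpos hj n
      change _ = ladderCoeff (S.sg (δ j) (δ j)) _ n • _ at h1
      rw [h2, h0, map_zero] at h1
      have hr' : (r : ℂ) ≠ 0 := by exact_mod_cast hr.ne'
      exact (smul_ne_zero (mul_ne_zero hc hr') ih) h1.symm
  obtain ⟨n, hn⟩ := hS.exists_iterate_eq_zero hj hα hx
  exact hne n hn

theorem SatisfiesSerre.wt_eq {b : J → J → ℤ} (hS : S.SatisfiesSerre b) (α : J →₀ ℤ) (j : J) :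
    S.wt α (S.t (δ j)) = (Finsupp.linearCombination ℤ (fun k => b k j) α : ℤ) := by
  induction α using Finsupp.induction_linear with
  | zero => simp
  | add α β h h' => simp [h, h']
  | single k n =>
    have : Finsupp.single k n = n • δ k := by simp
    rw [this, map_zsmul, LinearMap.smul_apply, hS.wt_t, map_zsmul]
    simp

theorem SatisfiesSerre.casimirScalar_eq {b : J → J → ℤ} (hS : S.SatisfiesSerre b)
    (α : J →₀ ℤ) : S.casimirScalar α =
      (∑ j ∈ α.support, α j * (b j j - Finsupp.linearCombination ℤ (fun k => b k j) α) : ℤ) := by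
  have h1 : S.wt α (S.t α) = ∑ j ∈ α.support, α j * S.wt α (S.t (δ j)) := by
    have ht : S.t α = ∑ j ∈ α.support, S.t (Finsupp.single j (α j)) := by
      conv_lhs => rw [← α.sum_single, Finsupp.sum, map_sum]
    rw [ht, map_sum]
    refine Finset.sum_congr rfl fun j _ => ?_
    have : Finsupp.single j (α j) = α j • δ j := by simp
    rw [this, map_zsmul, map_zsmul, zsmul_eq_mul]
  have h2 : Finsupp.linearCombination ℤ (fun j => S.wt (δ j) (S.t (δ j))) α =
      ∑ j ∈ α.support, α j * (b j j : ℂ) := by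
    rw [Finsupp.linearCombination_apply, Finsupp.sum]
    refine Finset.sum_congr rfl fun j _ => ?_
    rw [hS.wt_t, zsmul_eq_mul]
  rw [casimirScalar, h1, h2, ← Finset.sum_sub_distrib]
  push_cast
  refine Finset.sum_congr rfl fun j _ => ?_
  rw [hS.wt_eq]; ring

/-- Every summand is nonnegative: for real `j` by `hre`, for imaginary `j` because `α j * b j j ≤ b
j j` and the other entries are nonpositive. So each factor vanishes, which is impossible for real
`j`; for imaginary `j` it forces `(α j - 1) * b j j` and the off-diagonal terms to vanish. -/
theorem matrix_of_sum_eq_zero {b : J → J → ℤ} (hb : ∀ j k, j ≠ k → b j k ≤ 0) {α : J →₀ ℤ}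
    (hα : 0 < α)
    (hre : ∀ j, 0 < b j j → Finsupp.linearCombination ℤ (fun k => b k j) α ≤ 0)
    (hsum : ∑ j ∈ α.support,
      α j * (b j j - Finsupp.linearCombination ℤ (fun k => b k j) α) = 0) :
    (∀ j ∈ α.support, ∀ k ∈ α.support, k ≠ j → b k j = 0) ∧
      ∀ j, 1 < α j → b j j = 0 := by
  classical
  have h1 : ∀ i, 0 ≤ α i := fun i => hα.le i
  have hlc : ∀ j ∈ α.support, Finsupp.linearCombination ℤ (fun k => b k j) α =
      α j * b j j + ∑ k ∈ α.support.erase j, α k * b k j := by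
    intro j hj
    rw [Finsupp.linearCombination_apply, Finsupp.sum, ← Finset.add_sum_erase _ _ hj]
    rfl
  have hterm : ∀ j, ∀ k ∈ α.support.erase j, α k * b k j ≤ 0 := fun j k hk =>
    mul_nonpos_of_nonneg_of_nonpos (h1 k) (hb k j (Finset.ne_of_mem_erase hk))
  have hpos : ∀ j ∈ α.support, 0 < α j := fun j hj =>
    lt_of_le_of_ne (h1 j) (Ne.symm (Finsupp.mem_support_iff.1 hj))
  have hbj : ∀ j ∈ α.support, b j j ≤ 0 → α j * b j j ≤ b j j := by
    intro j hj hbj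
    have := hpos j hj
    nlinarith
  have hnonneg : ∀ j ∈ α.support,
      0 ≤ b j j - Finsupp.linearCombination ℤ (fun k => b k j) α := by
    intro j hj
    by_cases hr : 0 < b j j
    · have := hre j hr; omega
    · have h2 := hbj j hj (not_lt.1 hr)
      have h3 := Finset.sum_nonpos (hterm j)
      rw [hlc j hj]; omega
  have hzero : ∀ j ∈ α.support,
      b j j = Finsupp.linearCombination ℤ (fun k => b k j) α := by
    intro j hj
    have := (Finset.sum_eq_zero_iff_of_nonneg
      (fun j hj => mul_nonneg (h1 j) (hnonneg j hj))).1 hsum j hj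
    rcases mul_eq_zero.1 this with h | h
    · exact absurd h (hpos j hj).ne'
    · omega
  have him : ∀ j ∈ α.support, b j j ≤ 0 := by
    intro j hj
    by_contra! hr
    have := hre j hr
    have := hzero j hj
    omega
  refine ⟨fun j hj k hk hkj => ?_, fun j hj => ?_⟩
  · have h2 := hbj j hj (him j hj)
    have h3 := Finset.sum_nonpos (hterm j)
    have h4 := hzero j hj
    rw [hlc j hj] at h4
    have h5 : ∑ k ∈ α.support.erase j, α k * b k j = 0 := by omega
    have := (Finset.sum_eq_zero_iff_of_nonpos (hterm j)).1 h5 k (Finset.mem_erase.2 ⟨hkj, hk⟩)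
    rcases mul_eq_zero.1 this with h | h
    · exact absurd h (hpos k hk).ne'
    · exact h
  · have hjs : j ∈ α.support := Finsupp.mem_support_iff.2 (by omega)
    have h3 := Finset.sum_nonpos (hterm j)
    have h4 := hzero j hjs
    have h6 := him j hjs
    rw [hlc j hjs] at h4
    nlinarith

/-- The innermost bracket of a longer word involves two distinct orthogonal indices or one repeated,
hence isotropic, index; either way the generators commute. -/
theorem SatisfiesSerre.word_eq_zero {b : J → J → ℤ} (hS : S.SatisfiesSerre b) {ε : ℤˣ}
    {α : J →₀ ℤ} (h1 : ∀ j ∈ α.support, ∀ k ∈ α.support, k ≠ j → b k j = 0)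
    (h2 : ∀ j, 1 < α j → b j j = 0) {β : J →₀ ℤ} {y : L} (hy : S.IsWord ε β y) (hβ : β ≤ α) :
    (∃ j, β = δ j ∧ y = S.gen ε j) ∨ y = 0 := by
  classical
  induction hy with
  | gen j => exact Or.inl ⟨j, rfl, rfl⟩
  | cons j β y hy ih =>
    right
    rcases ih ((le_add_of_nonneg_right (δ_pos j).le).trans hβ) with ⟨k, rfl, rfl⟩ | rfl
    · refine hS.comm ε j k ?_
      have hj := hβ j
      have hk := hβ k
      by_cases hjk : j = k
      · subst hjk
        simp at hj
        exact h2 j (by omega)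
      · simp [hjk, Ne.symm hjk] at hj hk
        refine h1 k (Finsupp.mem_support_iff.2 (by omega)) j
          (Finsupp.mem_support_iff.2 (by omega)) hjk
    · exact map_zero _

/-- A radical element of minimal height is killed by the partial Casimir operator, so its scalar
vanishes; `matrix_of_sum_eq_zero` and `word_eq_zero` then leave no words in its degree. -/
theorem SatisfiesSerre.noRadical_aux {b : J → J → ℤ} (hS : S.SatisfiesSerre b) (m : ℕ) :
    ∀ (ε : ℤˣ) (α : J →₀ ℤ), 0 < α → S.ht α ≤ m → S.NoRadical ((ε : ℤ) • α) := by
  classical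
  induction m with
  | zero => intro ε α hα hn; have := S.ht_pos hα; omega
  | succ m ih =>
    intro ε α hα hn x hx hrad
    have hB : ∀ y, S.B x y = 0 := by
      intro y
      induction y using S.comp_induction with
      | zero => simp
      | add y y' h h' => rw [map_add, h, h', add_zero]
      | mem β y hy =>
        by_cases h : (ε : ℤ) • α + β = 0
        · exact hrad y (by rwa [neg_eq_of_add_eq_zero_right h])
        · exact S.B_of_ne hx hy h
    -- By invariance `[z, x]` is again orthogonal to everything, in a degree of smaller height.
    have hlow : ∀ β, 0 < β → β < α → ∀ z ∈ S.comp (-((ε : ℤ) • β)), S.br z x = 0 := by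
      intro β hβ hβα z hz
      have hm : S.br z x ∈ S.comp ((ε : ℤ) • (α - β)) := S.br_mem hz hx (by module)
      refine ih ε (α - β) (sub_pos.2 hβα) ?_ _ hm fun y hy => ?_
      · have := S.ht_pos hβ
        rw [map_sub]; omega
      · rw [S.skew hz hx, map_neg, map_smul, LinearMap.neg_apply, LinearMap.smul_apply,
          S.B_invariant, hB, smul_zero, neg_zero]
    by_contra hx0
    -- In a simple degree `x = c • gen ε j`; the bracket identity would give `c • [gen ε j, gen (-ε)
    -- j] = 0`, although `t (δ j)` has nonzero height.
    by_cases hsimple : ∃ j, α = δ j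
    · obtain ⟨j, rfl⟩ := hsimple
      obtain ⟨c, rfl⟩ := S.exists_smul_gen hx
      have h1 := bracketEq _ _ hx (S.gen (-ε) j) (by
        have := S.gen_mem (-ε) j
        rwa [Units.val_neg, neg_smul] at this)
      obtain ⟨d, hd, hd'⟩ := S.gen_bracket_same ε j
      rw [hB, zero_smul, map_smul, LinearMap.smul_apply, hd'] at h1
      have hc : c ≠ 0 := fun h => hx0 (by rw [h, zero_smul])
      have h2 := (smul_eq_zero.1 h1).resolve_left hc
      rw [← map_zero S.car] at h2
      have h3 := (smul_eq_zero.1 (S.car_injective h2)).resolve_left hd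
      have h4 := S.xi_t_eq ((ε : ℤ) • δ j)
      rw [h3, map_zero] at h4
      exact S.ht_ne_zero (ε := ε) (δ_pos j) (by exact_mod_cast h4.symm)
    have hsing : ∀ j, S.br (S.gen (-ε) j) x = 0 := by
      intro j
      have hm := S.gen_mem (-ε) j
      rw [Units.val_neg, neg_smul] at hm
      by_cases h : 0 ≤ α - δ j
      · refine hlow (δ j) (δ_pos j) (lt_of_le_of_ne (sub_nonneg.1 h) ?_) _ hm
        exact fun h' => hsimple ⟨j, h'.symm⟩
      · exact eq_zero_of_not_nonneg_sub (ε := ε) hα h (S.br_mem hm hx (by module))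
    -- Outside the range `0 < β < α` the families are empty placeholders, so that a choice can be
    -- made for all `β` at once.
    have hdual : ∀ β, ∃ (n : ℕ) (u v : Fin n → L),
        0 < β → β < α → S.IsDualFamily ((ε : ℤ) • β) u v := by
      intro β
      by_cases h : 0 < β ∧ β < α
      · have hhb : S.ht β ≤ m := by
          have := S.ht_pos (sub_pos.2 h.2)
          rw [map_sub] at this
          omega
        obtain ⟨n, u, v, huv⟩ := exists_isDualFamily (S.finiteDimensional_comp ε h.1)
          (ih ε β h.1 hhb) (by simpa using ih (-ε) β h.1 hhb)
        exact ⟨n, u, v, fun _ _ => huv⟩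
      · exact ⟨0, fun _ => 0, fun _ => 0, fun h1 h2 => absurd ⟨h1, h2⟩ h⟩
    choose n u v huv using hdual
    have hcas := casimir_aux (S.ht α).toNat ε α hα (Int.self_le_toNat _) n u v huv x hx
    rw [Finset.sum_eq_zero] at hcas
    swap
    · intro β hβ
      rw [Finset.mem_Ioo] at hβ
      refine Finset.sum_eq_zero fun i _ => ?_
      rw [hlow β hβ.1 hβ.2 _ ((huv β hβ.1 hβ.2).mem_left i), map_zero]
    have hscalar := (smul_eq_zero.1 hcas.symm).resolve_right hx0
    rw [hS.casimirScalar_eq, Int.cast_eq_zero] at hscalar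
    obtain ⟨h1, h2⟩ := matrix_of_sum_eq_zero hS.off_diag hα
      (fun j hj => hS.wt_nonpos hj hα hx hx0 (hsing j) (hS.wt_eq α j)) hscalar
    apply hx0
    have hspan := S.mem_span_word hα hx
    have : Submodule.span ℂ {y | S.IsWord ε α y} = ⊥ := by
      rw [Submodule.span_eq_bot]
      intro y hy
      exact (hS.word_eq_zero h1 h2 hy le_rfl).resolve_left fun ⟨j, hj, _⟩ => hsimple ⟨j, hj⟩
    rwa [this, Submodule.mem_bot] at hspan

theorem SatisfiesSerre.noRadical {b : J → J → ℤ} (hS : S.SatisfiesSerre b) (α : J →₀ ℤ) :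
    S.NoRadical α := by
  have aux : ∀ (ε : ℤˣ) (α : J →₀ ℤ), 0 < α → S.NoRadical ((ε : ℤ) • α) := fun ε α hα =>
    hS.noRadical_aux (S.ht α).toNat ε α hα (Int.self_le_toNat _)
  by_cases h0 : α = 0
  · subst h0
    intro x hx h
    obtain ⟨v, rfl⟩ := S.exists_car hx
    rw [S.form_nondeg v fun u => ?_, map_zero]
    rw [← S.B_car]
    exact h _ (by simpa using S.car_mem u)
  by_cases h : 0 ≤ α
  · simpa using aux 1 α (lt_of_le_of_ne h (Ne.symm h0))
  by_cases h' : α ≤ 0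
  · simpa using aux (-1) (-α) (lt_of_le_of_ne (by simpa using h') (by simpa using h0))
  · intro x hx _
    exact S.eq_zero_of_mixed h h' hx

variable (S) in
-- Allowing every larger finite set makes the statement additive in `x`, and later lets the index
-- `0` be adjoined.
theorem exists_sum_proj (x : L) :
    ∃ s : Finset (J →₀ ℤ), ∀ t, s ⊆ t → ∑ α ∈ t, S.proj α x = x := by
  classical
  induction x using S.comp_induction with
  | zero => exact ⟨∅, fun t _ => by simp⟩
  | add x y hx hy =>
    obtain ⟨s, hs⟩ := hx
    obtain ⟨s', hs'⟩ := hy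
    refine ⟨s ∪ s', fun t ht => ?_⟩
    simp only [map_add, Finset.sum_add_distrib]
    rw [hs t (Finset.union_subset_left ht), hs' t (Finset.union_subset_right ht)]
  | mem α x hx =>
    refine ⟨{α}, fun t ht => ?_⟩
    rw [Finset.sum_eq_single_of_mem α (ht (Finset.mem_singleton_self α)), S.proj_same hx]
    exact fun β _ hβ => S.proj_ne hx hβ.symm

theorem SatisfiesSerre.nondegenerate {b : J → J → ℤ} (hS : S.SatisfiesSerre b) :
    S.B.Nondegenerate := by
  have hBproj : ∀ x β, ∀ y ∈ S.comp β, S.B (S.proj (-β) x) y = S.B x y := by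
    intro x β y hy
    induction x using S.comp_induction with
    | zero => simp
    | add x x' h h' => simp only [map_add, LinearMap.add_apply, h, h']
    | mem α x hx =>
      by_cases h : α = -β
      · subst h; rw [S.proj_same hx]
      · rw [S.proj_ne hx h, S.B_of_ne hx hy fun h' => h (eq_neg_of_add_eq_zero_left h')]
        simp
  have hleft : ∀ x, (∀ y, S.B x y = 0) → x = 0 := by
    intro x hx
    obtain ⟨s, hs⟩ := S.exists_sum_proj x
    rw [← hs s subset_rfl]
    refine Finset.sum_eq_zero fun α _ => hS.noRadical α _ (S.proj_mem α x) fun y hy => ?_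
    have := hBproj x (-α) y hy
    rw [neg_neg] at this
    rw [this, hx]
  have hsymm : ∀ x, (∀ y, S.B y x = 0) → ∀ y, S.B x y = 0 := by
    intro x hx y
    induction y using S.comp_induction with
    | zero => simp
    | add y y' h h' => rw [map_add, h, h', add_zero]
    | mem β y hy =>
      rw [← hBproj x β y hy, S.B_symm (S.proj_mem _ _) hy]
      have : ∀ z, S.B y (S.proj (-β) z) = S.B y z := by
        intro z
        induction z using S.comp_induction with
        | zero => simp
        | add x x' h h' => simp only [map_add, h, h']
        | mem α z hz =>
          by_cases h : α = -β
          · subst h; rw [S.proj_same hz]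
          · rw [S.proj_ne hz h, S.B_of_ne hy hz fun h' => h (eq_neg_of_add_eq_zero_right h')]
            simp
      rw [this, hx, mul_zero]
  exact ⟨hleft, fun x hx => hleft x (hsymm x hx)⟩

end RootGraded

/-! ### Serre elements are killed by the opposite generators. -/

namespace LieSuperalgebra

variable {L : Type*} [AddCommGroup L] [Module ℂ L] (𝓛 : LieSuperalgebra L)

theorem bracket_self_of_even {f : L} (hf : f ∈ 𝓛.part 0) : 𝓛.bracket f f = 0 := by
  have h := 𝓛.bracket_skew _ _ f f hf hf
  rw [superSign_zero_left, one_smul] at h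
  have h2 : (2 : ℂ) • 𝓛.bracket f f = 0 := by
    rw [two_smul]
    nth_rewrite 2 [h]
    exact add_neg_cancel _
  exact (smul_eq_zero.1 h2).resolve_left two_ne_zero

/-- For odd `f` the Jacobi identity reads `3 [f, [f, f]] = 0`. -/
theorem bracket_bracket_self {a : ZMod 2} {f : L} (hf : f ∈ 𝓛.part a) :
    𝓛.bracket f (𝓛.bracket f f) = 0 := by
  rcases zmod_two_cases a with rfl | rfl
  · rw [𝓛.bracket_self_of_even hf, map_zero]
  · have h1 := 𝓛.jacobi _ _ f f f hf hf
    have h2 := 𝓛.bracket_skew _ _ (𝓛.bracket f f) f (𝓛.bracket_mem _ _ _ _ hf hf) hf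
    rw [CharTwo.add_self_eq_zero, superSign_zero_left, one_smul] at h2
    rw [h2, superSign_one_one] at h1
    have h3 : (3 : ℂ) • 𝓛.bracket f (𝓛.bracket f f) = 0 := by
      generalize 𝓛.bracket f (𝓛.bracket f f) = x at h1 ⊢
      rw [← sub_eq_zero] at h1
      rw [← h1]
      module
    exact (smul_eq_zero.1 h3).resolve_left (by norm_num)

theorem bracket_iterate_of_bracket_eq_zero {a b : ZMod 2} {e f : L} (he : e ∈ 𝓛.part a)
    (hf : f ∈ 𝓛.part b) (hef : 𝓛.bracket e f = 0) (y : L) (n : ℕ) :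
    ∃ z : ℂ, 𝓛.bracket e ((𝓛.bracket f)^[n] y) = z • (𝓛.bracket f)^[n] (𝓛.bracket e y) := by
  induction n with
  | zero => exact ⟨1, by simp⟩
  | succ n ih =>
    obtain ⟨z, hz⟩ := ih
    refine ⟨superSign a b * z, ?_⟩
    rw [Function.iterate_succ_apply', 𝓛.jacobi a b e f _ he hf, hef, hz, map_smul,
      Function.iterate_succ_apply', smul_smul]
    simp

theorem iterate_bracket_mem {a b : ZMod 2} {f y : L} (hf : f ∈ 𝓛.part a) (hy : y ∈ 𝓛.part b)
    (n : ℕ) : (𝓛.bracket f)^[n] y ∈ 𝓛.part (n • a + b) := by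
  induction n with
  | zero => simpa using hy
  | succ n ih =>
    rw [Function.iterate_succ_apply', succ_nsmul', add_assoc]
    exact 𝓛.bracket_mem _ _ _ _ hf ih

end LieSuperalgebra

/-- The closed form is `(n + 1)(m - n)` for `s = 1`, and `m - n` at even `n` for `s = -1`. At odd
`n` the latter is `-(n + 1)`, so evenness of `m` is essential; it comes from `a_{ij} ∈ 2ℤ` for odd
real `i`. -/
theorem ladderCoeff_eq_zero {s : ℂ} (m : ℕ) (hs : s = 1 ∨ s = -1 ∧ Even m) :
    ladderCoeff s (fun n => m - 2 * n) m = 0 := by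
  rcases hs with rfl | ⟨rfl, k, rfl⟩
  · have key : ∀ n : ℕ, ladderCoeff 1 (fun n => (m : ℂ) - 2 * n) n = (n + 1) * (m - n) := by
      intro n
      induction n with
      | zero => simp [ladderCoeff]
      | succ n ih => rw [ladderCoeff, ih]; push_cast; ring
    rw [key]; simp
  · have key : ∀ n : ℕ,
        ladderCoeff (-1) (fun n => ((k + k : ℕ) : ℂ) - 2 * n) (n + n) = (k + k : ℕ) - 2 * n := by
      intro n
      induction n with
      | zero => simp [ladderCoeff]
      | succ n ih =>
        have : n + 1 + (n + 1) = n + n + 1 + 1 := by ring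
        rw [this, ladderCoeff, ladderCoeff, ih]; push_cast; ring
    rw [key]; push_cast; ring

namespace OddBorcherdsCartanDatum

variable {I P : Type*} [AddCommGroup P] (D : OddBorcherdsCartanDatum I P)

/-- The weight `l α_i` of `e_{il}`. -/
def indexWt (a : D.Index) : Cartan P →ₗ[ℂ] ℂ := (a.1.2 : ℂ) • cartanEval (D.simpleRoot a.1.1)

/-- Elements of a Lie superalgebra which satisfy the Chevalley relations. -/
structure ChevalleyElements {L : Type*} [AddCommGroup L] [Module ℂ L]
    (𝓛 : LieSuperalgebra L) where
  /-- the elements `e_{il}` -/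
  E : D.Index → L
  /-- the elements `f_{il}` -/
  F : D.Index → L
  /-- the map from the Cartan subalgebra -/
  Hc : Cartan P →ₗ[ℂ] L
  E_mem : ∀ a, E a ∈ 𝓛.part (D.indexParity a.1.1)
  F_mem : ∀ a, F a ∈ 𝓛.part (D.indexParity a.1.1)
  Hc_mem : ∀ t, Hc t ∈ 𝓛.part 0
  h_h : ∀ s t, 𝓛.bracket (Hc s) (Hc t) = 0
  e_f_same : ∀ a, 𝓛.bracket (E a) (F a) = (a.1.2 : ℂ) • Hc (D.coroot a.1.1)
  e_f_ne : ∀ a b, a ≠ b → 𝓛.bracket (E a) (F b) = 0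
  h_e : ∀ t a, 𝓛.bracket (Hc t) (E a) = D.indexWt a t • E a
  h_f : ∀ t a, 𝓛.bracket (Hc t) (F a) = -(D.indexWt a t) • F a

theorem index_eq_one {a : D.Index} (ha : D.A a.1.1 a.1.1 = 2) : a.1.2 = 1 := a.2.2 ha

theorem fst_ne_fst {a b : D.Index} (ha : D.A a.1.1 a.1.1 = 2) (hab : a ≠ b) :
    a.1.1 ≠ b.1.1 := by
  intro h
  exact hab (Subtype.ext (Prod.ext h ((a.2.2 ha).trans (b.2.2 (h ▸ ha)).symm)))

theorem A_eq_zero_symm {i j : I} (h : D.A i j = 0) : D.A j i = 0 := by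
  have h1 : D.d j * D.A j i = D.d i * D.A i j := D.symmetrizes.apply i j
  rw [h, mul_zero] at h1
  exact (mul_eq_zero.1 h1).resolve_left (D.d_pos j).ne'

theorem indexWt_coroot (a : D.Index) (i : I) :
    D.indexWt a (D.coroot i) = (a.1.2 : ℂ) * D.A i a.1.1 := by
  rw [indexWt, LinearMap.smul_apply, cartanEval_coroot, smul_eq_mul]

theorem superSign_indexParity (i : I) :
    superSign (D.indexParity i) (D.indexParity i) = 1 ∨
      (superSign (D.indexParity i) (D.indexParity i) = -1 ∧ i ∈ D.odd ∧ D.indexParity i = 1) := by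
  by_cases h : i ∈ D.odd
  · have : D.indexParity i = 1 := by simp [indexParity, h]
    exact Or.inr ⟨by rw [this, superSign_one_one], h, this⟩
  · have : D.indexParity i = 0 := by simp [indexParity, h]
    exact Or.inl (by rw [this, superSign_zero_left])

/-- The number of brackets in a Serre relation. -/
theorem exists_serre_exponent {a b : D.Index} (ha : D.A a.1.1 a.1.1 = 2) (hab : a ≠ b) :
    ∃ m : ℕ, (1 - (b.1.2 : ℤ) * D.A a.1.1 b.1.1).toNat = m + 1 ∧
      (m : ℤ) = -((b.1.2 : ℤ) * D.A a.1.1 b.1.1) ∧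
      (superSign (D.indexParity a.1.1) (D.indexParity a.1.1) = 1 ∨
        superSign (D.indexParity a.1.1) (D.indexParity a.1.1) = -1 ∧ Even m) := by
  have h := D.off_diag _ _ (D.fst_ne_fst ha hab)
  have h1 : 0 ≤ -((b.1.2 : ℤ) * D.A a.1.1 b.1.1) := by
    have : (0 : ℤ) ≤ b.1.2 := Int.natCast_nonneg _
    nlinarith
  obtain ⟨m, hm⟩ := Int.eq_ofNat_of_zero_le h1
  refine ⟨m, by omega, hm.symm, ?_⟩
  rcases D.superSign_indexParity a.1.1 with hs | ⟨hs, hodd, -⟩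
  · exact Or.inl hs
  · refine Or.inr ⟨hs, ?_⟩
    have h2 : Even (m : ℤ) := by
      rw [← hm, even_neg]
      exact (D.odd_real _ hodd ha _).mul_left _
    exact_mod_cast h2

variable {D}

namespace ChevalleyElements

variable {L : Type*} [AddCommGroup L] [Module ℂ L] {𝓛 : LieSuperalgebra L}
  (C : D.ChevalleyElements 𝓛)

/-- The elements with the roles of `e_{il}` and `f_{il}` exchanged. -/
def swap : D.ChevalleyElements 𝓛 where
  E := C.F
  -- The sign makes the bracket of the exchanged pair exactly the negative of the old one, matching
  -- the negated `Hc`.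
  F a := superSign (D.indexParity a.1.1) (D.indexParity a.1.1) • C.E a
  Hc := -C.Hc
  E_mem := C.F_mem
  F_mem a := Submodule.smul_mem _ _ (C.E_mem a)
  Hc_mem t := neg_mem (C.Hc_mem t)
  h_h s t := by simp [C.h_h]
  e_f_same a := by
    rw [map_smul, 𝓛.bracket_skew _ _ _ _ (C.F_mem a) (C.E_mem a), C.e_f_same, smul_neg, smul_smul,
      superSign_mul_self, one_smul, LinearMap.neg_apply, smul_neg]
  e_f_ne a b hab := by
    rw [map_smul, 𝓛.bracket_skew _ _ _ _ (C.F_mem a) (C.E_mem b), C.e_f_ne b a hab.symm]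
    simp
  h_e t a := by simp [C.h_f]
  h_f t a := by
    rw [LinearMap.neg_apply, map_neg, LinearMap.neg_apply, map_smul, C.h_e, smul_comm, neg_smul]

theorem f_h (t : Cartan P) (a : D.Index) : 𝓛.bracket (C.F a) (C.Hc t) = D.indexWt a t • C.F a := by
  rw [𝓛.bracket_skew _ _ _ _ (C.F_mem a) (C.Hc_mem t), C.h_f]
  simp

/-- A weight vector for the Cartan subalgebra. -/
def IsWeight (κ : Cartan P →ₗ[ℂ] ℂ) (x : L) : Prop := ∀ t, 𝓛.bracket (C.Hc t) x = κ t • x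

variable {C}

theorem IsWeight.bracket {κ μ : Cartan P →ₗ[ℂ] ℂ} {x y : L} {a : ZMod 2} (hxa : x ∈ 𝓛.part a)
    (hx : C.IsWeight κ x) (hy : C.IsWeight μ y) : C.IsWeight (κ + μ) (𝓛.bracket x y) := by
  intro t
  rw [𝓛.jacobi _ _ _ _ _ (C.Hc_mem t) hxa, hx t, hy t, superSign_zero_left, map_smul,
    LinearMap.smul_apply, map_smul, one_smul, ← add_smul]
  rfl

variable (C)

theorem isWeight_F (a : D.Index) : C.IsWeight (-D.indexWt a) (C.F a) := fun t => C.h_f t a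

theorem isWeight_iterate (a b : D.Index) (n : ℕ) :
    C.IsWeight (-(n • D.indexWt a + D.indexWt b)) ((𝓛.bracket (C.F a))^[n] (C.F b)) := by
  induction n with
  | zero => simpa using C.isWeight_F b
  | succ n ih =>
    rw [Function.iterate_succ_apply']
    have := (C.isWeight_F a).bracket (C.F_mem a) ih
    convert this using 1
    module

/-- For `c = a` the string coefficient vanishes by `ladderCoeff_eq_zero`. Otherwise `E c` passes
through the `F a` up to sign and only `c = b` matters: `[E b, F b]` lies in `𝔥`, so one `F a` turns
it into a multiple of `F a`. With `m = 0` that multiple is zero; for even `F a` then `[F a, F a] =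
0`, and for odd `F a` the even number `m` is at least `2`, so `[F a, [F a, F a]] = 0` applies. -/
theorem e_serre_f {a b : D.Index} (ha : D.A a.1.1 a.1.1 = 2) (hab : a ≠ b) (c : D.Index) :
    𝓛.bracket (C.E c) ((𝓛.bracket (C.F a))^[(1 - (b.1.2 : ℤ) * D.A a.1.1 b.1.1).toNat] (C.F b)) =
      0 := by
  obtain ⟨m, hm1, hm2, hm3⟩ := D.exists_serre_exponent ha hab
  rw [hm1]
  by_cases hca : c = a
  · subst hca
    have h := 𝓛.bracket_iterate (C.E_mem c) (C.F_mem c) (C.e_f_same c) (C.e_f_ne c b hab)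
      (lam := fun n => (m : ℂ) - 2 * n) (fun n => by
        rw [map_smul, LinearMap.smul_apply, C.isWeight_iterate c b n, smul_smul]
        congr 1
        have h1 : (m : ℂ) = -((b.1.2 : ℂ) * D.A c.1.1 b.1.1) := by exact_mod_cast hm2
        rw [h1]
        simp only [LinearMap.neg_apply, LinearMap.add_apply, LinearMap.smul_apply,
          D.indexWt_coroot, ha, D.index_eq_one ha]
        simp
        ring)
    rw [h m, ladderCoeff_eq_zero m hm3, zero_smul]
  obtain ⟨z, hz⟩ := 𝓛.bracket_iterate_of_bracket_eq_zero (C.E_mem c) (C.F_mem a)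
    (C.e_f_ne c a hca) (C.F b) (m + 1)
  rw [hz]
  by_cases hcb : c = b
  swap
  · rw [C.e_f_ne c b hcb]
    simp
  subst hcb
  rw [C.e_f_same c, ← map_smul, Function.iterate_succ_apply, C.f_h, iterate_smul_apply, map_smul,
    D.indexWt_coroot]
  rcases m with _ | m
  · have h0 : D.A a.1.1 c.1.1 = 0 := by
      have hc := c.2.1
      have h2 : (c.1.2 : ℤ) * D.A a.1.1 c.1.1 = 0 := by omega
      exact (mul_eq_zero.1 h2).resolve_left (by omega)
    rw [D.A_eq_zero_symm h0]
    simp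
  · have h0 : (𝓛.bracket (C.F a))^[m + 1] (C.F a) = 0 := by
      rcases zmod_two_cases (D.indexParity a.1.1) with hp | hp
      · have := C.F_mem a
        rw [hp] at this
        rw [Function.iterate_succ_apply, 𝓛.bracket_self_of_even this, iterate_map_zero]
      · rw [hp, superSign_one_one] at hm3
        have : Even (m + 1) := by
          rcases hm3 with h | h
          · norm_num at h
          · exact h.2
        obtain ⟨k, rfl⟩ : ∃ k, m = k + 1 := by
          cases m with
          | zero => simp at this
          | succ k => exact ⟨k, rfl⟩
        rw [Function.iterate_succ_apply, Function.iterate_succ_apply,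
          𝓛.bracket_bracket_self (C.F_mem a), iterate_map_zero]
    rw [h0]; simp

theorem e_f_f {a b : D.Index} (hab : D.A a.1.1 b.1.1 = 0) (c : D.Index) :
    𝓛.bracket (C.E c) (𝓛.bracket (C.F a) (C.F b)) = 0 := by
  rw [𝓛.jacobi _ _ _ _ _ (C.E_mem c) (C.F_mem a)]
  have h1 : 𝓛.bracket (𝓛.bracket (C.E c) (C.F a)) (C.F b) = 0 := by
    by_cases h : c = a
    · subst h
      rw [C.e_f_same, map_smul, LinearMap.smul_apply, C.h_f, D.indexWt_coroot, hab]
      simp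
    · rw [C.e_f_ne c a h]; simp
  have h2 : 𝓛.bracket (C.F a) (𝓛.bracket (C.E c) (C.F b)) = 0 := by
    by_cases h : c = b
    · subst h
      rw [C.e_f_same, map_smul, C.f_h, D.indexWt_coroot, D.A_eq_zero_symm hab]
      simp
    · rw [C.e_f_ne c b h]; simp
  rw [h1, h2]; simp

theorem swap_iterate (a b : D.Index) (n : ℕ) : ∃ z : ℂ, z ≠ 0 ∧
    (𝓛.bracket (C.swap.F a))^[n] (C.swap.F b) = z • (𝓛.bracket (C.E a))^[n] (C.E b) := by
  have hs : ∀ a : D.Index, superSign (D.indexParity a.1.1) (D.indexParity a.1.1) ≠ 0 := fun a =>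
    left_ne_zero_of_mul_eq_one (superSign_mul_self _ _)
  induction n with
  | zero => exact ⟨_, hs b, rfl⟩
  | succ n ih =>
    obtain ⟨z, hz, h⟩ := ih
    refine ⟨_, mul_ne_zero (hs a) hz, ?_⟩
    rw [Function.iterate_succ_apply', h, Function.iterate_succ_apply', map_smul, mul_comm, mul_smul]
    congr 1
    exact LinearMap.congr_fun (map_smul 𝓛.bracket _ (C.E a)) _

theorem f_serre_e {a b : D.Index} (ha : D.A a.1.1 a.1.1 = 2) (hab : a ≠ b) (c : D.Index) :
    𝓛.bracket (C.F c) ((𝓛.bracket (C.E a))^[(1 - (b.1.2 : ℤ) * D.A a.1.1 b.1.1).toNat] (C.E b)) =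
      0 := by
  have h := C.swap.e_serre_f ha hab c
  obtain ⟨z, hz, h'⟩ := C.swap_iterate a b (1 - (b.1.2 : ℤ) * D.A a.1.1 b.1.1).toNat
  rw [h', map_smul] at h
  exact (smul_eq_zero.1 h).resolve_left hz

theorem f_e_e {a b : D.Index} (hab : D.A a.1.1 b.1.1 = 0) (c : D.Index) :
    𝓛.bracket (C.F c) (𝓛.bracket (C.E a) (C.E b)) = 0 := by
  have h := C.swap.e_f_f hab c
  obtain ⟨z, hz, h'⟩ := C.swap_iterate a b 1
  simp only [Function.iterate_one] at h'
  rw [h', map_smul] at h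
  exact (smul_eq_zero.1 h).resolve_left hz

end ChevalleyElements

end OddBorcherdsCartanDatum

/-! ### The algebra with the Chevalley relations only. -/

namespace OddBorcherdsCartanDatum

variable {I P : Type*} [AddCommGroup P] (D : OddBorcherdsCartanDatum I P)

/-- The defining relators other than the Serre relators. -/
inductive IsChevalleyRelator : FreeNonUnitalNonAssocAlgebra ℂ D.Gen → Prop
  | h_add (s t : Cartan P) : IsChevalleyRelator (D.freeH (s + t) - (D.freeH s + D.freeH t))
  | h_smul (c : ℂ) (t : Cartan P) : IsChevalleyRelator (D.freeH (c • t) - c • D.freeH t)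
  | h_h (s t : Cartan P) : IsChevalleyRelator (D.freeH s * D.freeH t)
  | e_f_same (a : D.Index) :
      IsChevalleyRelator (D.freeE a * D.freeF a - (a.1.2 : ℂ) • D.freeH (D.coroot a.1.1))
  | e_f_ne (a b : D.Index) (hab : a ≠ b) : IsChevalleyRelator (D.freeE a * D.freeF b)
  | h_e (t : Cartan P) (a : D.Index) :
      IsChevalleyRelator (D.freeH t * D.freeE a -
        ((a.1.2 : ℂ) * cartanEval (D.simpleRoot a.1.1) t) • D.freeE a)
  | h_f (t : Cartan P) (a : D.Index) :
      IsChevalleyRelator (D.freeH t * D.freeF a +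
        ((a.1.2 : ℂ) * cartanEval (D.simpleRoot a.1.1) t) • D.freeF a)

theorem IsChevalleyRelator.isRelator {r : FreeNonUnitalNonAssocAlgebra ℂ D.Gen}
    (h : D.IsChevalleyRelator r) : D.IsRelator r := by
  cases h with
  | h_add s t => exact .h_add s t
  | h_smul c t => exact .h_smul c t
  | h_h s t => exact .h_h s t
  | e_f_same a => exact .e_f_same a
  | e_f_ne a b h => exact .e_f_ne a b h
  | h_e t a => exact .h_e t a
  | h_f t a => exact .h_f t a

open SuperPresentation

/-- The images of the generators in a presented Lie superalgebra. -/
def presentedChevalley {R : Set (FreeNonUnitalNonAssocAlgebra ℂ D.Gen)}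
    (hR : ∀ r ∈ R, ∃ a, r ∈ freePart D.genParity a)
    (h : ∀ r, D.IsChevalleyRelator r → r ∈ R) :
    D.ChevalleyElements (presentedLieSuperalgebra D.genParity R hR) where
  E a := (relIdeal D.genParity R).mkQ (D.freeE a)
  F a := (relIdeal D.genParity R).mkQ (D.freeF a)
  Hc :=
    { toFun := fun t => (relIdeal D.genParity R).mkQ (D.freeH t)
      map_add' := fun s t => (Submodule.Quotient.eq _).2 (relator_mem (.rel _ (h _ (.h_add s t))))
      map_smul' := fun c t =>
        (Submodule.Quotient.eq _).2 (relator_mem (.rel _ (h _ (.h_smul c t)))) }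
  E_mem a := ⟨_, D.freeE_mem a, rfl⟩
  F_mem a := ⟨_, D.freeF_mem a, rfl⟩
  Hc_mem t := ⟨_, D.freeH_mem t, rfl⟩
  h_h s t := (Submodule.Quotient.mk_eq_zero _).2 (relator_mem (.rel _ (h _ (.h_h s t))))
  e_f_same a := (Submodule.Quotient.eq _).2 (relator_mem (.rel _ (h _ (.e_f_same a))))
  e_f_ne a b hab :=
    (Submodule.Quotient.mk_eq_zero _).2 (relator_mem (.rel _ (h _ (.e_f_ne a b hab))))
  h_e t a := (Submodule.Quotient.eq _).2 (relator_mem (.rel _ (h _ (.h_e t a))))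
  h_f t a := by
    rw [neg_smul, eq_neg_iff_add_eq_zero]
    exact (Submodule.Quotient.mk_eq_zero _).2 (relator_mem (.rel _ (h _ (.h_f t a))))

/-- The Lie superalgebra with the Chevalley relations only, as a vector space. -/
abbrev Pre : Type _ := Presented D.genParity {r | D.IsChevalleyRelator r}

theorem isChevalleyRelator_homogeneous : ∀ r ∈ {r | D.IsChevalleyRelator r},
    ∃ a, r ∈ freePart D.genParity a :=
  fun r hr => D.isRelator_homogeneous r (IsChevalleyRelator.isRelator D hr)

/-- The Lie superalgebra with the Chevalley relations only. -/
def preLie : LieSuperalgebra D.Pre :=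
  presentedLieSuperalgebra D.genParity {r | D.IsChevalleyRelator r}
    D.isChevalleyRelator_homogeneous

/-- The generators of the Lie superalgebra with the Chevalley relations only. -/
def preChevalley : D.ChevalleyElements D.preLie :=
  D.presentedChevalley D.isChevalleyRelator_homogeneous fun _ h => h

/-! ### Verma modules -/

/-- The space underlying a Verma module: the span of the words in the `f_{il}`. -/
abbrev Verma : Type _ := List D.Index →₀ ℂ

/-- The basis vector given by a word. -/
abbrev word (w : List D.Index) : D.Verma := Finsupp.single w 1

variable {D}

theorem verma_ext {M : Type*} [AddCommGroup M] [Module ℂ M] {f g : D.Verma →ₗ[ℂ] M}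
    (h : ∀ w, f (D.word w) = g (D.word w)) : f = g :=
  Finsupp.lhom_ext' fun w => LinearMap.ext_ring (h w)

variable (D) in
/-- The action of `f_{il}` on the Verma module. -/
def opF (a : D.Index) : Module.End ℂ D.Verma :=
  Finsupp.linearCombination ℂ fun w => D.word (a :: w)

/-- The weight of a word. -/
def wordWt : List D.Index → (Cartan P →ₗ[ℂ] ℂ)
  | [] => 0
  | a :: w => D.indexWt a + wordWt w

/-- The action of the Cartan subalgebra on the Verma module of highest weight `lam`. -/
def opH (lam : Cartan P →ₗ[ℂ] ℂ) (t : Cartan P) : Module.End ℂ D.Verma :=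
  Finsupp.linearCombination ℂ fun w => (lam t - wordWt w t) • D.word w

open Classical in
/-- The action of `e_{il}` on a word. -/
def eWord (lam : Cartan P →ₗ[ℂ] ℂ) (a : D.Index) : List D.Index → D.Verma
  | [] => 0
  | b :: w => (if a = b then (a.1.2 : ℂ) • opH lam (D.coroot a.1.1) (D.word w) else 0) +
      superSign (D.indexParity a.1.1) (D.indexParity b.1.1) • D.opF b (eWord lam a w)

/-- The action of `e_{il}` on the Verma module. -/
def opE (lam : Cartan P →ₗ[ℂ] ℂ) (a : D.Index) : Module.End ℂ D.Verma :=
  Finsupp.linearCombination ℂ (eWord lam a)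

@[simp] theorem opF_word (a : D.Index) (w : List D.Index) :
    D.opF a (D.word w) = D.word (a :: w) := by
  simp [opF]

@[simp] theorem opH_word (lam : Cartan P →ₗ[ℂ] ℂ) (t : Cartan P) (w : List D.Index) :
    opH lam t (D.word w) = (lam t - wordWt w t) • D.word w := by
  simp [opH]

@[simp] theorem opE_word (lam : Cartan P →ₗ[ℂ] ℂ) (a : D.Index) (w : List D.Index) :
    opE lam a (D.word w) = eWord lam a w := by
  simp [opE]

theorem opH_add (lam : Cartan P →ₗ[ℂ] ℂ) (s t : Cartan P) :
    opH (D := D) lam (s + t) = opH lam s + opH lam t := by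
  refine verma_ext fun w => ?_
  rw [LinearMap.add_apply]
  simp only [opH_word, map_add]
  module

theorem opH_smul (lam : Cartan P →ₗ[ℂ] ℂ) (c : ℂ) (t : Cartan P) :
    opH (D := D) lam (c • t) = c • opH lam t := by
  refine verma_ext fun w => ?_
  rw [LinearMap.smul_apply]
  simp only [opH_word, map_smul, smul_eq_mul]
  module

theorem opH_opH (lam : Cartan P →ₗ[ℂ] ℂ) (s t : Cartan P) :
    opH (D := D) lam s * opH lam t = opH lam t * opH lam s := by
  refine verma_ext fun w => ?_
  simp only [Module.End.mul_apply, opH_word, map_smul]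
  rw [smul_comm]

theorem opH_opF (lam : Cartan P →ₗ[ℂ] ℂ) (t : Cartan P) (a : D.Index) :
    opH lam t * D.opF a = D.opF a * opH lam t - D.indexWt a t • D.opF a := by
  refine verma_ext fun w => ?_
  simp only [Module.End.mul_apply, opH_word, opF_word, map_smul, LinearMap.sub_apply,
    LinearMap.smul_apply, wordWt, LinearMap.add_apply]
  module

open Classical in
theorem opE_opF (lam : Cartan P →ₗ[ℂ] ℂ) (a b : D.Index) :
    opE lam a * D.opF b = (if a = b then (a.1.2 : ℂ) • opH lam (D.coroot a.1.1) else 0) +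
      superSign (D.indexParity a.1.1) (D.indexParity b.1.1) • (D.opF b * opE lam a) := by
  refine verma_ext fun w => ?_
  simp only [Module.End.mul_apply, opF_word, opE_word, LinearMap.add_apply, LinearMap.smul_apply]
  rw [eWord]
  congr 1
  split_ifs
  · rfl
  · rfl

theorem opH_opE (lam : Cartan P →ₗ[ℂ] ℂ) (t : Cartan P) (a : D.Index) :
    opH lam t * opE lam a = opE lam a * opH lam t + D.indexWt a t • opE lam a := by
  classical
  refine verma_ext fun w => ?_
  induction w with
  | nil =>
    simp only [Module.End.mul_apply, LinearMap.add_apply, LinearMap.smul_apply, opE_word, opH_word,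
      map_smul, eWord, map_zero, smul_zero, add_zero]
  | cons b w ih =>
    have h1 : opH lam t (D.opF b (eWord lam a w)) =
        D.opF b (opH lam t (eWord lam a w)) - D.indexWt b t • D.opF b (eWord lam a w) :=
      LinearMap.congr_fun (opH_opF lam t b) (eWord lam a w)
    simp only [Module.End.mul_apply, LinearMap.add_apply, LinearMap.smul_apply, opE_word, opH_word,
      map_smul, eWord, map_add, wordWt] at ih ⊢
    rw [h1, ih]
    by_cases hab : a = b
    · subst hab
      simp only [if_true, map_add, map_smul, opH_word]
      module
    · simp only [if_neg hab, map_add, map_smul, map_zero]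
      module

/-- The values of the generators on the Verma module. -/
def vermaGen (lam : Cartan P →ₗ[ℂ] ℂ) : D.Gen → Module.End ℂ D.Verma
  | .e a => opE lam a
  | .f a => D.opF a
  | .h t => opH lam t

theorem freeRep_freeE {A : Type*} [Ring A] [Algebra ℂ A] (g : D.Gen → A) (a : D.Index) :
    freeRep D.genParity g (D.freeE a) = g (.e a) := freeRep_of g _

theorem freeRep_freeF {A : Type*} [Ring A] [Algebra ℂ A] (g : D.Gen → A) (a : D.Index) :
    freeRep D.genParity g (D.freeF a) = g (.f a) := freeRep_of g _

theorem freeRep_freeH {A : Type*} [Ring A] [Algebra ℂ A] (g : D.Gen → A) (t : Cartan P) :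
    freeRep D.genParity g (D.freeH t) = g (.h t) := freeRep_of g _

theorem freeRep_vermaGen (lam : Cartan P →ₗ[ℂ] ℂ) :
    ∀ r ∈ {r | D.IsChevalleyRelator r}, freeRep D.genParity (vermaGen lam) r = 0 := by
  classical
  intro r hr
  cases hr with
  | h_add s t =>
    rw [map_sub, map_add, freeRep_freeH, freeRep_freeH, freeRep_freeH, sub_eq_zero]
    exact opH_add lam s t
  | h_smul c t =>
    rw [map_sub, map_smul, freeRep_freeH, freeRep_freeH, sub_eq_zero]
    exact opH_smul lam c t
  | h_h s t =>
    rw [freeRep_mul _ (D.freeH_mem s) (D.freeH_mem t), freeRep_freeH, freeRep_freeH,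
      superSign_zero_left, one_smul, sub_eq_zero]
    exact opH_opH lam s t
  | e_f_same a =>
    rw [map_sub, map_smul, freeRep_mul _ (D.freeE_mem a) (D.freeF_mem a), freeRep_freeE,
      freeRep_freeF, freeRep_freeH]
    change opE lam a * D.opF a - _ • (D.opF a * opE lam a) - _ • opH lam _ = 0
    rw [opE_opF, if_pos rfl]
    abel
  | e_f_ne a b hab =>
    rw [freeRep_mul _ (D.freeE_mem a) (D.freeF_mem b), freeRep_freeE, freeRep_freeF]
    change opE lam a * D.opF b - _ • (D.opF b * opE lam a) = 0
    rw [opE_opF, if_neg hab, zero_add, sub_self]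
  | h_e t a =>
    rw [map_sub, map_smul, freeRep_mul _ (D.freeH_mem t) (D.freeE_mem a), freeRep_freeE,
      freeRep_freeH, superSign_zero_left, one_smul]
    change opH lam t * opE lam a - opE lam a * opH lam t - D.indexWt a t • opE lam a = 0
    rw [opH_opE]; abel
  | h_f t a =>
    rw [map_add, map_smul, freeRep_mul _ (D.freeH_mem t) (D.freeF_mem a), freeRep_freeF,
      freeRep_freeH, superSign_zero_left, one_smul]
    change opH lam t * D.opF a - D.opF a * opH lam t + D.indexWt a t • D.opF a = 0
    rw [opH_opF]; abel

/-- The Verma module of highest weight `lam`. -/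
def vermaRep (lam : Cartan P →ₗ[ℂ] ℂ) : D.Pre →ₗ[ℂ] Module.End ℂ D.Verma :=
  presentedRep D.isChevalleyRelator_homogeneous (vermaGen lam) (freeRep_vermaGen lam)

theorem vermaRep_E (lam : Cartan P →ₗ[ℂ] ℂ) (a : D.Index) :
    vermaRep lam (D.preChevalley.E a) = opE lam a := freeRep_freeE _ a

theorem vermaRep_F (lam : Cartan P →ₗ[ℂ] ℂ) (a : D.Index) :
    vermaRep lam (D.preChevalley.F a) = D.opF a := freeRep_freeF _ a

theorem vermaRep_H (lam : Cartan P →ₗ[ℂ] ℂ) (t : Cartan P) :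
    vermaRep lam (D.preChevalley.Hc t) = opH lam t := freeRep_freeH _ t

theorem vermaRep_bracket (lam : Cartan P →ₗ[ℂ] ℂ) {a b : ZMod 2} {x y : D.Pre}
    (hx : x ∈ D.preLie.part a) (hy : y ∈ D.preLie.part b) :
    vermaRep lam (D.preLie.bracket x y) = vermaRep lam x * vermaRep lam y -
      superSign a b • (vermaRep lam y * vermaRep lam x) :=
  presentedRep_bracket D.isChevalleyRelator_homogeneous (vermaGen lam) (freeRep_vermaGen lam) hx hy

/-! ### Elements which act by zero on the irreducible quotient -/

/-- The operator of `x` supercommutes with every `f`, and words in the `f` applied to the highest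
weight vector span the module. -/
theorem vermaRep_eq_zero (lam : Cartan P →ₗ[ℂ] ℂ) {p : ZMod 2} {x : D.Pre}
    (hx : x ∈ D.preLie.part p) (hF : ∀ c, D.preLie.bracket (D.preChevalley.F c) x = 0)
    (hv : vermaRep lam x (D.word []) = 0) : vermaRep lam x = 0 := by
  refine verma_ext fun w => ?_
  induction w with
  | nil => exact hv
  | cons c w ih =>
    have h := vermaRep_bracket lam (D.preChevalley.F_mem c) hx
    rw [hF, map_zero, vermaRep_F] at h
    have h1 := LinearMap.congr_fun h (D.word w)
    simp only [LinearMap.smul_apply, LinearMap.sub_apply, Module.End.mul_apply, opF_word] at h1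
    rw [ih, LinearMap.zero_apply, map_zero, eq_comm, sub_eq_zero] at h1
    rw [LinearMap.zero_apply]
    refine (smul_eq_zero.1 h1.symm).resolve_left ?_
    exact left_ne_zero_of_mul_eq_one (superSign_mul_self _ _)

theorem vermaRep_bracket_E_word_nil (lam : Cartan P →ₗ[ℂ] ℂ) {p : ZMod 2} {x : D.Pre}
    (hx : x ∈ D.preLie.part p) (hv : vermaRep lam x (D.word []) = 0) (a : D.Index) :
    vermaRep lam (D.preLie.bracket (D.preChevalley.E a) x) (D.word []) = 0 := by
  rw [vermaRep_bracket lam (D.preChevalley.E_mem a) hx, vermaRep_E]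
  simp [hv, eWord]

theorem vermaRep_iterate_E (lam : Cartan P →ₗ[ℂ] ℂ) (a b : D.Index) (n : ℕ) :
    vermaRep lam ((D.preLie.bracket (D.preChevalley.E a))^[n] (D.preChevalley.E b))
      (D.word []) = 0 := by
  induction n with
  | zero => rw [Function.iterate_zero, id_eq, vermaRep_E]; simp [eWord]
  | succ n ih =>
    rw [Function.iterate_succ_apply']
    exact vermaRep_bracket_E_word_nil lam
      (D.preLie.iterate_bracket_mem (D.preChevalley.E_mem a) (D.preChevalley.E_mem b) n) ih a

/-- The coefficient of the highest weight vector. -/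
def topCoeff : D.Verma →ₗ[ℂ] ℂ := Finsupp.lapply []

theorem topCoeff_opF (a : D.Index) (m : D.Verma) : topCoeff (D.opF a m) = 0 := by
  have : topCoeff ∘ₗ D.opF a = 0 := verma_ext fun w => by simp [topCoeff]
  exact LinearMap.congr_fun this m

/-- The algebra of operators on the Verma module generated by the action. -/
def opAlg (lam : Cartan P →ₗ[ℂ] ℂ) : Subalgebra ℂ (Module.End ℂ D.Verma) :=
  Algebra.adjoin ℂ (Set.range (vermaGen lam))

/-- The maximal proper submodule of the Verma module. -/
def maxSubmodule (lam : Cartan P →ₗ[ℂ] ℂ) : Submodule ℂ D.Verma where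
  carrier := {m | ∀ X ∈ opAlg lam, topCoeff (X m) = 0}
  zero_mem' X _ := by simp
  add_mem' hx hy X hX := by rw [map_add, map_add, hx X hX, hy X hX, add_zero]
  smul_mem' c x hx X hX := by rw [map_smul, map_smul, hx X hX, smul_zero]

theorem vermaGen_mem_opAlg (lam : Cartan P →ₗ[ℂ] ℂ) (g : D.Gen) : vermaGen lam g ∈ opAlg lam :=
  Algebra.subset_adjoin ⟨g, rfl⟩

theorem apply_mem_maxSubmodule {lam : Cartan P →ₗ[ℂ] ℂ} {X : Module.End ℂ D.Verma}
    (hX : X ∈ opAlg lam) {m : D.Verma} (hm : m ∈ maxSubmodule lam) : X m ∈ maxSubmodule lam :=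
  fun Y hY => hm (Y * X) (mul_mem hY hX)

theorem word_nil_notMem_maxSubmodule (lam : Cartan P →ₗ[ℂ] ℂ) :
    D.word [] ∉ maxSubmodule lam := fun h => by
  have := h 1 (one_mem _)
  simp [topCoeff] at this

/-- The submodule generated by the image of an operator. -/
inductive Generated (X : Module.End ℂ D.Verma) : D.Verma → Prop
  | base (m : D.Verma) : Generated X (X m)
  | opF (a : D.Index) (m : D.Verma) (h : Generated X m) : Generated X (D.opF a m)
  | add (m m' : D.Verma) (h : Generated X m) (h' : Generated X m') : Generated X (m + m')
  | smul (c : ℂ) (m : D.Verma) (h : Generated X m) : Generated X (c • m)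

/-- Since `x` supercommutes with the `e` and is a weight vector, the closure of its image under the
`f` is stable under all operators. No vector there has a top coefficient: those in the image of `x`
by `htop`, those in the image of an `f` trivially. -/
theorem vermaRep_mem_maxSubmodule (lam : Cartan P →ₗ[ℂ] ℂ) {p : ZMod 2} {x : D.Pre}
    (hx : x ∈ D.preLie.part p) (hE : ∀ c, D.preLie.bracket (D.preChevalley.E c) x = 0)
    {κ : Cartan P →ₗ[ℂ] ℂ} (hκ : D.preChevalley.IsWeight κ x)
    (htop : ∀ m, topCoeff (vermaRep lam x m) = 0) (m : D.Verma) :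
    vermaRep lam x m ∈ maxSubmodule lam := by
  classical
  have hH : ∀ t m, Generated (vermaRep lam x) m → Generated (vermaRep lam x) (opH lam t m) := by
    intro t m hm
    induction hm with
    | base m =>
      have h := vermaRep_bracket lam (D.preChevalley.Hc_mem t) hx
      rw [hκ t, map_smul, vermaRep_H, superSign_zero_left, one_smul] at h
      have h1 := LinearMap.congr_fun h m
      simp only [LinearMap.smul_apply, LinearMap.sub_apply, Module.End.mul_apply] at h1
      rw [eq_add_of_sub_eq h1.symm]
      exact .add _ _ (.smul _ _ (.base _)) (.base _)
    | opF a m hm ih =>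
      have h1 := LinearMap.congr_fun (opH_opF lam t a) m
      simp only [LinearMap.smul_apply, LinearMap.sub_apply, Module.End.mul_apply] at h1
      rw [h1, sub_eq_add_neg, ← neg_smul]
      exact .add _ _ (.opF _ _ ih) (.smul _ _ (.opF _ _ hm))
    | add m m' _ _ ih ih' => rw [map_add]; exact .add _ _ ih ih'
    | smul c m _ ih => rw [map_smul]; exact .smul _ _ ih
  have hEm : ∀ c m, Generated (vermaRep lam x) m → Generated (vermaRep lam x) (opE lam c m) := by
    intro c m hm
    induction hm with
    | base m =>
      have h := vermaRep_bracket lam (D.preChevalley.E_mem c) hx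
      rw [hE, map_zero, vermaRep_E] at h
      have h1 := LinearMap.congr_fun h m
      simp only [LinearMap.smul_apply, LinearMap.sub_apply, LinearMap.zero_apply,
        Module.End.mul_apply] at h1
      rw [eq_comm, sub_eq_zero] at h1
      rw [h1]
      exact .smul _ _ (.base _)
    | opF a m hm ih =>
      have h1 := LinearMap.congr_fun (opE_opF lam c a) m
      simp only [LinearMap.smul_apply, LinearMap.add_apply, Module.End.mul_apply] at h1
      rw [h1]
      refine .add _ _ ?_ (.smul _ _ (.opF _ _ ih))
      split_ifs
      · exact .smul _ _ (hH _ _ hm)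
      · rw [LinearMap.zero_apply, ← zero_smul ℂ m]
        exact .smul _ _ hm
    | add m m' _ _ ih ih' => rw [map_add]; exact .add _ _ ih ih'
    | smul c m _ ih => rw [map_smul]; exact .smul _ _ ih
  have hAlg : ∀ X ∈ opAlg lam, ∀ m, Generated (vermaRep lam x) m →
      Generated (vermaRep lam x) (X m) := by
    intro X hX
    induction hX using Algebra.adjoin_induction with
    | mem X hX =>
      obtain ⟨g, rfl⟩ := hX
      cases g with
      | e a => exact hEm a
      | f a => exact fun m hm => .opF a m hm
      | h t => exact hH t
    | algebraMap c => exact fun m hm => .smul c m hm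
    | add X Y _ _ hX hY => exact fun m hm => .add _ _ (hX m hm) (hY m hm)
    | mul X Y _ _ hX hY => exact fun m hm => hX _ (hY m hm)
  have hzero : ∀ m, Generated (vermaRep lam x) m → topCoeff m = 0 := by
    intro m hm
    induction hm with
    | base m => exact htop m
    | opF a m _ _ => exact topCoeff_opF a m
    | add m m' _ _ ih ih' => rw [map_add, ih, ih', add_zero]
    | smul c m _ ih => rw [map_smul, ih, smul_zero]
  exact fun X hX => hzero _ (hAlg X hX _ (.base m))

theorem topCoeff_vermaRep_iterate_F (lam : Cartan P →ₗ[ℂ] ℂ) (a b : D.Index) (n : ℕ) :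
    ∀ m, topCoeff (vermaRep lam
      ((D.preLie.bracket (D.preChevalley.F a))^[n] (D.preChevalley.F b)) m) = 0 := by
  induction n with
  | zero =>
    intro m
    rw [Function.iterate_zero, id_eq, vermaRep_F, topCoeff_opF]
  | succ n ih =>
    intro m
    rw [Function.iterate_succ_apply', vermaRep_bracket lam (D.preChevalley.F_mem a)
      (D.preLie.iterate_bracket_mem (D.preChevalley.F_mem a) (D.preChevalley.F_mem b) n),
      vermaRep_F]
    simp only [LinearMap.sub_apply, LinearMap.smul_apply, Module.End.mul_apply, map_sub, map_smul,
      topCoeff_opF, ih]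
    simp

theorem mkQ_iterate {R : Set (FreeNonUnitalNonAssocAlgebra ℂ D.Gen)}
    (x y : FreeNonUnitalNonAssocAlgebra ℂ D.Gen) (n : ℕ) :
    (relIdeal D.genParity R).mkQ ((fun z => x * z)^[n] y) =
      (presentedBracket D.genParity R ((relIdeal D.genParity R).mkQ x))^[n]
        ((relIdeal D.genParity R).mkQ y) := by
  induction n with
  | zero => rfl
  | succ n ih =>
    rw [Function.iterate_succ_apply', Function.iterate_succ_apply', ← ih, presentedBracket_mk]

/-- Relators in the `e` already act by zero on the Verma module, because they kill the highest
weight vector; relators in the `f` only map it into the maximal submodule. The commutation relators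
are the case of exponent `1`. -/
theorem freeRep_vermaGen_mem (lam : Cartan P →ₗ[ℂ] ℂ)
    {r : FreeNonUnitalNonAssocAlgebra ℂ D.Gen} (hr : D.IsRelator r) (m : D.Verma) :
    freeRep D.genParity (vermaGen lam) r m ∈ maxSubmodule lam := by
  have aux : ∀ r, D.IsChevalleyRelator r →
      freeRep D.genParity (vermaGen lam) r m ∈ maxSubmodule lam := fun r hr => by
    rw [freeRep_vermaGen lam r hr]
    exact zero_mem _
  have hrep : ∀ r, freeRep D.genParity (vermaGen lam) r =
      vermaRep lam ((relIdeal D.genParity _).mkQ r) := fun r => rfl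
  have mem_e : ∀ (a b : D.Index) (n : ℕ),
      (∀ c, D.preLie.bracket (D.preChevalley.F c)
        ((D.preLie.bracket (D.preChevalley.E a))^[n] (D.preChevalley.E b)) = 0) →
      freeRep D.genParity (vermaGen lam) ((fun x => D.freeE a * x)^[n] (D.freeE b)) m ∈
        maxSubmodule lam := by
    intro a b n h
    rw [hrep, mkQ_iterate]
    have h1 := vermaRep_eq_zero lam (D.preLie.iterate_bracket_mem (D.preChevalley.E_mem a)
      (D.preChevalley.E_mem b) n) h (vermaRep_iterate_E lam a b n)
    have h2 := LinearMap.congr_fun h1 m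
    rw [LinearMap.zero_apply] at h2
    exact h2 ▸ zero_mem (maxSubmodule lam)
  have mem_f : ∀ (a b : D.Index) (n : ℕ),
      (∀ c, D.preLie.bracket (D.preChevalley.E c)
        ((D.preLie.bracket (D.preChevalley.F a))^[n] (D.preChevalley.F b)) = 0) →
      freeRep D.genParity (vermaGen lam) ((fun x => D.freeF a * x)^[n] (D.freeF b)) m ∈
        maxSubmodule lam := by
    intro a b n h
    rw [hrep, mkQ_iterate]
    exact vermaRep_mem_maxSubmodule lam (D.preLie.iterate_bracket_mem (D.preChevalley.F_mem a)
      (D.preChevalley.F_mem b) n) h (D.preChevalley.isWeight_iterate a b n)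
      (topCoeff_vermaRep_iterate_F lam a b n) m
  cases hr with
  | h_add s t => exact aux _ (.h_add s t)
  | h_smul c t => exact aux _ (.h_smul c t)
  | h_h s t => exact aux _ (.h_h s t)
  | e_f_same a => exact aux _ (.e_f_same a)
  | e_f_ne a b h => exact aux _ (.e_f_ne a b h)
  | h_e t a => exact aux _ (.h_e t a)
  | h_f t a => exact aux _ (.h_f t a)
  | serre_e a b ha hab => exact mem_e a b _ (D.preChevalley.f_serre_e ha hab)
  | serre_f a b ha hab => exact mem_f a b _ (D.preChevalley.e_serre_f ha hab)
  | e_e a b hab => exact mem_e a b 1 (D.preChevalley.f_e_e hab)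
  | f_f a b hab => exact mem_f a b 1 (D.preChevalley.e_f_f hab)

/-- The values of the generators on the irreducible quotient of the Verma module. -/
def irrGen (lam : Cartan P →ₗ[ℂ] ℂ) (g : D.Gen) : Module.End ℂ (D.Verma ⧸ maxSubmodule lam) :=
  (maxSubmodule lam).mapQ (maxSubmodule lam) (vermaGen lam g)
    fun _ hm => apply_mem_maxSubmodule (vermaGen_mem_opAlg lam g) hm

theorem freeRep_irrGen (lam : Cartan P →ₗ[ℂ] ℂ) (x : FreeNonUnitalNonAssocAlgebra ℂ D.Gen) :
    ∀ m, freeRep D.genParity (irrGen lam) x ((maxSubmodule lam).mkQ m) =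
      (maxSubmodule lam).mkQ (freeRep D.genParity (vermaGen lam) x m) := by
  have hx : x ∈ Submodule.span ℂ (Set.range (mono (X := D.Gen))) := by
    rw [span_range_mono]; trivial
  induction hx using Submodule.span_induction with
  | zero => simp
  | add x y _ _ hx hy => intro m; simp only [map_add, LinearMap.add_apply, hx, hy]
  | smul c x _ hx => intro m; simp only [map_smul, LinearMap.smul_apply, hx]
  | mem x hx =>
    obtain ⟨k, rfl⟩ := hx
    simp only [freeRep, freeLinear_mono]
    induction k with
    | ih1 g => intro m; rfl
    | ih2 k l hk hl =>
      intro m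
      have h1 : ∀ {W : Type _} [AddCommGroup W] [Module ℂ W] (g : D.Gen → Module.End ℂ W) (v : W),
          monoRep D.genParity g (k.mul l) v =
            monoRep D.genParity g k (monoRep D.genParity g l v) -
              superSign (monoParity D.genParity k) (monoParity D.genParity l) •
                monoRep D.genParity g l (monoRep D.genParity g k v) := fun _ _ => rfl
      refine (h1 _ _).trans (Eq.trans ?_ (congrArg (maxSubmodule lam).mkQ (h1 _ _)).symm)
      simp only [map_sub, map_smul, hk, hl]

theorem freeRep_irrGen_relator (lam : Cartan P →ₗ[ℂ] ℂ) :
    ∀ r ∈ {r | D.IsRelator r}, freeRep D.genParity (irrGen lam) r = 0 := by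
  intro r hr
  refine LinearMap.ext fun m => ?_
  obtain ⟨m, rfl⟩ := Submodule.Quotient.mk_surjective _ m
  exact (freeRep_irrGen lam r m).trans
    ((Submodule.Quotient.mk_eq_zero _).2 (freeRep_vermaGen_mem lam hr m))

variable (D)

/-- On the highest weight vector, nonzero in the quotient, `t` acts by `lam t`, and functionals
`lam` separate points of `𝔥`. -/
theorem ofCartan_injective : Function.Injective D.ofCartan := by
  rw [injective_iff_map_eq_zero]
  intro t ht
  rw [← Module.forall_dual_apply_eq_zero_iff ℂ]
  intro lam
  let ρ := presentedRep D.isRelator_homogeneous (irrGen lam) (freeRep_irrGen_relator lam)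
  have h1 : ρ (D.ofCartan t) ((maxSubmodule lam).mkQ (D.word [])) =
      lam t • (maxSubmodule lam).mkQ (D.word []) := by
    have h2 : ρ (D.ofCartan t) = irrGen lam (.h t) := freeRep_freeH _ t
    rw [h2]
    change (maxSubmodule lam).mkQ (opH lam t (D.word [])) = _
    rw [opH_word, map_smul]
    simp [wordWt]
  rw [ht, map_zero, LinearMap.zero_apply] at h1
  refine (smul_eq_zero.1 h1.symm).resolve_right fun h => ?_
  exact word_nil_notMem_maxSubmodule lam ((Submodule.Quotient.mk_eq_zero _).1 h)

end OddBorcherdsCartanDatum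

/-! ### The triangular decomposition. -/

namespace OddBorcherdsCartanDatum

variable {I P : Type*} [AddCommGroup P] {D : OddBorcherdsCartanDatum I P}

namespace ChevalleyElements

variable {L : Type*} [AddCommGroup L] [Module ℂ L] {𝓛 : LieSuperalgebra L}
  (C : D.ChevalleyElements 𝓛)

/-- The generators `e_{il}` (for the sign `1`) and `f_{il}` (for the sign `-1`). -/
def gen (ε : ℤˣ) (a : D.Index) : L := if ε = 1 then C.E a else C.F a

@[simp] theorem gen_one (a : D.Index) : C.gen 1 a = C.E a := if_pos rfl

@[simp] theorem gen_neg_one (a : D.Index) : C.gen (-1) a = C.F a := if_neg (by decide)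

theorem gen_mem (ε : ℤˣ) (a : D.Index) : C.gen ε a ∈ 𝓛.part (D.indexParity a.1.1) := by
  rcases Int.units_eq_one_or ε with rfl | rfl
  · rw [gen_one]; exact C.E_mem a
  · rw [gen_neg_one]; exact C.F_mem a

theorem isWeight_gen (ε : ℤˣ) (a : D.Index) :
    C.IsWeight ((ε : ℤ) • D.indexWt a) (C.gen ε a) := by
  intro t
  rcases Int.units_eq_one_or ε with rfl | rfl
  · simp [C.h_e]
  · simp [C.h_f]

theorem exists_bracket_gen_Hc (ε : ℤˣ) (a : D.Index) (t : Cartan P) :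
    ∃ c : ℂ, 𝓛.bracket (C.gen ε a) (C.Hc t) = c • C.gen ε a := by
  refine ⟨-((ε : ℤ) • D.indexWt a) t, ?_⟩
  rw [𝓛.bracket_skew _ _ _ _ (C.gen_mem ε a) (C.Hc_mem t), C.isWeight_gen]
  simp

theorem bracket_gen_same (ε : ℤˣ) (a : D.Index) : ∃ c : ℂ, c ≠ 0 ∧
    𝓛.bracket (C.gen ε a) (C.gen (-ε) a) = ((ε : ℤ) : ℂ) • c • C.Hc (D.coroot a.1.1) := by
  have hl : (a.1.2 : ℂ) ≠ 0 := by exact_mod_cast (Nat.one_le_iff_ne_zero.1 a.2.1)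
  rcases Int.units_eq_one_or ε with rfl | rfl
  · exact ⟨a.1.2, hl, by simp [C.e_f_same]⟩
  · refine ⟨superSign (D.indexParity a.1.1) (D.indexParity a.1.1) * a.1.2, mul_ne_zero
      (left_ne_zero_of_mul_eq_one (superSign_mul_self _ _)) hl, ?_⟩
    rw [neg_neg, gen_one, gen_neg_one, 𝓛.bracket_skew _ _ _ _ (C.F_mem a) (C.E_mem a),
      C.e_f_same, smul_smul]
    simp

theorem bracket_gen_ne (ε : ℤˣ) {a b : D.Index} (hab : a ≠ b) :
    𝓛.bracket (C.gen ε a) (C.gen (-ε) b) = 0 := by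
  rcases Int.units_eq_one_or ε with rfl | rfl
  · simpa using C.e_f_ne a b hab
  · rw [neg_neg, gen_one, gen_neg_one, 𝓛.bracket_skew _ _ _ _ (C.F_mem a) (C.E_mem b),
      C.e_f_ne b a hab.symm, smul_zero, neg_zero]

theorem exists_bracket_gen (ε : ℤˣ) (a b : D.Index) :
    ∃ t, 𝓛.bracket (C.gen ε a) (C.gen (-ε) b) = C.Hc t := by
  by_cases hab : a = b
  · subst hab
    obtain ⟨c, -, h⟩ := C.bracket_gen_same ε a
    exact ⟨((ε : ℤ) : ℂ) • c • D.coroot a.1.1, by rw [h, map_smul, map_smul]⟩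
  · exact ⟨0, by rw [C.bracket_gen_ne ε hab, map_zero]⟩

/-- The iterated brackets of generators of the same sign, with their degrees. -/
inductive IsWord (ε : ℤˣ) : (D.Index →₀ ℤ) → L → Prop
  | gen (a : D.Index) : IsWord ε (Finsupp.single a 1) (C.gen ε a)
  | cons (a : D.Index) (α : D.Index →₀ ℤ) (x : L) (hx : IsWord ε α x) :
    IsWord ε (α + Finsupp.single a 1) (𝓛.bracket (C.gen ε a) x)

variable {C} in
theorem IsWord.exists_isWeight {ε : ℤˣ} {α : D.Index →₀ ℤ} {x : L} (h : C.IsWord ε α x) :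
    ∃ κ, C.IsWeight κ x := by
  induction h with
  | gen a => exact ⟨_, C.isWeight_gen ε a⟩
  | cons a α x _ ih =>
    obtain ⟨κ, hκ⟩ := ih
    exact ⟨_, (C.isWeight_gen ε a).bracket (C.gen_mem ε a) hκ⟩

/-- The span of the Cartan subalgebra and the words of a given sign. -/
def borel (ε : ℤˣ) : Submodule ℂ L :=
  Submodule.span ℂ (Set.range C.Hc ∪ {x | ∃ α, C.IsWord ε α x})

theorem Hc_mem_borel (ε : ℤˣ) (t : Cartan P) : C.Hc t ∈ C.borel ε :=
  Submodule.subset_span (Or.inl ⟨t, rfl⟩)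

variable {C} in
theorem IsWord.mem_borel {ε : ℤˣ} {α : D.Index →₀ ℤ} {x : L} (h : C.IsWord ε α x) :
    x ∈ C.borel ε :=
  Submodule.subset_span (Or.inr ⟨α, h⟩)

theorem bracket_gen_mem_borel (ε : ℤˣ) (a : D.Index) {x : L} (hx : x ∈ C.borel ε) :
    𝓛.bracket (C.gen ε a) x ∈ C.borel ε := by
  unfold borel at hx
  induction hx using Submodule.span_induction with
  | zero => simp
  | add x y _ _ hx hy => rw [map_add]; exact add_mem hx hy
  | smul c x _ hx => rw [map_smul]; exact Submodule.smul_mem _ _ hx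
  | mem x hx =>
    rcases hx with ⟨t, rfl⟩ | ⟨α, hx⟩
    · obtain ⟨c, hc⟩ := C.exists_bracket_gen_Hc ε a t
      rw [hc]
      exact Submodule.smul_mem _ _ (IsWord.gen a).mem_borel
    · exact (hx.cons a).mem_borel

theorem bracket_Hc_mem_borel (ε : ℤˣ) (t : Cartan P) {x : L} (hx : x ∈ C.borel ε) :
    𝓛.bracket (C.Hc t) x ∈ C.borel ε := by
  unfold borel at hx
  induction hx using Submodule.span_induction with
  | zero => simp
  | add x y _ _ hx hy => rw [map_add]; exact add_mem hx hy
  | smul c x _ hx => rw [map_smul]; exact Submodule.smul_mem _ _ hx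
  | mem x hx =>
    rcases hx with ⟨s, rfl⟩ | ⟨α, hx⟩
    · rw [C.h_h]; exact zero_mem _
    · obtain ⟨κ, hκ⟩ := hx.exists_isWeight
      rw [hκ t]
      exact Submodule.smul_mem _ _ hx.mem_borel

/-- Moving the generator past the first letter leaves an element of `𝔥` acting on a shorter word,
and the same problem for that shorter word. -/
theorem bracket_gen_isWord_mem_borel (ε : ℤˣ) (a : D.Index) {α : D.Index →₀ ℤ} {x : L}
    (h : C.IsWord (-ε) α x) : 𝓛.bracket (C.gen ε a) x ∈ C.borel (-ε) := by
  induction h with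
  | gen b =>
    obtain ⟨t, ht⟩ := C.exists_bracket_gen ε a b
    rw [ht]
    exact C.Hc_mem_borel _ t
  | cons b α x hx ih =>
    obtain ⟨t, ht⟩ := C.exists_bracket_gen ε a b
    rw [𝓛.jacobi _ _ _ _ x (C.gen_mem ε a) (C.gen_mem (-ε) b), ht]
    exact add_mem (C.bracket_Hc_mem_borel _ t hx.mem_borel)
      (Submodule.smul_mem _ _ (C.bracket_gen_mem_borel _ b ih))

theorem bracket_gen_mem_sup (ε : ℤˣ) (a : D.Index) {x : L} (hx : x ∈ C.borel 1 ⊔ C.borel (-1)) :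
    𝓛.bracket (C.gen ε a) x ∈ C.borel 1 ⊔ C.borel (-1) := by
  have hle : ∀ η, C.borel η ≤ C.borel 1 ⊔ C.borel (-1) := by
    intro η
    rcases Int.units_eq_one_or η with rfl | rfl
    · exact le_sup_left
    · exact le_sup_right
  have key : ∀ η, ∀ x ∈ C.borel η, 𝓛.bracket (C.gen ε a) x ∈ C.borel 1 ⊔ C.borel (-1) := by
    intro η x hx
    by_cases h : η = ε
    · subst h
      exact hle _ (C.bracket_gen_mem_borel _ a hx)
    · obtain rfl : η = -ε := Int.units_ne_iff_eq_neg.1 h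
      unfold borel at hx
      induction hx using Submodule.span_induction with
      | zero => simp
      | add x y _ _ hx hy => rw [map_add]; exact add_mem hx hy
      | smul c x _ hx => rw [map_smul]; exact Submodule.smul_mem _ _ hx
      | mem x hx =>
        rcases hx with ⟨t, rfl⟩ | ⟨α, hx⟩
        · exact hle ε (C.bracket_gen_mem_borel ε a (C.Hc_mem_borel ε t))
        · exact hle _ (C.bracket_gen_isWord_mem_borel ε a hx)
  obtain ⟨y, hy, z, hz, rfl⟩ := Submodule.mem_sup.1 hx
  rw [map_add]
  exact add_mem (key 1 y hy) (key (-1) z hz)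

theorem bracket_Hc_mem_sup (t : Cartan P) {x : L} (hx : x ∈ C.borel 1 ⊔ C.borel (-1)) :
    𝓛.bracket (C.Hc t) x ∈ C.borel 1 ⊔ C.borel (-1) := by
  obtain ⟨y, hy, z, hz, rfl⟩ := Submodule.mem_sup.1 hx
  rw [map_add]
  exact add_mem (Submodule.mem_sup_left (C.bracket_Hc_mem_borel 1 t hy))
    (Submodule.mem_sup_right (C.bracket_Hc_mem_borel (-1) t hz))

end ChevalleyElements

/-! ### The Borcherds–Bozec superalgebra as a root-graded algebra. -/

variable (D)

open SuperPresentation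

/-- The generators of the Borcherds-Bozec superalgebra. -/
def chevalley : D.ChevalleyElements D.lieSuper :=
  D.presentedChevalley D.isRelator_homogeneous fun _ h => IsChevalleyRelator.isRelator D h

/-- The degrees of the generators. -/
def genDeg : D.Gen → (D.Index →₀ ℤ)
  | .e a => Finsupp.single a 1
  | .f a => -Finsupp.single a 1
  | .h _ => 0

/-- The parity of a degree. -/
def degParity : (D.Index →₀ ℤ) →+ ZMod 2 :=
  (Finsupp.linearCombination ℤ fun a : D.Index => D.indexParity a.1.1).toAddMonoidHom

/-- The weight of a degree. -/
def degWt : (D.Index →₀ ℤ) →+ Cartan P →ₗ[ℂ] ℂ :=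
  (Finsupp.linearCombination ℤ D.indexWt).toAddMonoidHom

/-- The element of the Cartan subalgebra which represents the weight of a degree. -/
def degCartan : (D.Index →₀ ℤ) →+ Cartan P :=
  (Finsupp.linearCombination ℤ fun a : D.Index =>
    ((a.1.2 : ℂ) * D.d a.1.1) • D.coroot a.1.1).toAddMonoidHom

theorem degParity_single (a : D.Index) :
    D.degParity (Finsupp.single a 1) = D.indexParity a.1.1 := by
  simp [degParity]

theorem degWt_single (a : D.Index) : D.degWt (Finsupp.single a 1) = D.indexWt a := by
  simp [degWt]

theorem degCartan_single (a : D.Index) :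
    D.degCartan (Finsupp.single a 1) = ((a.1.2 : ℂ) * D.d a.1.1) • D.coroot a.1.1 := by
  simp [degCartan]

theorem degParity_genDeg (g : D.Gen) : D.degParity (D.genDeg g) = D.genParity g := by
  have h : ∀ a : ZMod 2, -a = a := by decide
  cases g with
  | e a => exact D.degParity_single a
  | f a => rw [genDeg, map_neg, degParity_single, h]; rfl
  | h t => exact map_zero _

theorem isRelator_mem_freeComp : ∀ r ∈ {r | D.IsRelator r}, ∃ γ, r ∈ freeComp D.genDeg γ := by
  have hE : ∀ a, D.freeE a ∈ freeComp D.genDeg (Finsupp.single a 1) := fun a =>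
    of_mem_freeComp (δ := D.genDeg) (Gen.e a)
  have hF : ∀ a, D.freeF a ∈ freeComp D.genDeg (-Finsupp.single a 1) := fun a =>
    of_mem_freeComp (δ := D.genDeg) (Gen.f a)
  have hH : ∀ t, D.freeH t ∈ freeComp D.genDeg 0 := fun t =>
    of_mem_freeComp (δ := D.genDeg) (Gen.h t)
  intro r hr
  cases hr with
  | h_add s t => exact ⟨0, sub_mem (hH _) (add_mem (hH _) (hH _))⟩
  | h_smul c t => exact ⟨0, sub_mem (hH _) (Submodule.smul_mem _ _ (hH _))⟩
  | h_h s t => exact ⟨_, mul_mem_freeComp (hH s) (hH t)⟩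
  | e_f_same a =>
    refine ⟨0, sub_mem ?_ (Submodule.smul_mem _ _ (hH _))⟩
    simpa using mul_mem_freeComp (hE a) (hF a)
  | e_f_ne a b _ => exact ⟨_, mul_mem_freeComp (hE a) (hF b)⟩
  | h_e t a =>
    have h := mul_mem_freeComp (hH t) (hE a)
    rw [zero_add] at h
    exact ⟨_, sub_mem h (Submodule.smul_mem _ _ (hE a))⟩
  | h_f t a =>
    have h := mul_mem_freeComp (hH t) (hF a)
    rw [zero_add] at h
    exact ⟨_, add_mem h (Submodule.smul_mem _ _ (hF a))⟩
  | serre_e a b _ _ => exact ⟨_, iterate_mul_mem_freeComp (hE a) (hE b) _⟩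
  | serre_f a b _ _ => exact ⟨_, iterate_mul_mem_freeComp (hF a) (hF b) _⟩
  | e_e a b _ => exact ⟨_, mul_mem_freeComp (hE a) (hE b)⟩
  | f_f a b _ => exact ⟨_, mul_mem_freeComp (hF a) (hF b)⟩

/-- The components of the Borcherds-Bozec superalgebra for the grading by degrees. -/
abbrev degComp (γ : D.Index →₀ ℤ) : Submodule ℂ D.BBSuper :=
  presentedComp D.genParity {r | D.IsRelator r} D.genDeg γ

theorem gen_mem_degComp (ε : ℤˣ) (a : D.Index) :
    D.chevalley.gen ε a ∈ D.degComp ((ε : ℤ) • Finsupp.single a 1) := by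
  rcases Int.units_eq_one_or ε with rfl | rfl
  · rw [ChevalleyElements.gen_one, Units.val_one, one_smul]
    exact ⟨_, of_mem_freeComp (δ := D.genDeg) (Gen.e a), rfl⟩
  · rw [ChevalleyElements.gen_neg_one, Units.val_neg, Units.val_one, neg_one_smul]
    exact ⟨_, of_mem_freeComp (δ := D.genDeg) (Gen.f a), rfl⟩

theorem Hc_mem_degComp (t : Cartan P) : D.chevalley.Hc t ∈ D.degComp 0 :=
  ⟨_, of_mem_freeComp (δ := D.genDeg) (Gen.h t), rfl⟩

theorem mkQ_mono_mem_part (m : FreeMagma D.Gen) :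
    (relIdeal D.genParity {r | D.IsRelator r}).mkQ (mono m) ∈
      D.lieSuper.part (monoParity D.genParity m) :=
  ⟨_, Submodule.subset_span ⟨m, rfl, rfl⟩, rfl⟩

theorem mkQ_mono_mul (m n : FreeMagma D.Gen) :
    (relIdeal D.genParity {r | D.IsRelator r}).mkQ (mono (m * n)) =
      D.lieSuper.bracket ((relIdeal D.genParity {r | D.IsRelator r}).mkQ (mono m))
        ((relIdeal D.genParity {r | D.IsRelator r}).mkQ (mono n)) := by
  rw [mono_mul]; rfl

theorem isWeight_mkQ_mono (m : FreeMagma D.Gen) :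
    D.chevalley.IsWeight (D.degWt (monoDeg D.genDeg m))
      ((relIdeal D.genParity {r | D.IsRelator r}).mkQ (mono m)) := by
  induction m with
  | ih1 g =>
    intro t
    cases g with
    | e a =>
      change _ = D.degWt (Finsupp.single a 1) t • _
      rw [degWt_single]
      exact D.chevalley.h_e t a
    | f a =>
      change _ = D.degWt (-Finsupp.single a 1) t • _
      rw [map_neg, degWt_single]
      exact D.chevalley.h_f t a
    | h s =>
      change _ = D.degWt 0 t • _
      rw [map_zero, LinearMap.zero_apply, zero_smul]
      exact D.chevalley.h_h t s
  | ih2 m n hm hn =>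
    rw [mkQ_mono_mul]
    change D.chevalley.IsWeight (D.degWt (monoDeg D.genDeg m + monoDeg D.genDeg n)) _
    rw [map_add]
    exact hm.bracket (D.mkQ_mono_mem_part m) hn

theorem bracket_Hc_of_mem_degComp {γ : D.Index →₀ ℤ} {x : D.BBSuper} (hx : x ∈ D.degComp γ)
    (t : Cartan P) : D.lieSuper.bracket (D.chevalley.Hc t) x = D.degWt γ t • x := by
  obtain ⟨x, hx, rfl⟩ := hx
  unfold freeComp at hx
  induction hx using Submodule.span_induction with
  | zero => simp
  | add x y _ _ hx hy => rw [map_add, map_add, hx, hy, smul_add]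
  | smul c x _ hx => rw [map_smul, map_smul, hx, smul_comm]
  | mem x hx =>
    obtain ⟨m, rfl, rfl⟩ := hx
    exact D.isWeight_mkQ_mono m t

/-- Stability under the generators passes to all monomials, because the adjoint action of a bracket
is a supercommutator; applied to the right factor of a product, it puts every monomial in the sum.
-/
theorem mem_borel_sup_borel (x : D.BBSuper) :
    x ∈ D.chevalley.borel 1 ⊔ D.chevalley.borel (-1) := by
  set U := D.chevalley.borel 1 ⊔ D.chevalley.borel (-1)
  have hbr : ∀ m : FreeMagma D.Gen, ∀ y ∈ U,
      D.lieSuper.bracket ((relIdeal D.genParity {r | D.IsRelator r}).mkQ (mono m)) y ∈ U := by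
    intro m
    induction m with
    | ih1 g =>
      intro y hy
      cases g with
      | e a =>
        have h := D.chevalley.bracket_gen_mem_sup 1 a hy
        rw [ChevalleyElements.gen_one] at h
        exact h
      | f a =>
        have h := D.chevalley.bracket_gen_mem_sup (-1) a hy
        rw [ChevalleyElements.gen_neg_one] at h
        exact h
      | h t => exact D.chevalley.bracket_Hc_mem_sup t hy
    | ih2 m n hm hn =>
      intro y hy
      have h := D.lieSuper.jacobi _ _ _ _ y (D.mkQ_mono_mem_part m) (D.mkQ_mono_mem_part n)
      rw [mkQ_mono_mul, eq_sub_of_add_eq h.symm]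
      exact sub_mem (hm _ (hn _ hy)) (Submodule.smul_mem _ _ (hn _ (hm _ hy)))
  refine presented_induction (zero_mem _) (fun _ _ => add_mem)
    (fun _ _ => Submodule.smul_mem _ _) (fun m => ?_) x
  induction m with
  | ih1 g =>
    cases g with
    | e a =>
      have h := (ChevalleyElements.IsWord.gen (C := D.chevalley) (ε := 1) a).mem_borel
      rw [ChevalleyElements.gen_one] at h
      exact Submodule.mem_sup_left h
    | f a =>
      have h := (ChevalleyElements.IsWord.gen (C := D.chevalley) (ε := -1) a).mem_borel
      rw [ChevalleyElements.gen_neg_one] at h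
      exact Submodule.mem_sup_right h
    | h t => exact Submodule.mem_sup_left (D.chevalley.Hc_mem_borel 1 t)
  | ih2 m n hm hn =>
    rw [mkQ_mono_mul]
    exact hbr m _ hn

theorem eq_top_of_closed (S : Submodule ℂ D.BBSuper) (hH : ∀ t, D.ofCartan t ∈ S)
    (hgen : ∀ ε a, D.chevalley.gen ε a ∈ S)
    (hbr : ∀ (ε : ℤˣ) a x α, 0 < α → x ∈ S → x ∈ D.degComp ((ε : ℤ) • α) →
      D.lieSuper.bracket (D.chevalley.gen ε a) x ∈ S) : S = ⊤ := by
  have hword : ∀ {ε : ℤˣ} {α x}, D.chevalley.IsWord ε α x →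
      0 < α ∧ x ∈ D.degComp ((ε : ℤ) • α) ∧ x ∈ S := by
    intro ε α x h
    induction h with
    | gen a => exact ⟨RootGraded.δ_pos a, D.gen_mem_degComp ε a, hgen ε a⟩
    | cons a α x _ ih =>
      refine ⟨add_pos ih.1 (RootGraded.δ_pos a), ?_, hbr ε a x α ih.1 ih.2.2 ih.2.1⟩
      rw [add_comm, smul_add]
      exact presentedBracket_mem_presentedComp (D.gen_mem_degComp ε a) ih.2.1
  have hle : ∀ ε, D.chevalley.borel ε ≤ S := by
    intro ε
    refine Submodule.span_le.2 ?_
    rintro x (⟨t, rfl⟩ | ⟨α, hx⟩)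
    · exact hH t
    · exact (hword hx).2.2
  exact eq_top_iff.2 fun x _ => sup_le (hle 1) (hle (-1)) (D.mem_borel_sup_borel x)

/-- The coroots are independent, so their values can be prescribed. With these values `l d_i h_i`,
which represents the weight of `e_{il}`, is sent to `l`. -/
theorem exists_xi : ∃ ξ : Cartan P →ₗ[ℂ] ℂ, ∀ i, ξ (D.coroot i) = (D.d i : ℂ)⁻¹ := by
  obtain ⟨ξ, hξ⟩ := LinearMap.exists_extend
    (Finsupp.linearCombination ℂ (fun i => (D.d i : ℂ)⁻¹) ∘ₗ D.linearIndependent_coroot.repr)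
  refine ⟨ξ, fun i => ?_⟩
  have h := LinearMap.congr_fun hξ ⟨D.coroot i, D.coroot_mem i⟩
  have h2 : D.linearIndependent_coroot.repr ⟨D.coroot i, D.coroot_mem i⟩ =
      Finsupp.single i 1 :=
    D.linearIndependent_coroot.repr_eq_single i _ rfl
  simpa [h2] using h

section RootGraded

variable (H : Submodule ℂ (Cartan P)) (hH : IsCompl D.cartanPrime H)

theorem d_ne_zero (i : I) : (D.d i : ℂ) ≠ 0 := by exact_mod_cast (D.d_pos i).ne'

theorem cartanForm_degCartan (α : D.Index →₀ ℤ) (v : Cartan P) :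
    D.cartanForm H hH (D.degCartan α) v = D.degWt α v := by
  induction α using Finsupp.induction_linear with
  | zero => simp
  | add α β hα hβ => rw [map_add, map_add, map_add, LinearMap.add_apply, LinearMap.add_apply, hα, hβ]
  | single a n =>
    rw [← mul_one n, ← smul_eq_mul, ← Finsupp.smul_single, map_zsmul, map_zsmul, map_zsmul,
      LinearMap.smul_apply, LinearMap.smul_apply, degCartan_single, degWt_single, map_smul,
      LinearMap.smul_apply, cartanForm_symm, cartanForm_coroot, indexWt, LinearMap.smul_apply,
      smul_eq_mul, smul_eq_mul]
    have := D.d_ne_zero a.1.1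
    field_simp

/-- The grading of the Borcherds-Bozec superalgebra by degrees. -/
def rootGraded (hnd : (D.cartanForm H hH).Nondegenerate) :
    RootGraded D.Index (Cartan P) D.lieSuper where
  parity := D.degParity
  comp := D.degComp
  comp_le α := presentedComp_le_part D.degParity D.degParity_genDeg α
  bracket_mem := presentedBracket_mem_presentedComp
  scale := presentedScale D.isRelator_mem_freeComp
  scale_apply s {_ _} hx := presentedScale_apply D.isRelator_mem_freeComp s hx
  iSup_comp := iSup_presentedComp
  car := D.ofCartan
  car_injective := D.ofCartan_injective
  car_mem := D.Hc_mem_degComp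
  gen := D.chevalley.gen
  gen_mem := D.gen_mem_degComp
  wt := D.degWt
  car_bracket := D.bracket_Hc_of_mem_degComp
  form := D.cartanForm H hH
  form_symm := D.cartanForm_symm H hH
  form_nondeg := hnd.1
  t := D.degCartan
  form_t := D.cartanForm_degCartan H hH
  gen_bracket_same ε a := by
    obtain ⟨c, hc, h⟩ := D.chevalley.bracket_gen_same ε a
    have hl : (a.1.2 : ℂ) ≠ 0 := by exact_mod_cast (Nat.one_le_iff_ne_zero.1 a.2.1)
    have hd := D.d_ne_zero a.1.1
    -- The bracket is a multiple of `h_i`, while the representing element is `l d_i h_i`.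
    refine ⟨c * ((a.1.2 : ℂ) * D.d a.1.1)⁻¹, mul_ne_zero hc (inv_ne_zero (mul_ne_zero hl hd)), ?_⟩
    rw [h, map_zsmul, degCartan_single, ← Int.cast_smul_eq_zsmul ℂ, smul_smul, smul_smul, smul_smul,
      map_smul]
    change _ = _ • D.chevalley.Hc _
    congr 1
    field_simp
  gen_bracket_ne ε a b hab := D.chevalley.bracket_gen_ne ε hab
  xi := D.exists_xi.choose
  w a := a.1.2
  w_pos a := a.2.1
  xi_t a := by
    rw [degCartan_single, map_smul, D.exists_xi.choose_spec, smul_eq_mul]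
    have := D.d_ne_zero a.1.1
    field_simp
  span_top := D.eq_top_of_closed

theorem gen_serre (ε : ℤˣ) {a b : D.Index} (ha : D.A a.1.1 a.1.1 = 2) (hab : a ≠ b) :
    (D.lieSuper.bracket (D.chevalley.gen ε a))^[(1 - (b.1.2 : ℤ) * D.A a.1.1 b.1.1).toNat]
      (D.chevalley.gen ε b) = 0 := by
  rcases Int.units_eq_one_or ε with rfl | rfl
  · rw [ChevalleyElements.gen_one, ChevalleyElements.gen_one]
    exact (mkQ_iterate _ _ _).symm.trans ((Submodule.Quotient.mk_eq_zero _).2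
      (relator_mem (.rel _ (IsRelator.serre_e a b ha hab))))
  · rw [ChevalleyElements.gen_neg_one, ChevalleyElements.gen_neg_one]
    exact (mkQ_iterate _ _ _).symm.trans ((Submodule.Quotient.mk_eq_zero _).2
      (relator_mem (.rel _ (IsRelator.serre_f a b ha hab))))

theorem bracket_gen_gen_eq_zero (ε : ℤˣ) {a b : D.Index} (hab : D.A a.1.1 b.1.1 = 0) :
    D.lieSuper.bracket (D.chevalley.gen ε a) (D.chevalley.gen ε b) = 0 := by
  rcases Int.units_eq_one_or ε with rfl | rfl
  · rw [ChevalleyElements.gen_one, ChevalleyElements.gen_one]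
    exact (Submodule.Quotient.mk_eq_zero _).2 (relator_mem (.rel _ (IsRelator.e_e a b hab)))
  · rw [ChevalleyElements.gen_neg_one, ChevalleyElements.gen_neg_one]
    exact (Submodule.Quotient.mk_eq_zero _).2 (relator_mem (.rel _ (IsRelator.f_f a b hab)))

theorem satisfiesSerre_rootGraded (hnd : (D.cartanForm H hH).Nondegenerate) :
    (D.rootGraded H hH hnd).SatisfiesSerre fun a b =>
      (a.1.2 : ℤ) * b.1.2 * (D.d b.1.1 * D.A b.1.1 a.1.1) where
  wt_t a b := by
    change D.degWt (Finsupp.single a 1) (D.degCartan (Finsupp.single b 1)) = _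
    rw [degWt_single, degCartan_single, map_smul, indexWt_coroot, smul_eq_mul]
    push_cast
    ring
  off_diag a b hab := by
    have hA : D.A b.1.1 a.1.1 ≤ 0 := by
      -- Distinct indices `(i, l)` and `(i, k)` can share `i` only when `i` is imaginary, and then
      -- `a_{ii} ≤ 0`.
      by_cases h : a.1.1 = b.1.1
      · rcases D.diag a.1.1 with h2 | h2
        · exact absurd h (D.fst_ne_fst h2 hab)
        · rw [← h]; exact h2.1
      · exact D.off_diag _ _ (Ne.symm h)
    exact mul_nonpos_of_nonneg_of_nonpos (by positivity)
      (mul_nonpos_of_nonneg_of_nonpos (D.d_pos _).le hA)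
  nilpotent ε a b ha := by
    have hA : D.A a.1.1 a.1.1 = 2 := by
      refine (D.diag a.1.1).resolve_right fun h => ha.not_ge ?_
      exact mul_nonpos_of_nonneg_of_nonpos (by positivity)
        (mul_nonpos_of_nonneg_of_nonpos (D.d_pos _).le h.1)
    by_cases hab : a = b
    · subst hab
      exact ⟨2, D.lieSuper.bracket_bracket_self (D.chevalley.gen_mem ε a)⟩
    · exact ⟨_, D.gen_serre ε hA hab⟩
  comm ε a b hab := by
    refine D.bracket_gen_gen_eq_zero ε (D.A_eq_zero_symm ?_)
    have ha := a.2.1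
    have hb := b.2.1
    have hd := D.d_pos b.1.1
    have h1 : (a.1.2 : ℤ) * b.1.2 ≠ 0 := by positivity
    exact (mul_eq_zero.1 ((mul_eq_zero.1 hab).resolve_left h1)).resolve_left hd.ne'

end RootGraded

end OddBorcherdsCartanDatum

/-! ### Weight spaces of the Cartan subalgebra. -/

namespace RootGraded

variable {J V L : Type*} [AddCommGroup V] [Module ℂ V] [AddCommGroup L] [Module ℂ L]
  {𝓛 : LieSuperalgebra L} (S : RootGraded J V 𝓛)

theorem bracket_car_right (x : L) (v : V) : S.br x (S.car v) = -S.br (S.car v) x := by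
  induction x using S.comp_induction with
  | zero => simp
  | add x y hx hy => rw [map_add, LinearMap.add_apply, hx, hy, map_add, neg_add]
  | mem α x hx => rw [S.skew hx (S.car_mem v)]; simp

theorem bracket_car_bracket (v : V) (x y : L) :
    S.br (S.car v) (S.br x y) = S.br (S.br (S.car v) x) y + S.br x (S.br (S.car v) y) := by
  induction x using S.comp_induction with
  | zero => simp
  | add x x' hx hx' => simp only [map_add, LinearMap.add_apply, hx, hx']; abel
  | mem α x hx => rw [S.jac (S.car_mem v) hx]; simp

theorem proj_bracket_car (α : J →₀ ℤ) (v : V) (x : L) :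
    S.proj α (S.br (S.car v) x) = S.br (S.car v) (S.proj α x) := by
  induction x using S.comp_induction with
  | zero => simp
  | add x y hx hy => simp only [map_add, hx, hy]
  | mem β x hx =>
    rw [S.car_bracket hx, map_smul]
    by_cases h : β = α
    · subst h; rw [S.proj_same hx, S.car_bracket hx]
    · rw [S.proj_ne hx h]; simp

/-- A zero weight would make `t α = 0` by nondegeneracy on `𝔥`, hence the height of `α` zero. -/
theorem wt_ne_zero {α : J →₀ ℤ} {x : L} (hx : x ∈ S.comp α) (hα : α ≠ 0) (hx0 : x ≠ 0) :
    S.wt α ≠ 0 := by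
  intro h
  have ht : S.t α = 0 := S.form_nondeg _ fun u => by rw [S.form_t, h, LinearMap.zero_apply]
  have h1 := S.xi_t_eq α
  rw [ht, map_zero] at h1
  exact S.ht_ne_zero_of_ne hx hα hx0 (by exact_mod_cast h1.symm)

/-- The Cartan subalgebra is its own centralizer. -/
theorem exists_car_of_bracket_eq_zero {x : L} (hx : ∀ v, S.br (S.car v) x = 0) :
    ∃ v, S.car v = x := by
  have h : ∀ α, α ≠ 0 → S.proj α x = 0 := by
    intro α hα
    by_contra h0
    refine S.wt_ne_zero (S.proj_mem α x) hα h0 (LinearMap.ext fun v => ?_)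
    have h1 := S.proj_bracket_car α v x
    rw [hx, map_zero, S.car_bracket (S.proj_mem α x)] at h1
    exact (smul_eq_zero.1 h1.symm).resolve_right h0
  obtain ⟨s, hs⟩ := S.exists_sum_proj x
  classical
  have h2 := hs (insert 0 s) (Finset.subset_insert 0 s)
  rw [Finset.sum_eq_single_of_mem 0 (Finset.mem_insert_self 0 s) fun α _ hα => h α hα] at h2
  exact S.exists_car (h2 ▸ S.proj_mem 0 x)

/-- Different degrees can have the same weight, so orthogonality of weight spaces comes from
invariance under `𝔥` instead of the grading. -/
theorem B_eq_zero_of_weight {κ μ : V → ℂ} {x y : L} (hx : ∀ v, S.br (S.car v) x = κ v • x)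
    (hy : ∀ v, S.br (S.car v) y = μ v • y) {v : V} (hv : κ v + μ v ≠ 0) : S.B x y = 0 := by
  have h := S.B_invariant x (S.car v) y
  rw [S.bracket_car_right, hx, hy, map_neg, map_smul, map_smul, LinearMap.neg_apply,
    LinearMap.smul_apply, smul_eq_mul, smul_eq_mul] at h
  refine (mul_eq_zero.1 (?_ : (κ v + μ v) * S.B x y = 0)).resolve_left hv
  linear_combination -h

/-- The bracket has weight zero and therefore lies in `𝔥`; by invariance it pairs with each `v` as
`(x, y) κ v`, which determines it. -/
theorem bracket_eq_of_weight {κ : V → ℂ} {x y : L} (hx : ∀ v, S.br (S.car v) x = κ v • x)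
    (hy : ∀ v, S.br (S.car v) y = -κ v • y) {t : V} (ht : ∀ v, S.form t v = κ v) :
    S.br x y = S.B x y • S.car t := by
  obtain ⟨u, hu⟩ := S.exists_car_of_bracket_eq_zero (x := S.br x y) fun v => by
    rw [S.bracket_car_bracket, hx, hy, map_smul, map_smul, LinearMap.smul_apply]
    module
  have h : u - S.B x y • t = 0 := S.form_nondeg _ fun v => by
    have h1 := S.B_invariant x y (S.car v)
    rw [← hu, S.B_car, S.bracket_car_right, hy, map_neg, map_smul] at h1
    rw [map_sub, map_smul, LinearMap.sub_apply, LinearMap.smul_apply, ht, h1, smul_eq_mul,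
      smul_eq_mul]
    ring
  rw [← hu, sub_eq_zero.1 h, map_smul]

end RootGraded

theorem cartanEval_add {P : Type*} [AddCommGroup P] (μ μ' : P) :
    cartanEval (μ + μ') = cartanEval μ + cartanEval μ' := by
  simp only [cartanEval, map_add, LinearMap.baseChange_add, LinearMap.comp_add]

theorem cartanEval_zero {P : Type*} [AddCommGroup P] : cartanEval (0 : P) = 0 := by
  simp only [cartanEval, map_zero, LinearMap.baseChange_zero, LinearMap.comp_zero]

theorem cartanEval_neg {P : Type*} [AddCommGroup P] (μ : P) :
    cartanEval (-μ) = -cartanEval μ := by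
  rw [eq_neg_iff_add_eq_zero, ← cartanEval_add, neg_add_cancel, cartanEval_zero]

/-- For a free group `P`, the functionals in `Hom(P, ℤ)` separate points. -/
theorem exists_cartanEval_ne_zero {P : Type*} [AddCommGroup P] [Module.Free ℤ P] {μ : P}
    (hμ : μ ≠ 0) : ∃ v, cartanEval μ v ≠ 0 := by
  by_contra! h
  refine hμ ((Module.forall_dual_apply_eq_zero_iff ℤ μ).1 fun g => ?_)
  have := h (1 ⊗ₜ[ℤ] g)
  rw [cartanEval_tmul, mul_one] at this
  exact_mod_cast this

namespace OddBorcherdsCartanDatum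

variable {I P : Type*} [AddCommGroup P] (D : OddBorcherdsCartanDatum I P)

theorem exists_nu_eq (H : Submodule ℂ (Cartan P)) (hH : IsCompl D.cartanPrime H) {α : P}
    (hα : α ∈ D.rootLattice) : ∃ t, D.nu H hH t = cartanEval α := by
  induction hα using AddSubgroup.closure_induction with
  | mem α hα =>
    obtain ⟨i, rfl⟩ := hα
    refine ⟨(D.d i : ℂ) • D.coroot i, LinearMap.ext fun v => ?_⟩
    rw [map_smul, LinearMap.smul_apply]
    change (D.d i : ℂ) • D.cartanForm H hH _ _ = _
    rw [cartanForm_symm, cartanForm_coroot, smul_eq_mul, mul_inv_cancel_left₀ (D.d_ne_zero i)]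
  | zero => exact ⟨0, by rw [map_zero, cartanEval_zero]⟩
  | add α β _ _ hα hβ =>
    obtain ⟨s, hs⟩ := hα
    obtain ⟨t, ht⟩ := hβ
    exact ⟨s + t, by rw [map_add, hs, ht, cartanEval_add]⟩
  | neg α _ hα =>
    obtain ⟨s, hs⟩ := hα
    exact ⟨-s, by rw [map_neg, hs, cartanEval_neg]⟩

theorem rootGraded_B_symm (H : Submodule ℂ (Cartan P)) (hH : IsCompl D.cartanPrime H)
    (hnd : (D.cartanForm H hH).Nondegenerate) {a b : ZMod 2} {x y : D.BBSuper}
    (hx : x ∈ D.lieSuper.part a) (hy : y ∈ D.lieSuper.part b) :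
    (D.rootGraded H hH hnd).B x y = superSign a b * (D.rootGraded H hH hnd).B y x := by
  replace hx := SuperPresentation.presentedPart_le_iSup D.degParity D.degParity_genDeg a hx
  replace hy := SuperPresentation.presentedPart_le_iSup D.degParity D.degParity_genDeg b hy
  induction hx using Submodule.iSup_induction' with
  | zero => simp
  | add x x' _ _ hx hx' => simp only [map_add, LinearMap.add_apply, hx, hx', mul_add]
  | mem α x hx =>
    induction hy using Submodule.iSup_induction' with
    | zero => simp
    | add y y' _ _ hy hy' => simp only [map_add, LinearMap.add_apply, hy, hy', mul_add]
    | mem β y hy =>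
      have h := (D.rootGraded H hH hnd).B_symm hx hy
      obtain ⟨α, rfl⟩ := α
      obtain ⟨β, rfl⟩ := β
      exact h

end OddBorcherdsCartanDatum

end

theorem proposition2p2 {I P : Type*} [AddCommGroup P] [Module.Free ℤ P]
    (D : OddBorcherdsCartanDatum I P)
    (H : Submodule ℂ (Cartan P)) (hH : IsCompl D.cartanPrime H)
    (hnd : (D.cartanForm H hH).Nondegenerate) :
    ∃ B : LinearMap.BilinForm ℂ D.BBSuper,
      (∀ s t : Cartan P, B (D.ofCartan s) (D.ofCartan t) = D.cartanForm H hH s t) ∧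
      (∀ α ∈ D.rootLattice, ∀ β ∈ D.rootLattice, α + β ≠ 0 →
        ∀ x ∈ D.rootSpace α, ∀ y ∈ D.rootSpace β, B x y = 0) ∧
      B.Nondegenerate ∧
      (∀ a b : ZMod 2, ∀ x ∈ D.lieSuper.part a, ∀ y ∈ D.lieSuper.part b,
        B x y = superSign a b * B y x) ∧
      (∀ x y z : D.BBSuper,
        B (D.lieSuper.bracket x y) z = B x (D.lieSuper.bracket y z)) ∧
      (∀ α ∈ D.rootLattice, ∃ t : Cartan P, D.nu H hH t = cartanEval α ∧
        ∀ x ∈ D.rootSpace α, ∀ y ∈ D.rootSpace (-α),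
          D.lieSuper.bracket x y = B x y • D.ofCartan t) := by
  set S := D.rootGraded H hH hnd with hS
  refine ⟨S.B, S.B_car, ?_, (D.satisfiesSerre_rootGraded H hH hnd).nondegenerate,
    fun a b x hx y hy => D.rootGraded_B_symm H hH hnd hx hy, S.B_invariant, ?_⟩
  · intro α _ β _ hαβ x hx y hy
    obtain ⟨v, hv⟩ := exists_cartanEval_ne_zero hαβ
    rw [cartanEval_add, LinearMap.add_apply] at hv
    exact S.B_eq_zero_of_weight hx hy hv
  · intro α hα
    obtain ⟨t, ht⟩ := D.exists_nu_eq H hH hα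
    refine ⟨t, ht, fun x hx y hy => S.bracket_eq_of_weight hx (fun v => ?_)
      fun v => LinearMap.congr_fun ht v⟩
    have h := hy v
    rw [cartanEval_neg] at h
    exact h
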